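/- **Setting.** Let $\lambda>0$, $0<t_1<\infty$, and let $f:[0,\infty)\to[0,\infty)$ be measurable with $f(0)=0$ (Assumption 0) and $0<a<\infty$, where $a=\int_{\mathbb R^d}f(\|x\|)\,dx$ (Assumption 1). Let $\Psi=\Psi_{(0,t_1)}$ be a Poisson point process on $\mathbb R^d\times(0,t_1)$ with intensity $\lambda\cdot$Lebesgue; a point $p=(x_p,b_p)$ of it is located at $x_p$ and born at time $b_p$. Let $\mathcal Z_0$ (the augmentation) be a point process on $\mathbb R^d\times\{0\}$, independent of $\Psi$. Given all the points, each unordered pair $\{p,q\}$ of distinct points of $\mathcal Z_0\cup\Psi$ carries, independently of the other pairs, independent variables $T_{pq}=T_{qp}\sim (b_p\vee b_q)+\mathrm{Exp}(2f(\|x_p-x_q\|))$ (with $\mathrm{Exp}(0)=\infty$) and $I_{pq}=1-I_{qp}\sim\mathrm{Bernoulli}(1/2)$; $I_{pq}=1$ means that $q$ would kill $p$. It is assumed that, almost surely, (i) for every $p\in\mathcal Z_0\cup\Psi$ only finitely many $z\in\mathcal Z_0$ satisfy $T_{pz}<t_1$; (ii) there is no sequence $p_1,p_2,\dots$ of distinct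 points of $\mathcal Z_0\cup\Psi$, infinitely many of them in $\mathcal Z_0$, such that $(T_{p_np_{n+1}})_n$ is non-increasing with values below $t_1$. **Sheriff** on a set $S$ of points, with an enumeration of $S$ (an injection $S\to\mathbb N$). Every $p\in S$ has a stack of the death sentences $(p,q,T_{pq})$, $q\in S\setminus\{p\}$, $I_{pq}=1$, earliest on top; the investigation stack (IS) is empty. Repeat: (1) if IS is empty, take the first $p$ that has no death certificate and whose top sentence has time $<t_1$, and move that sentence to IS (stop if there is no such $p$); (2) let $(p,q,T)$ be on top of IS. If the stack of $q$ has on top a certificate or sentence with time $>T$ (or has no card left), then $(p,q,T)$ becomes the death certificate of $p$, goes on top of the stack of $p$, and leaves IS; if $q$ has a certificate with time $<T$, then $(p,q,T)$ is discarded; otherwise the top sentence of $q$ is moved to IS. The death time of $p$ is the time on its certificate, and $\infty$ if it never gets one. Let $d_p$ ($p\in\Psi$) be the death times for $S=\Psi$ and $d'_p$ ($p\in\mathcal Z_0\cup\Psi$) those for $S=\mathcal Z_0\cup\Psi$. Put $d_z:=0$ for $z\in\mathcal Z_0$ (these points count as dead in the non-augmented system). **Sheriff$^Z$**, with an enumeration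 of $\mathcal Z_0\cup\Psi$. Every $p\in\mathcal Z_0\cup\Psi$ has a stack $S_p$ of all cards $(p,q,T_{pq})$, $q\ne p$, earliest on top; IS is empty; $e_p=e'_p=\infty$; $\mathcal A(z)=\emptyset$ and $\mathcal Z(z)=\{z\}$ for $z\in\mathcal Z_0$. Write $\mathcal A=\bigcup_z\mathcal A(z)$, $\mathcal Z=\bigcup_z\mathcal Z(z)$, call $p\notin\mathcal A\cup\mathcal Z$ regular, and let $\mathfrak z(p)$ be the $z$ with $p\in\mathcal A(z)\cup\mathcal Z(z)$. A point $p$ is *finished* if $p\in\mathcal Z_0$ and $e'_p<\infty$, or $p\in\Psi$ and $e_p\vee e'_p<\infty$, or no card in $S_p$ has time $<t_1$. Repeat: 1. If IS is empty, copy to IS the top card of the first unfinished point (if all points are finished, nothing is left to do). 2. Let $(p,q,T)$, $T=T_{pq}$, be on top of IS. If $q$ is finished, pop $S_p$ and IS, and return to 1. If the top card of $S_q$ has time $<T$, copy it to IS and repeat 2. 3. Otherwise settle the duel (interchange $p$ and $q$ if the case is missing), then pop IS and return to 1: * $p,q$ regular. $I_{pq}=1$: $e_p:=e'_p:=T$,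 pop $S_q$. $I_{pq}=0$: $e_q:=e'_q:=T$, pop $S_p$. * $p\in\mathcal Z$, $q$ regular. $I_{pq}=1$: $e'_p:=T$, remove $p$ from $\mathcal Z(\mathfrak z(p))$, pop $S_q$. $I_{pq}=0$: $e'_q:=T$, add $q$ to $\mathcal A(\mathfrak z(p))$, pop $S_p$ and $S_q$. * $p\in\mathcal A$, $q$ regular. $I_{pq}=1$: $e_p:=T$, remove $p$ from $\mathcal A(\mathfrak z(p))$, pop $S_q$. $I_{pq}=0$: $e_q:=T$, add $q$ to $\mathcal Z(\mathfrak z(p))$, pop $S_p$ and $S_q$. * $p,q\in\mathcal Z$. $I_{pq}=1$: $e'_p:=T$, remove $p$ from $\mathcal Z(\mathfrak z(p))$, pop $S_q$. $I_{pq}=0$: $e'_q:=T$, remove $q$ from $\mathcal Z(\mathfrak z(q))$, pop $S_p$. * $p,q\in\mathcal A$. $I_{pq}=1$: $e_p:=T$, remove $p$ from $\mathcal A(\mathfrak z(p))$, pop $S_q$. $I_{pq}=0$: $e_q:=T$, remove $q$ from $\mathcal A(\mathfrak z(q))$, pop $S_p$. * $p\in\mathcal Z$, $q\in\mathcal A$: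 pop $S_p$ and $S_q$. For $t\in[0,t_1)$ let $A_t(z)$ be the set of points that were added to $\mathcal A(z)$ in a duel of time $T\le t$ and were not removed from it in a duel of time $T\le t$; define $Z_t(z)$ in the same way from $\mathcal Z(z)$, where $z$ itself belongs to $\mathcal Z(z)$ from time $0$. **Theorem.** Almost surely, for all enumerations of the points used by the three algorithms: 1. Sheriff$^Z$ runs unambiguously: in every state that it reaches, each point of $\mathcal A\cup\mathcal Z$ belongs to $\mathcal A(z)\cup\mathcal Z(z)$ for only one $z$, and exactly one next state is prescribed unless IS is empty and all points are finished. Every point gets finished after finitely many steps. The final values satisfy $e_p=d_p$ for all $p\in\Psi$ and $e'_p=d'_p$ for all $p\in\mathcal Z_0\cup\Psi$. 2. For all $t\in[0,t_1)$ and $p\in\mathcal Z_0\cup\Psi$, $$p\in A_t(z)\text{ for some }z\in\mathcal Z_0\iff d'_p\le t<d_p,\qquad p\in Z_t(z)\text{ for some }z\in\mathcal Z_0\iff d_p\le t<d'_p,$$ and the families $O_{t_1}(z)=\bigcup_{t\in[0,t_1)}A_t(z)\cup\bigcup_{t\in[0,t_1)}Z_t(z)$ of distinct $z\in\mathcal Z_0$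 are disjoint. -/

import Mathlib

open MeasureTheory ProbabilityTheory Set Filter
open scoped NNReal ENNReal

/-! ### Executions of a (possibly nondeterministic) algorithm -/

/-- `s` is an execution of the transition relation `R` from the state `s₀`; an execution that has
no available transition stays where it is. -/
def IsExecution {σ : Type*} (R : σ → σ → Prop) (s₀ : σ) (s : ℕ → σ) : Prop :=
  s 0 = s₀ ∧ ∀ n, R (s n) (s (n + 1)) ∨ ((¬ ∃ s', R (s n) s') ∧ s (n + 1) = s n)

/-- A stack of cards sorted by time, earliest on top, is represented by the set `S` of its cards
together with the times of the cards; `q` is on top of the stack. -/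
def IsTopCard {α : Type*} (time : α → ℝ≥0∞) (S : Set α) (q : α) : Prop :=
  q ∈ S ∧ ∀ r ∈ S, time q ≤ time r

/-! ### The Sheriff algorithm

`pop` is the set of points, `T p q` the connection time of `p` and `q`, `I p q = true` means that
`q` is the killer in the connection of `p` and `q`, `t₁` is the time horizon, and `ord` is the
predefined enumeration of the points. -/

/-- State of the Sheriff algorithm. `q ∈ sentences p` : the death sentence `(p, q, T p q)` is in
the stack of `p`. `cert p = some q` : the death certificate `(p, q, T p q)` is on top of the stack
of `p`. `inv` : the investigation stack, its top being the head of the list; the entry `(p, q)`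
stands for the sentence `(p, q, T p q)`. -/
structure SheriffState (α : Type*) where
  sentences : α → Set α
  cert : α → Option α
  inv : List (α × α)

namespace SheriffState

variable {α : Type*} [DecidableEq α]

/-- The initial state: every point has the stack of all its death sentences. -/
def initial (pop : Set α) (I : α → α → Bool) : SheriffState α where
  sentences p := {q | p ∈ pop ∧ q ∈ pop ∧ q ≠ p ∧ I p q = true}
  cert _ := none
  inv := []

/-- The sentence `(p, q, T p q)` is moved from the stack of `p` to the investigation stack. -/
def investigate (s : SheriffState α) (p q : α) : SheriffState α where
  sentences := Function.update s.sentences p (s.sentences p \ {q})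
  cert := s.cert
  inv := (p, q) :: s.inv

/-- The stack of `p` has on top a death sentence with time less than `t₁`, and no certificate. -/
def Eligible (pop : Set α) (T : α → α → ℝ≥0∞) (t₁ : ℝ≥0∞) (s : SheriffState α) (p : α) : Prop :=
  p ∈ pop ∧ s.cert p = none ∧ ∃ q, IsTopCard (T p) (s.sentences p) q ∧ T p q < t₁

/-- One step of the Sheriff algorithm. -/
inductive Step (pop : Set α) (T : α → α → ℝ≥0∞) (t₁ : ℝ≥0∞) (ord : α → ℕ) :
    SheriffState α → SheriffState α → Prop
  /-- The investigation stack is empty: the first eligible point is investigated. -/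
  | choose (s : SheriffState α) (p q : α) (h_inv : s.inv = [])
      (h_elig : s.Eligible pop T t₁ p)
      (h_first : ∀ p', s.Eligible pop T t₁ p' → ord p ≤ ord p')
      (h_top : IsTopCard (T p) (s.sentences p) q) :
      Step pop T t₁ ord s (s.investigate p q)
  /-- The killer `q` has a certificate later than `T p q`: the execution happens. -/
  | execute_cert (s : SheriffState α) (p q r : α) (l : List (α × α)) (h_inv : s.inv = (p, q) :: l)
      (h_cert : s.cert q = some r) (h_late : T p q < T q r) :
      Step pop T t₁ ord s { s with cert := Function.update s.cert p (some q), inv := l }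
  /-- The killer `q` has no certificate, and no sentence at or before `T p q` is left in its stack:
  the execution happens. -/
  | execute_sentence (s : SheriffState α) (p q : α) (l : List (α × α))
      (h_inv : s.inv = (p, q) :: l) (h_cert : s.cert q = none)
      (h_late : ∀ r ∈ s.sentences q, T p q < T q r) :
      Step pop T t₁ ord s { s with cert := Function.update s.cert p (some q), inv := l }
  /-- The killer `q` has a certificate earlier than `T p q`: the sentence is discarded. -/
  | discard (s : SheriffState α) (p q r : α) (l : List (α × α)) (h_inv : s.inv = (p, q) :: l)
      (h_cert : s.cert q = some r) (h_early : T q r < T p q) :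
      Step pop T t₁ ord s { s with inv := l }
  /-- Otherwise the top sentence of the stack of `q` is moved to the investigation stack. -/
  | descend (s : SheriffState α) (p q r : α) (l : List (α × α)) (h_inv : s.inv = (p, q) :: l)
      (h_cert : s.cert q = none) (h_top : IsTopCard (T q) (s.sentences q) r)
      (h_early : T q r ≤ T p q) :
      Step pop T t₁ ord s (s.investigate q r)

/-- `σ` is an execution of the Sheriff algorithm on the points `pop` up to the horizon `t₁`. -/
def IsSheriffRun (pop : Set α) (T : α → α → ℝ≥0∞) (I : α → α → Bool) (t₁ : ℝ≥0∞) (ord : α → ℕ)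
    (σ : ℕ → SheriffState α) : Prop :=
  IsExecution (Step pop T t₁ ord) (initial pop I) σ

/-- The death time of `p` found by an execution of Sheriff: the time on its death certificate, and
`∞` if it never receives one. -/
noncomputable def deathTime (T : α → α → ℝ≥0∞) (σ : ℕ → SheriffState α) (p : α) : ℝ≥0∞ :=
  ⨅ (n : ℕ) (q : α) (_ : (σ n).cert p = some q), T p q

open Classical in
/-- The death times of an execution `σ` of Sheriff without the augmentation `Z₀`, extended to the
points of `Z₀`, which count as dead from time `0` on. -/
noncomputable def nonAugmentedDeathTime (Z₀ : Set α) (T : α → α → ℝ≥0∞)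
    (σ : ℕ → SheriffState α) (p : α) : ℝ≥0∞ :=
  if p ∈ Z₀ then 0 else deathTime T σ p

end SheriffState

/-! ### The algorithm Sheriff with zombies

`Z₀` is the set of points of the augmentation, `W` the set of the other points. -/

/-- State of Sheriff with zombies. `q ∈ stack p` : the card `(p, q, T p q)` is in the stack of `p`.
`inv` : the investigation stack, its top being the head of the list. `A z`, `Z z` : the antizombies
and the zombies that are offspring of `z`. -/
structure ZState (α : Type*) where
  stack : α → Set α
  inv : List (α × α)
  e : α → ℝ≥0∞
  e' : α → ℝ≥0∞
  A : α → Set α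
  Z : α → Set α

namespace ZState

variable {α : Type*} [DecidableEq α]

/-- The initial state. -/
def initial (Z₀ W : Set α) : ZState α where
  stack p := {q | p ∈ Z₀ ∪ W ∧ q ∈ Z₀ ∪ W ∧ q ≠ p}
  inv := []
  e _ := ⊤
  e' _ := ⊤
  A _ := ∅
  Z z := {p | z ∈ Z₀ ∧ p = z}

/-- The point `p` is finished. -/
def Finished (Z₀ W : Set α) (T : α → α → ℝ≥0∞) (t₁ : ℝ≥0∞) (s : ZState α) (p : α) : Prop :=
  (p ∈ Z₀ ∧ s.e' p < ⊤) ∨ (p ∈ W ∧ max (s.e p) (s.e' p) < ⊤) ∨ ∀ r ∈ s.stack p, t₁ ≤ T p r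

/-- The point `p` is neither an antizombie nor a zombie. -/
def Regular (s : ZState α) (p : α) : Prop := ∀ z, p ∉ s.A z ∧ p ∉ s.Z z

/-- The card of `p` naming `a` is removed from the stack of `p`. -/
def popCard (s : ZState α) (p a : α) : ZState α :=
  { s with stack := Function.update s.stack p (s.stack p \ {a}) }

/-- `e_p := t`. -/
def setE (s : ZState α) (p : α) (t : ℝ≥0∞) : ZState α :=
  { s with e := Function.update s.e p t }

/-- `e'_p := t`. -/
def setE' (s : ZState α) (p : α) (t : ℝ≥0∞) : ZState α :=
  { s with e' := Function.update s.e' p t }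

/-- `A(z) := S`. -/
def setA (s : ZState α) (z : α) (S : Set α) : ZState α :=
  { s with A := Function.update s.A z S }

/-- `Z(z) := S`. -/
def setZ (s : ZState α) (z : α) (S : Set α) : ZState α :=
  { s with Z := Function.update s.Z z S }

/-- The settlement of the duel of `p` and `q`; `a` and `b` are the top cards of `p` and `q`. The
cases that are missing are obtained by interchanging `p` and `q`. -/
inductive Duel (T : α → α → ℝ≥0∞) (I : α → α → Bool) (p q a b : α) : ZState α → ZState α → Prop
  | regular_regular_true (s : ZState α) (hp : s.Regular p) (hq : s.Regular q) (hI : I p q = true) :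
      Duel T I p q a b s (((s.setE p (T p q)).setE' p (T p q)).popCard q b)
  | regular_regular_false (s : ZState α) (hp : s.Regular p) (hq : s.Regular q)
      (hI : I p q = false) :
      Duel T I p q a b s (((s.setE q (T p q)).setE' q (T p q)).popCard p a)
  | zombie_regular_true (s : ZState α) (z : α) (hp : p ∈ s.Z z) (hq : s.Regular q)
      (hI : I p q = true) :
      Duel T I p q a b s (((s.setE' p (T p q)).setZ z (s.Z z \ {p})).popCard q b)
  | zombie_regular_false (s : ZState α) (z : α) (hp : p ∈ s.Z z) (hq : s.Regular q)
      (hI : I p q = false) :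
      Duel T I p q a b s
        ((((s.setE' q (T p q)).setA z (s.A z ∪ {q})).popCard p a).popCard q b)
  | antizombie_regular_true (s : ZState α) (z : α) (hp : p ∈ s.A z) (hq : s.Regular q)
      (hI : I p q = true) :
      Duel T I p q a b s (((s.setE p (T p q)).setA z (s.A z \ {p})).popCard q b)
  | antizombie_regular_false (s : ZState α) (z : α) (hp : p ∈ s.A z) (hq : s.Regular q)
      (hI : I p q = false) :
      Duel T I p q a b s
        ((((s.setE q (T p q)).setZ z (s.Z z ∪ {q})).popCard p a).popCard q b)
  | zombie_zombie_true (s : ZState α) (z z' : α) (hp : p ∈ s.Z z) (hq : q ∈ s.Z z')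
      (hI : I p q = true) :
      Duel T I p q a b s (((s.setE' p (T p q)).setZ z (s.Z z \ {p})).popCard q b)
  | zombie_zombie_false (s : ZState α) (z z' : α) (hp : p ∈ s.Z z) (hq : q ∈ s.Z z')
      (hI : I p q = false) :
      Duel T I p q a b s (((s.setE' q (T p q)).setZ z' (s.Z z' \ {q})).popCard p a)
  | antizombie_antizombie_true (s : ZState α) (z z' : α) (hp : p ∈ s.A z) (hq : q ∈ s.A z')
      (hI : I p q = true) :
      Duel T I p q a b s (((s.setE p (T p q)).setA z (s.A z \ {p})).popCard q b)
  | antizombie_antizombie_false (s : ZState α) (z z' : α) (hp : p ∈ s.A z) (hq : q ∈ s.A z')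
      (hI : I p q = false) :
      Duel T I p q a b s (((s.setE q (T p q)).setA z' (s.A z' \ {q})).popCard p a)
  | zombie_antizombie (s : ZState α) (z z' : α) (hp : p ∈ s.Z z) (hq : q ∈ s.A z') :
      Duel T I p q a b s ((s.popCard p a).popCard q b)

/-- One step of Sheriff with zombies. -/
inductive Step (Z₀ W : Set α) (T : α → α → ℝ≥0∞) (I : α → α → Bool) (t₁ : ℝ≥0∞) (ord : α → ℕ) :
    ZState α → ZState α → Prop
  /-- The investigation stack is empty: the top card of the first unfinished point is copied. -/
  | choose (s : ZState α) (p q : α) (h_inv : s.inv = []) (h_mem : p ∈ Z₀ ∪ W)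
      (h_unf : ¬ s.Finished Z₀ W T t₁ p)
      (h_first : ∀ p' ∈ Z₀ ∪ W, ¬ s.Finished Z₀ W T t₁ p' → ord p ≤ ord p')
      (h_top : IsTopCard (T p) (s.stack p) q) (h_lt : T p q < t₁) :
      Step Z₀ W T I t₁ ord s { s with inv := [(p, q)] }
  /-- `q` is finished: the stack of `p` and the investigation stack are popped. -/
  | drop (s : ZState α) (p q a : α) (l : List (α × α)) (h_inv : s.inv = (p, q) :: l)
      (h_fin : s.Finished Z₀ W T t₁ q) (h_top : IsTopCard (T p) (s.stack p) a) :
      Step Z₀ W T I t₁ ord s { s.popCard p a with inv := l }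
  /-- The top card of `q` is earlier: it is copied to the investigation stack. -/
  | descend (s : ZState α) (p q r : α) (l : List (α × α)) (h_inv : s.inv = (p, q) :: l)
      (h_unf : ¬ s.Finished Z₀ W T t₁ q) (h_top : IsTopCard (T q) (s.stack q) r)
      (h_early : T q r < T p q) :
      Step Z₀ W T I t₁ ord s { s with inv := (q, r) :: s.inv }
  /-- Otherwise the duel of `p` and `q` is settled and the investigation stack is popped. -/
  | duel (s s₁ : ZState α) (p q a b : α) (l : List (α × α)) (h_inv : s.inv = (p, q) :: l)
      (h_unf : ¬ s.Finished Z₀ W T t₁ q) (h_top_p : IsTopCard (T p) (s.stack p) a)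
      (h_top_q : IsTopCard (T q) (s.stack q) b) (h_late : ¬ T q b < T p q)
      (h_duel : Duel T I p q a b s s₁ ∨ Duel T I q p b a s s₁) :
      Step Z₀ W T I t₁ ord s { s₁ with inv := l }

/-- `s` is an execution of Sheriff with zombies. -/
def IsZRun (Z₀ W : Set α) (T : α → α → ℝ≥0∞) (I : α → α → Bool) (t₁ : ℝ≥0∞) (ord : α → ℕ)
    (s : ℕ → ZState α) : Prop :=
  IsExecution (Step Z₀ W T I t₁ ord) (initial Z₀ W) s

/-- Sheriff with zombies runs unambiguously: in every state that it can reach, a special point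
descends from only one `z`, and exactly one next step is prescribed, unless the investigation stack
is empty and all points are finished, so that there is nothing left to do. -/
def RunsUnambiguously (Z₀ W : Set α) (T : α → α → ℝ≥0∞) (I : α → α → Bool) (t₁ : ℝ≥0∞)
    (ord : α → ℕ) : Prop :=
  ∀ s, Relation.ReflTransGen (Step Z₀ W T I t₁ ord) (initial Z₀ W) s →
    (∀ p z z', p ∈ s.A z ∪ s.Z z → p ∈ s.A z' ∪ s.Z z' → z = z') ∧
    ((s.inv = [] ∧ ∀ p ∈ Z₀ ∪ W, s.Finished Z₀ W T t₁ p) ∨ ∃! s', Step Z₀ W T I t₁ ord s s')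

/-- The time of the card that is looked at in state `s`. -/
noncomputable def currentTime (T : α → α → ℝ≥0∞) (s : ZState α) : ℝ≥0∞ :=
  match s.inv with
  | [] => ⊤
  | (p, q) :: _ => T p q

/-- The set-valued process generated by an execution `s` for a set `K` that the algorithm maintains:
`p` belongs to it at time `t` if `p` was in `K` from the start or was put into `K` on the occasion
of a card with time at most `t`, and was not removed from `K` on the occasion of such a card. -/
def membersAt (T : α → α → ℝ≥0∞) (s : ℕ → ZState α) (K : ZState α → Set α) (t : ℝ≥0∞) : Set α :=
  {p | (p ∈ K (s 0) ∨ ∃ n, p ∉ K (s n) ∧ p ∈ K (s (n + 1)) ∧ (s n).currentTime T ≤ t) ∧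
    ¬ ∃ n, p ∈ K (s n) ∧ p ∉ K (s (n + 1)) ∧ (s n).currentTime T ≤ t}

/-- `A_t(z)`: the antizombies originating from `z` and living at time `t`. -/
def antizombiesAt (T : α → α → ℝ≥0∞) (s : ℕ → ZState α) (z : α) (t : ℝ≥0∞) : Set α :=
  membersAt T s (fun u => u.A z) t

/-- `Z_t(z)`: the zombies originating from `z` and living at time `t`. -/
def zombiesAt (T : α → α → ℝ≥0∞) (s : ℕ → ZState α) (z : α) (t : ℝ≥0∞) : Set α :=
  membersAt T s (fun u => u.Z z) t

/-- The family of offspring of `z` before time `t₁`. -/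
def offspring (T : α → α → ℝ≥0∞) (t₁ : ℝ≥0∞) (s : ℕ → ZState α) (z : α) : Set α :=
  (⋃ t ∈ Ico 0 t₁, antizombiesAt T s z t) ∪ ⋃ t ∈ Ico 0 t₁, zombiesAt T s z t

end ZState

/-! ### The random input -/

/-- The number of points of the configuration `{X j ω | j}` in `B`. -/
noncomputable def pointCount {Ω S : Type*} (X : ℕ → Ω → S) (B : Set S) (ω : Ω) : ℕ∞ :=
  {j | X j ω ∈ B}.encard

/-- The random points `X 0, X 1, …` enumerate a Poisson point process of intensity measure `μ`. -/
structure IsPoissonPoints {Ω S : Type*} [MeasurableSpace Ω] [MeasurableSpace S]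
    (X : ℕ → Ω → S) (μ : Measure S) (P : Measure Ω) : Prop where
  measurable : ∀ j, Measurable (X j)
  law : ∀ B, MeasurableSet B → μ B ≠ ⊤ → ∀ k : ℕ,
    P {ω | pointCount X B ω = k} =
      ENNReal.ofReal (Real.exp (-(μ B).toReal) * (μ B).toReal ^ k / (k.factorial : ℝ))
  indep : ∀ (n : ℕ) (B : Fin n → Set S), (∀ i, MeasurableSet (B i)) →
    Pairwise (fun i j => Disjoint (B i) (B j)) → iIndepFun (fun i => pointCount X (B i)) P

/-- Labels of points: `Sum.inl i` is the `i`-th point of the initial augmentation, `Sum.inr j` the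
`j`-th point born after time `0`. -/
abbrev Label := ℕ ⊕ ℕ

/-- The labels of the points of the augmentation, when it has `N₀` points. -/
def augLabels (N₀ : ℕ∞) : Set Label := {p | ∃ i : ℕ, (i : ℕ∞) < N₀ ∧ p = Sum.inl i}

/-- The labels of the points born after time `0`. -/
def birthLabels : Set Label := Set.range Sum.inr

/-- Space-time positions: the augmentation points `ζ i` are born at time `0`. -/
def position {d : ℕ} (ζ : ℕ → EuclideanSpace ℝ (Fin d)) (ψ : ℕ → EuclideanSpace ℝ (Fin d) × ℝ) :
    Label → EuclideanSpace ℝ (Fin d) × ℝ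
  | Sum.inl i => (ζ i, 0)
  | Sum.inr j => ψ j

/-- The connection time `T_{pq} = max b_p b_q + Exp(2 f(‖x_p - x_q‖))`, where an exponential variable
of rate `c` is obtained as `u / c` from an exponential variable `u` of rate one attached to the
unordered pair; it is infinite for `c = 0`. -/
noncomputable def connTime {d : ℕ} (f : ℝ≥0 → ℝ≥0)
    (pos : Label → EuclideanSpace ℝ (Fin d) × ℝ) (mark : Sym2 Label → ℝ × Bool)
    (p q : Label) : ℝ≥0∞ :=
  ENNReal.ofReal (max (pos p).2 (pos q).2) +
    ENNReal.ofReal (mark s(p, q)).1 / (2 * (f ‖(pos p).1 - (pos q).1‖₊ : ℝ≥0∞))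

/-- The direction `I_{pq}` of the connection, `true` if `q` kills `p`: a coin attached to the
unordered pair, read in a fixed orientation of the pair, so that `I_{qp} = 1 - I_{pq}`. -/
def connDir (mark : Sym2 Label → ℝ × Bool) (p q : Label) : Bool :=
  if Equiv.natSumNatEquivNat p < Equiv.natSumNatEquivNat q then (mark s(p, q)).2
  else !(mark s(p, q)).2

/-! ### Connections without infinite descending chains -/

/-! Almost surely the connections before `t₁` have distinct times, each point takes part in only
finitely many of them, and no infinite chain through distinct points has non-increasing times
(`GoodConnections`). Given this, the argument is deterministic
(`GoodConnections.sheriff_with_zombies`).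

Whether a connection of `p` and `q` kills `p` depends only on `p` and on the earlier connections of
`q`. The three properties make this regress well-founded (`GoodConnections.wellFounded`), so the
rule "a point dies in the first connection whose killer is alive" determines the death times
(`deathTimes_unique`). The same well-foundedness ends every investigation, and since points are
taken up in the order of an enumeration, every card is eventually settled
(`IsInvestigation.eventually_settled`). Sheriff therefore finds a system of death times for its
population.

Sheriff with zombies computes two systems at once: `e` on `W` and `e'` on `Z₀ ∪ W`. A regular point
that is not yet dead is alive in both, a zombie only in the augmented system, an antizombie only in
the non-augmented one. Read in this way, all rows of the duel table say the same: the loser dies in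
exactly those systems in which both duellists are alive (`Invariant.settled_of_duel`). So `e` and
`e'` settle on systems of death times, and uniqueness identifies them with those of the two Sheriff
runs. The outcome of a duel is also unique (`Invariant.settled_unique`), and points enter and leave
the families of zombies and antizombies exactly at their two death times. A special point keeps its
ancestor until it is dead in both systems (`IsZRun.persists`), whence the offspring are disjoint.

On the random side, distinct times come from the continuous marks. For the rest, the factorial
moment measures of a diffuse Poisson process are bounded by product measures (`factorialMoment_le`),
so the expected number of paths of `n` connections that start in `B` and have all times in a window
of length `δ` is at most `(2δC)^n μ(B)`, with `C` the birth rate times `t₁` times the integral of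
`f`. One connection gives local finiteness among births. If `2δC < 1` the bound tends to zero, which
excludes infinite paths inside one window, and a non-increasing sequence of finite times ends in a
single window. The assumptions on the augmentation take care of connections to it and of chains that
return to it forever. -/

/-- The connections of the points of `V` before time `t₁` are symmetric in time, antisymmetric in
direction, take place at distinct times, are locally finite, and have no infinite non-increasing
chain. -/
structure GoodConnections {α : Type*} (V : Set α) (T : α → α → ℝ≥0∞) (I : α → α → Bool)
    (t₁ : ℝ≥0∞) : Prop where
  symm : ∀ p q, T p q = T q p
  flip : ∀ p q, p ≠ q → I q p = !I p q
  inj : ∀ p ∈ V, ∀ q ∈ V, ∀ p' ∈ V, ∀ q' ∈ V, p ≠ q → p' ≠ q' → T p q = T p' q' → T p q < t₁ →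
    s(p, q) = s(p', q')
  finite : ∀ p ∈ V, {q | q ∈ V ∧ T p q < t₁}.Finite
  noChain : ¬ ∃ c : ℕ → α, Function.Injective c ∧ (∀ n, c n ∈ V) ∧
    (∀ n, T (c n) (c (n + 1)) < t₁) ∧ Antitone (fun n => T (c n) (c (n + 1)))

/-- An oriented connection between two points of `V` before time `t₁`. -/
structure IsDart {α : Type*} (V : Set α) (T : α → α → ℝ≥0∞) (t₁ : ℝ≥0∞) (p q : α) : Prop where
  fst_mem : p ∈ V
  snd_mem : q ∈ V
  ne : q ≠ p
  lt : T p q < t₁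

/-- The connection `d'` continues the connection `d` at an earlier time. -/
def DartDescends {α : Type*} (V : Set α) (T : α → α → ℝ≥0∞) (t₁ : ℝ≥0∞) (d' d : α × α) : Prop :=
  IsDart V T t₁ d'.1 d'.2 ∧ IsDart V T t₁ d.1 d.2 ∧ d'.1 = d.2 ∧ T d'.1 d'.2 < T d.1 d.2

/-- `D` is a system of death times for the connections of `V` before time `t₁`: a point dies in the
first connection in which its killer is alive. -/
structure IsDeathTimes {α : Type*} (V : Set α) (T : α → α → ℝ≥0∞) (I : α → α → Bool)
    (t₁ : ℝ≥0∞) (D : α → ℝ≥0∞) : Prop where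
  killer : ∀ p ∈ V, D p < ⊤ → ∃ q, IsDart V T t₁ p q ∧ I p q = true ∧ D p = T p q ∧ T p q < D q
  killed : ∀ p q, IsDart V T t₁ p q → I p q = true → T p q < D q → D p ≤ T p q

namespace GoodConnections

variable {α : Type*} {V : Set α} {T : α → α → ℝ≥0∞} {I : α → α → Bool} {t₁ : ℝ≥0∞}

theorem mono (h : GoodConnections V T I t₁) {W : Set α} (hW : W ⊆ V) :
    GoodConnections W T I t₁ where
  symm := h.symm
  flip := h.flip
  inj p hp q hq p' hp' q' hq' := h.inj p (hW hp) q (hW hq) p' (hW hp') q' (hW hq')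
  finite p hp := (h.finite p (hW hp)).subset fun _ hq => ⟨hW hq.1, hq.2⟩
  noChain := fun ⟨c, hc, hcW, hlt, hanti⟩ => h.noChain ⟨c, hc, fun n => hW (hcW n), hlt, hanti⟩

theorem dart_symm (h : GoodConnections V T I t₁) {p q : α} (hd : IsDart V T t₁ p q) :
    IsDart V T t₁ q p :=
  ⟨hd.snd_mem, hd.fst_mem, hd.ne.symm, by rw [h.symm]; exact hd.lt⟩

theorem eq_of_time_eq (h : GoodConnections V T I t₁) {p q r : α} (hq : IsDart V T t₁ p q)
    (hr : r ∈ V) (hrp : r ≠ p) (heq : T p q = T p r) : r = q := by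
  have := h.inj p hq.fst_mem q hq.snd_mem p hq.fst_mem r hr hq.ne.symm hrp.symm heq hq.lt
  rw [Sym2.eq_iff] at this
  rcases this with h1 | h1
  · exact h1.2.symm
  · exact absurd h1.1.symm hrp

theorem killer_ne (h : GoodConnections V T I t₁) {p q : α} (hpq : q ≠ p) (hI : I p q = true) :
    I q p ≠ true := by
  rw [h.flip p q hpq.symm, hI]; simp

/-- A descending sequence of darts is a walk with strictly decreasing times, but it may revisit
points, whereas `noChain` speaks of distinct points. Visits to one point use different connections,
because the times differ, so by local finiteness there are only finitely many. Erasing the loops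
leaves a chain of distinct points. -/
theorem wellFounded (h : GoodConnections V T I t₁) : WellFounded (DartDescends V T t₁) := by
  rw [wellFounded_iff_isEmpty_descending_chain]
  refine ⟨fun ⟨d, hd⟩ => ?_⟩
  set v : ℕ → α := fun n => (d n).1 with hv
  have hd2 : ∀ n, (d n).2 = v (n + 1) := fun n => (hd n).2.2.1.symm
  have hdart : ∀ n, IsDart V T t₁ (v n) (v (n + 1)) := fun n => by
    have := (hd n).2.1
    rwa [hd2] at this
  have hanti : StrictAnti fun n => T (v n) (v (n + 1)) := by
    refine strictAnti_nat_of_succ_lt fun n => ?_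
    have := (hd n).2.2.2
    rwa [hd2, hd2] at this
  have hfin : ∀ n, {m | v m = v n}.Finite := by
    intro n
    refine Set.Finite.of_finite_image (f := fun m => v (m + 1))
      ((h.finite (v n) (hdart n).fst_mem).subset ?_) ?_
    · rintro _ ⟨m, hm, rfl⟩
      have := (hdart m).lt
      rw [show v m = v n from hm] at this
      exact ⟨(hdart m).snd_mem, this⟩
    · intro m hm m' hm' heq
      refine hanti.injective ?_
      have h1 : v m = v n := hm
      have h2 : v m' = v n := hm'
      have h3 : v (m + 1) = v (m' + 1) := heq
      simp only [h1, h2, h3]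
  have hlast : ∀ n, ∃ m, v m = v n ∧ ∀ k, v k = v n → k ≤ m := by
    intro n
    obtain ⟨m, hm, hmax⟩ := (hfin n).exists_maximal ⟨n, rfl⟩
    exact ⟨m, hm, fun k hk => (le_total k m).elim id fun hmk => hmax hk hmk⟩
  choose last hlast1 hlast2 using hlast
  -- Loop erasure: `k (i + 1)` is the last visit to the point reached right after time `k i`.
  -- Consecutive points of the erased walk are thus joined by a connection that the walk really
  -- uses, at index `k i`.
  let k : ℕ → ℕ := fun i => Nat.rec (last 0) (fun _ m => last (m + 1)) i
  have hksucc : ∀ i, k (i + 1) = last (k i + 1) := fun i => rfl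
  have hkmono : StrictMono k := strictMono_nat_of_lt_succ fun i => by
    rw [hksucc]; exact hlast2 (k i + 1) _ rfl
  have hkmax : ∀ i m, v m = v (k i) → m ≤ k i := by
    intro i
    cases i with
    | zero => intro m hm; exact hlast2 0 m (hm.trans (hlast1 0))
    | succ i =>
      intro m hm
      rw [hksucc] at hm ⊢
      exact hlast2 _ m (hm.trans (hlast1 _))
  have hTk : ∀ i, T (v (k i)) (v (k (i + 1))) = T (v (k i)) (v (k i + 1)) := fun i => by
    rw [hksucc, hlast1]
  refine h.noChain ⟨fun i => v (k i), ?_, fun i => (hdart _).fst_mem, fun i => ?_, ?_⟩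
  · intro i j hij
    exact hkmono.injective (le_antisymm (hkmax j _ hij) (hkmax i _ hij.symm))
  · rw [hTk]; exact (hdart _).lt
  · intro i j hij
    simp only [hTk]
    exact hanti.antitone (hkmono.monotone hij)

/-- The death times are determined by the connections. -/
theorem deathTimes_le (h : GoodConnections V T I t₁) {D D' : α → ℝ≥0∞}
    (hD : IsDeathTimes V T I t₁ D) (hD' : IsDeathTimes V T I t₁ D') {p : α} (hp : p ∈ V) :
    D' p ≤ D p := by
  -- Quantifying over both systems lets the induction swap them. If `q` kills `p` in `D` but `p`
  -- outlives this connection in `D'`, then `q` was dead in `D'` through an earlier connection; by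
  -- induction with the roles exchanged, `q` was dead by then in `D` as well, which is absurd.
  suffices H : ∀ d : α × α, IsDart V T t₁ d.1 d.2 → I d.1 d.2 = true →
      ∀ D D' : α → ℝ≥0∞, IsDeathTimes V T I t₁ D → IsDeathTimes V T I t₁ D' →
      D d.1 = T d.1 d.2 → T d.1 d.2 < D d.2 → D' d.1 ≤ D d.1 by
    rcases eq_top_or_lt_top (D p) with htop | hlt
    · rw [htop]; exact le_top
    · obtain ⟨q, hd, hI, heq, hq⟩ := hD.killer p hp hlt
      exact H (p, q) hd hI D D' hD hD' heq hq
  intro d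
  induction d using h.wellFounded.induction with
  | _ d ih =>
    obtain ⟨p, q⟩ := d
    intro hd hI D D' hD hD' heq hq
    simp only at hd hI heq hq ⊢
    by_contra hcon
    push Not at hcon
    have h1 : D' q ≤ T p q := by
      by_contra h2
      push Not at h2
      exact absurd (hD'.killed p q hd hI h2) (by rw [heq] at hcon; exact not_le.2 hcon)
    obtain ⟨r, hdr, hIr, heqr, hr⟩ := hD'.killer q hd.snd_mem
      (h1.trans_lt (hd.lt.trans_le le_top))
    rw [heqr] at h1
    have hlt : T q r < T p q := by
      refine lt_of_le_of_ne h1 fun heq' => ?_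
      rw [h.symm p q] at heq'
      have := h.eq_of_time_eq hdr hd.fst_mem hd.ne.symm heq'
      subst this
      exact h.killer_ne hd.ne hI hIr
    have := ih (q, r) ⟨hdr, hd, rfl, hlt⟩ hdr hIr D' D hD' hD heqr hr
    simp only at this
    rw [heqr] at this
    exact absurd (this.trans_lt hlt) (not_lt.2 hq.le)

theorem deathTimes_unique (h : GoodConnections V T I t₁) {D D' : α → ℝ≥0∞}
    (hD : IsDeathTimes V T I t₁ D) (hD' : IsDeathTimes V T I t₁ D') {p : α} (hp : p ∈ V) :
    D p = D' p :=
  le_antisymm (h.deathTimes_le hD' hD hp) (h.deathTimes_le hD hD' hp)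

/-- A stack of cards which contains a card before `t₁` has a top card. -/
theorem exists_isTopCard (h : GoodConnections V T I t₁) {S : Set α} {p r : α} (hp : p ∈ V)
    (hS : S ⊆ V) (hr : r ∈ S) (hlt : T p r < t₁) : ∃ q, IsTopCard (T p) S q ∧ T p q ≤ T p r := by
  have hfin : {q | q ∈ S ∧ T p q < t₁}.Finite :=
    (h.finite p hp).subset fun q hq => ⟨hS hq.1, hq.2⟩
  obtain ⟨q, hq, hmin⟩ := hfin.exists_minimalFor (T p) _ ⟨r, hr, hlt⟩
  have hle : ∀ r ∈ S, T p r < t₁ → T p q ≤ T p r := fun r hr hlt =>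
    (le_total (T p q) (T p r)).elim id fun h' => hmin ⟨hr, hlt⟩ h'
  refine ⟨q, ⟨hq.1, fun r hr => ?_⟩, hle r hr hlt⟩
  rcases lt_or_ge (T p r) t₁ with h1 | h1
  · exact hle r hr h1
  · exact hq.2.le.trans h1

end GoodConnections

/-! ### Termination of investigations -/

section Investigation

variable {α : Type*} {V : Set α} {T : α → α → ℝ≥0∞} {I : α → α → Bool} {t₁ : ℝ≥0∞}
  {ord : α → ℕ}

/-- A sequence of investigation stacks `inv` and sets of open cards `U`, in which the card on top of
the investigation stack is either settled or continued by an earlier card. -/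
structure IsInvestigation (V : Set α) (T : α → α → ℝ≥0∞) (t₁ : ℝ≥0∞) (ord : α → ℕ)
    (inv : ℕ → List (α × α)) (U : ℕ → α → Set α) : Prop where
  start : inv 0 = []
  card : ∀ n, ∀ p ∈ V, ∀ q ∈ U n p, q ∈ V ∧ q ≠ p
  anti : ∀ n p, U (n + 1) p ⊆ U n p
  cons : ∀ n p q l, inv n = (p, q) :: l → IsDart V T t₁ p q ∧
    ((inv (n + 1) = l ∧ q ∉ U (n + 1) p) ∨
      ∃ r ∈ U n q, T q r < T p q ∧ inv (n + 1) = (q, r) :: inv n)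
  nil : ∀ n, inv n = [] → (inv (n + 1) = [] ∧ ∀ p ∈ V, ∀ r ∈ U n p, t₁ ≤ T p r) ∨
    ∃ p q, p ∈ V ∧ q ∈ U n p ∧ T p q < t₁ ∧ inv (n + 1) = [(p, q)] ∧
      ∀ p' ∈ V, (∃ r ∈ U n p', T p' r < t₁) → ord p ≤ ord p'

namespace IsInvestigation

variable {inv : ℕ → List (α × α)} {U : ℕ → α → Set α}

theorem anti_le (h : IsInvestigation V T t₁ ord inv U) {n m : ℕ} (hnm : n ≤ m) (p : α) :
    U m p ⊆ U n p := by
  induction m, hnm using Nat.le_induction with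
  | base => exact subset_rfl
  | succ m _ ih => exact (h.anti m p).trans ih

theorem finite_cards (h : IsInvestigation V T t₁ ord inv U) (hG : GoodConnections V T I t₁)
    (n : ℕ) {p : α} (hp : p ∈ V) {t : ℝ≥0∞} (ht : t ≤ t₁) :
    {r | r ∈ U n p ∧ T p r < t}.Finite :=
  (hG.finite p hp).subset fun r hr => ⟨(h.card n p hp r hr.1).1, hr.2.trans_le ht⟩

/-- A double induction. A card placed on top of `d` continues `d` at an earlier time, so by
well-founded induction it gets settled and `d` is on top again, with one open card of its second
point fewer. Only finitely many of these cards precede `d`, so the inner induction on their number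
ends. -/
theorem exists_settled (h : IsInvestigation V T t₁ ord inv U) (hG : GoodConnections V T I t₁)
    (d : α × α) : ∀ n l, inv n = d :: l → ∃ m > n, inv m = l ∧ d.2 ∉ U m d.1 := by
  induction d using hG.wellFounded.induction with
  | _ d ih =>
    obtain ⟨p, q⟩ := d
    suffices H : ∀ k n l, inv n = (p, q) :: l → {r | r ∈ U n q ∧ T q r < T p q}.ncard ≤ k →
        ∃ m > n, inv m = l ∧ q ∉ U m p from fun n l hn => H _ n l hn le_rfl
    intro k
    induction k with
    | zero =>
      intro n l hn hk
      obtain ⟨hd, h1 | ⟨r, hr, hlt, -⟩⟩ := h.cons n p q l hn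
      · exact ⟨n + 1, Nat.lt_succ_self n, h1⟩
      · have hfin := h.finite_cards hG n hd.snd_mem hd.lt.le
        rw [Nat.le_zero, Set.ncard_eq_zero hfin] at hk
        exact absurd (show r ∈ {r | r ∈ U n q ∧ T q r < T p q} from ⟨hr, hlt⟩) (by simp [hk])
    | succ k ihk =>
      intro n l hn hk
      obtain ⟨hd, h1 | ⟨r, hr, hlt, hnext⟩⟩ := h.cons n p q l hn
      · exact ⟨n + 1, Nat.lt_succ_self n, h1⟩
      · have hdr : IsDart V T t₁ q r :=
          ⟨hd.snd_mem, (h.card n q hd.snd_mem r hr).1, (h.card n q hd.snd_mem r hr).2,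
            hlt.trans hd.lt⟩
        obtain ⟨m, hm, hinv, hrm⟩ := ih (q, r) ⟨hdr, hd, rfl, hlt⟩ (n + 1) _ hnext
        rw [hn] at hinv
        have hlt' : {r | r ∈ U m q ∧ T q r < T p q}.ncard <
            {r | r ∈ U n q ∧ T q r < T p q}.ncard := by
          refine Set.ncard_lt_ncard ⟨fun x hx => ⟨h.anti_le (by omega) q hx.1, hx.2⟩, fun hsub => ?_⟩
            (h.finite_cards hG n hd.snd_mem hd.lt.le)
          exact hrm (hsub ⟨hr, hlt⟩).1
        obtain ⟨m', hm', h'⟩ := ihk m l hinv (by omega)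
        exact ⟨m', by omega, h'⟩

theorem exists_nil (h : IsInvestigation V T t₁ ord inv U) (hG : GoodConnections V T I t₁) (n : ℕ) :
    ∃ m ≥ n, inv m = [] := by
  suffices H : ∀ l n, inv n = l → ∃ m ≥ n, inv m = [] from H _ n rfl
  intro l
  induction l with
  | nil => exact fun n hn => ⟨n, le_rfl, hn⟩
  | cons d l ih =>
    intro n hn
    obtain ⟨m, hm, hinv, -⟩ := h.exists_settled hG d n l hn
    obtain ⟨m', hm', h'⟩ := ih m hinv
    exact ⟨m', by omega, h'⟩

/-- In an investigation all cards before `t₁` are eventually settled. -/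
theorem eventually_settled (h : IsInvestigation V T t₁ ord inv U) (hG : GoodConnections V T I t₁)
    (hord : Set.InjOn ord V) {p : α} (hp : p ∈ V) :
    ∃ n, inv n = [] ∧ ∀ m ≥ n, ∀ r ∈ U m p, t₁ ≤ T p r := by
  suffices H : ∀ N, ∀ p ∈ V, ord p = N → ∃ n, ∀ r ∈ U n p, t₁ ≤ T p r by
    obtain ⟨n, hn⟩ := H _ p hp rfl
    obtain ⟨m, hm, hinv⟩ := h.exists_nil hG n
    exact ⟨m, hinv, fun k hk r hr => hn r (h.anti_le (by omega) p hr)⟩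
  -- Strong induction on the place in the enumeration. Once the finitely many earlier points are
  -- settled, an empty investigation stack can only be refilled from `p`, unless `p` is settled too;
  -- each such round removes one of the finitely many open cards of `p` before `t₁`.
  intro N
  induction N using Nat.strong_induction_on with
  | _ N ih =>
    intro p hp hN
    have hfin : {p' | p' ∈ V ∧ ord p' < N}.Finite :=
      Set.Finite.of_finite_image (f := ord)
        ((Set.finite_Iio N).subset (by rintro _ ⟨x, hx, rfl⟩; exact hx.2))
        (hord.mono fun x hx => hx.1)
    have hearlier : ∃ n, ∀ p' ∈ {p' | p' ∈ V ∧ ord p' < N}, ∀ r ∈ U n p', t₁ ≤ T p' r := by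
      have hall : ∀ p' ∈ {p' | p' ∈ V ∧ ord p' < N}, ∀ᶠ n in atTop, ∀ r ∈ U n p', t₁ ≤ T p' r := by
        intro p' hp'
        obtain ⟨n, hn⟩ := ih (ord p') hp'.2 p' hp'.1 rfl
        exact eventually_atTop.2 ⟨n, fun m hm r hr => hn r (h.anti_le hm p' hr)⟩
      exact ((eventually_all_finite hfin).2 hall).exists
    obtain ⟨n₀, hn₀⟩ := hearlier
    suffices H : ∀ k n, n₀ ≤ n → inv n = [] → {r | r ∈ U n p ∧ T p r < t₁}.ncard ≤ k →
        ∃ n, ∀ r ∈ U n p, t₁ ≤ T p r by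
      obtain ⟨n, hn, hinv⟩ := h.exists_nil hG n₀
      exact H _ n hn hinv le_rfl
    intro k
    induction k with
    | zero =>
      intro n _ _ hk
      rw [Nat.le_zero, Set.ncard_eq_zero (h.finite_cards hG n hp le_rfl)] at hk
      refine ⟨n, fun r hr => ?_⟩
      by_contra hlt
      exact absurd (show r ∈ {r | r ∈ U n p ∧ T p r < t₁} from ⟨hr, not_le.1 hlt⟩) (by simp [hk])
    | succ k ihk =>
      intro n hn hinv hk
      by_cases hset : ∀ r ∈ U n p, t₁ ≤ T p r
      · exact ⟨n, hset⟩
      push Not at hset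
      rcases h.nil n hinv with ⟨-, h1⟩ | ⟨p', q, hp', hq, hlt, hnext, hfirst⟩
      · exact ⟨n, h1 p hp⟩
      · have hle := hfirst p hp hset
        have hpp : p' = p := by
          refine hord hp' hp (le_antisymm hle (hN ▸ not_lt.1 fun hlt' => ?_))
          exact absurd (hn₀ p' ⟨hp', hlt'⟩ q (h.anti_le hn p' hq)) (not_le.2 hlt)
        subst hpp
        obtain ⟨m, hm, hinvm, hqm⟩ := h.exists_settled hG (p', q) (n + 1) [] hnext
        refine ihk m (by omega) hinvm ?_
        have hlt' : {r | r ∈ U m p' ∧ T p' r < t₁}.ncard <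
            {r | r ∈ U n p' ∧ T p' r < t₁}.ncard := by
          refine Set.ncard_lt_ncard ⟨fun x hx => ⟨h.anti_le (by omega) p' hx.1, hx.2⟩, fun hsub => ?_⟩
            (h.finite_cards hG n hp le_rfl)
          exact hqm (hsub ⟨hq, hlt⟩).1
        omega

end IsInvestigation

end Investigation

/-! ### Executions -/

theorem IsExecution.invariant {σ : Type*} {R : σ → σ → Prop} {s₀ : σ} {s : ℕ → σ}
    (hs : IsExecution R s₀ s) {P : σ → Prop} (h₀ : P s₀) (hR : ∀ s s', P s → R s s' → P s')
    (n : ℕ) : P (s n) := by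
  induction n with
  | zero => rw [hs.1]; exact h₀
  | succ n ih =>
    rcases hs.2 n with h | ⟨-, h⟩
    · exact hR _ _ ih h
    · rw [h]; exact ih

/-! ### Correctness of the Sheriff algorithm -/

namespace SheriffState

set_option linter.unusedSectionVars false

variable {α : Type*} [DecidableEq α] {V : Set α} {T : α → α → ℝ≥0∞} {I : α → α → Bool}
  {t₁ : ℝ≥0∞} {ord : α → ℕ}

/-- The invariant of the Sheriff algorithm. -/
structure Invariant (V : Set α) (T : α → α → ℝ≥0∞) (I : α → α → Bool) (t₁ : ℝ≥0∞)
    (s : SheriffState α) : Prop where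
  sent : ∀ p, ∀ q ∈ s.sentences p, p ∈ V ∧ q ∈ V ∧ q ≠ p ∧ I p q = true
  inv_mem : ∀ p q, (p, q) ∈ s.inv → IsDart V T t₁ p q ∧ I p q = true ∧ s.cert p = none ∧
    ∀ r ∈ s.sentences p, T p q < T p r
  inv_chain : s.inv.Pairwise fun d d' => d.1 ≠ d'.1 ∧ T d.1 d.2 < T d'.1 d'.2
  -- A sentence that has left both stacks has left for a reason: its killer was already dead, or its
  -- victim died at that time or before. At the end of an investigation this becomes the field
  -- `killed` of `IsDeathTimes`.
  resolved : ∀ p q, IsDart V T t₁ p q → I p q = true → q ∉ s.sentences p → (p, q) ∉ s.inv →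
    (∃ r, s.cert q = some r ∧ T q r < T p q) ∨ ∃ r, s.cert p = some r ∧ T p r ≤ T p q
  cert_dart : ∀ p q, s.cert p = some q → IsDart V T t₁ p q ∧ I p q = true ∧
    ∀ r ∈ s.sentences p, T p q < T p r
  -- The second half protects executions from later discoveries: whatever the killer may still die
  -- of comes after the execution.
  cert_killer : ∀ p q, s.cert p = some q → (∀ r, s.cert q = some r → T p q < T q r) ∧
    (s.cert q = none → ∀ r, r ∈ s.sentences q ∨ (q, r) ∈ s.inv → T p q < T q r)

theorem invariant_initial :
    Invariant V T I t₁ (initial V I) where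
  sent p q hq := hq
  inv_mem p q h := by simp [initial] at h
  inv_chain := by simp [initial]
  resolved p q hd hI hq := absurd ⟨hd.fst_mem, hd.snd_mem, hd.ne, hI⟩ hq
  cert_dart p q h := by simp [initial] at h
  cert_killer p q h := by simp [initial] at h

theorem mem_investigate {s : SheriffState α} {p q p' r : α} :
    r ∈ (s.investigate p q).sentences p' ↔ r ∈ s.sentences p' ∧ (p' = p → r ≠ q) := by
  by_cases h : p' = p
  · subst h; simp [investigate]
  · simp [investigate, h]

theorem Invariant.investigate (hG : GoodConnections V T I t₁) {s : SheriffState α}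
    (hs : Invariant V T I t₁ s) {p q : α} (hcert : s.cert p = none)
    (htop : IsTopCard (T p) (s.sentences p) q) (hlt : T p q < t₁)
    (hinv : ∀ d ∈ s.inv, p ≠ d.1 ∧ T p q < T d.1 d.2) :
    Invariant V T I t₁ (s.investigate p q) := by
  obtain ⟨hp, hq, hne, hI⟩ := hs.sent p q htop.1
  have hd : IsDart V T t₁ p q := ⟨hp, hq, hne, hlt⟩
  have hmem : ∀ p' q', (p', q') ∈ (s.investigate p q).inv ↔
      (p' = p ∧ q' = q) ∨ (p', q') ∈ s.inv := by
    intro p' q'; simp [SheriffState.investigate]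
  refine ⟨fun p' q' h => hs.sent p' q' (mem_investigate.1 h).1, ?_, ?_, ?_, ?_, ?_⟩
  · intro p' q' h
    rcases (hmem p' q').1 h with ⟨rfl, rfl⟩ | h
    · refine ⟨hd, hI, hcert, fun r hr => ?_⟩
      rw [mem_investigate] at hr
      refine lt_of_le_of_ne (htop.2 r hr.1) fun heq => hr.2 rfl ?_
      obtain ⟨-, hrV, hrp, -⟩ := hs.sent p' r hr.1
      exact hG.eq_of_time_eq hd hrV hrp heq
    · obtain ⟨h1, h2, h3, h4⟩ := hs.inv_mem p' q' h
      exact ⟨h1, h2, h3, fun r hr => h4 r (mem_investigate.1 hr).1⟩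
  · exact List.pairwise_cons.2 ⟨hinv, hs.inv_chain⟩
  · intro p' q' hd' hI' hq' hinv'
    rw [hmem, not_or] at hinv'
    refine hs.resolved p' q' hd' hI' (fun hmem' => ?_) hinv'.2
    rw [mem_investigate, not_and_or] at hq'
    rcases hq' with h | h
    · exact h hmem'
    · push Not at h
      exact hinv'.1 h
  · intro p' q' h
    obtain ⟨h1, h2, h3⟩ := hs.cert_dart p' q' h
    exact ⟨h1, h2, fun r hr => h3 r (mem_investigate.1 hr).1⟩
  · intro p' q' h
    obtain ⟨h1, h2⟩ := hs.cert_killer p' q' h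
    refine ⟨h1, fun h3 r hr => h2 h3 r ?_⟩
    rcases hr with hr | hr
    · exact Or.inl (mem_investigate.1 hr).1
    · rcases (hmem _ _).1 hr with ⟨rfl, rfl⟩ | hr
      · exact Or.inl htop.1
      · exact Or.inr hr

theorem Invariant.inv_tail {s : SheriffState α} (hs : Invariant V T I t₁ s) {p q : α}
    {l : List (α × α)} (hinv : s.inv = (p, q) :: l) {p' q' : α} (h : (p', q') ∈ l) :
    p ≠ p' ∧ T p q < T p' q' := by
  have := hs.inv_chain
  rw [hinv, List.pairwise_cons] at this
  exact this.1 _ h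

theorem Invariant.execute {s : SheriffState α} (hs : Invariant V T I t₁ s) {p q : α}
    {l : List (α × α)} (hinv : s.inv = (p, q) :: l)
    (h₁ : ∀ r, s.cert q = some r → T p q < T q r)
    (h₂ : s.cert q = none → ∀ r ∈ s.sentences q, T p q < T q r) :
    Invariant V T I t₁ { s with cert := Function.update s.cert p (some q), inv := l } := by
  obtain ⟨hd, hI, hcert, hsent⟩ := hs.inv_mem p q (by simp [hinv])
  have hupd : ∀ p' q', Function.update s.cert p (some q) p' = some q' ↔
      (p' = p ∧ q = q') ∨ (p' ≠ p ∧ s.cert p' = some q') := by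
    intro p' q'
    by_cases h : p' = p
    · subst h; simp
    · simp [h]
  have hmem : ∀ p' q', (p', q') ∈ s.inv ↔ (p' = p ∧ q' = q) ∨ (p', q') ∈ l := by
    intro p' q'; simp [hinv]
  refine ⟨hs.sent, ?_, ?_, ?_, ?_, ?_⟩
  · intro p' q' h
    obtain ⟨h1, h2, h3, h4⟩ := hs.inv_mem p' q' ((hmem _ _).2 (Or.inr h))
    refine ⟨h1, h2, ?_, h4⟩
    simpa [Function.update_of_ne (hs.inv_tail hinv h).1.symm] using h3
  · have := hs.inv_chain
    rw [hinv] at this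
    exact this.of_cons
  · intro p' q' hd' hI' hq' hinv'
    simp only [hupd]
    by_cases heq : p' = p ∧ q' = q
    · obtain ⟨rfl, rfl⟩ := heq
      exact Or.inr ⟨q', Or.inl ⟨rfl, rfl⟩, le_rfl⟩
    · rcases hs.resolved p' q' hd' hI' hq' (fun h => ((hmem _ _).1 h).elim heq hinv') with
        ⟨r, hr, hlt⟩ | ⟨r, hr, hle⟩
      · refine Or.inl ⟨r, Or.inr ⟨fun h => ?_, hr⟩, hlt⟩
        rw [h, hcert] at hr; cases hr
      · refine Or.inr ⟨r, Or.inr ⟨fun h => ?_, hr⟩, hle⟩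
        rw [h, hcert] at hr; cases hr
  · intro p' q' h
    rcases (hupd p' q').1 h with ⟨rfl, rfl⟩ | ⟨-, h⟩
    · exact ⟨hd, hI, hsent⟩
    · exact hs.cert_dart p' q' h
  · intro p' q' h
    rcases (hupd p' q').1 h with ⟨rfl, rfl⟩ | ⟨hne, h⟩
    · simp only [Function.update_of_ne hd.ne]
      refine ⟨h₁, fun h3 r hr => ?_⟩
      rcases hr with hr | hr
      · exact h₂ h3 r hr
      · exact (hs.inv_tail hinv hr).2
    · obtain ⟨h1, h2⟩ := hs.cert_killer p' q' h
      constructor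
      · intro r hr
        rcases (hupd q' r).1 hr with ⟨rfl, rfl⟩ | ⟨-, hr⟩
        -- Here `p` itself is the killer in the older certificate of `p'`. Its own sentence `(p, q)`
        -- was still under investigation, so the second half of `cert_killer` places it after that
        -- execution.
        · exact h2 hcert q (Or.inr (by simp [hinv]))
        · exact h1 r hr
      · intro h3 r hr
        by_cases hq' : q' = p
        · subst hq'; simp at h3
        · simp only [Function.update_of_ne hq'] at h3
          exact h2 h3 r (hr.imp_right fun hr => (hmem _ _).2 (Or.inr hr))

theorem Invariant.discard {s : SheriffState α} (hs : Invariant V T I t₁ s) {p q r : α}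
    {l : List (α × α)} (hinv : s.inv = (p, q) :: l) (hcert : s.cert q = some r)
    (hlt : T q r < T p q) : Invariant V T I t₁ { s with inv := l } := by
  have hmem : ∀ p' q', (p', q') ∈ s.inv ↔ (p' = p ∧ q' = q) ∨ (p', q') ∈ l := by
    intro p' q'; simp [hinv]
  refine ⟨hs.sent, fun p' q' h => hs.inv_mem p' q' ((hmem _ _).2 (Or.inr h)), ?_, ?_,
    hs.cert_dart, ?_⟩
  · have := hs.inv_chain
    rw [hinv] at this
    exact this.of_cons
  · intro p' q' hd' hI' hq' hinv'
    by_cases heq : p' = p ∧ q' = q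
    · obtain ⟨rfl, rfl⟩ := heq
      exact Or.inl ⟨r, hcert, hlt⟩
    · exact hs.resolved p' q' hd' hI' hq' (fun h => ((hmem _ _).1 h).elim heq hinv')
  · intro p' q' h
    obtain ⟨h1, h2⟩ := hs.cert_killer p' q' h
    exact ⟨h1, fun h3 r hr => h2 h3 r (hr.imp_right fun hr => (hmem _ _).2 (Or.inr hr))⟩

/-- A card that is investigated next is earlier than the cards of the investigation stack. -/
theorem Invariant.descend_lt (hG : GoodConnections V T I t₁) {s : SheriffState α}
    (hs : Invariant V T I t₁ s) {p q r : α} {l : List (α × α)} (hinv : s.inv = (p, q) :: l)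
    (hr : r ∈ s.sentences q) (hle : T q r ≤ T p q) :
    T q r < T p q ∧ ∀ d ∈ s.inv, q ≠ d.1 ∧ T q r < T d.1 d.2 := by
  obtain ⟨hd, hI, hcert, hsent⟩ := hs.inv_mem p q (by simp [hinv])
  obtain ⟨-, hrV, hrq, hIr⟩ := hs.sent q r hr
  have hlt : T q r < T p q := by
    refine lt_of_le_of_ne hle fun heq => ?_
    rw [hG.symm p q] at heq
    have := hG.eq_of_time_eq (hG.dart_symm hd) hrV hrq heq.symm
    subst this
    exact hG.killer_ne hd.ne hI hIr
  have hle' : ∀ d ∈ s.inv, T p q ≤ T d.1 d.2 := by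
    intro d hd
    rw [hinv, List.mem_cons] at hd
    rcases hd with rfl | hd
    · exact le_rfl
    · exact (hs.inv_tail hinv (p' := d.1) (q' := d.2) hd).2.le
  refine ⟨hlt, fun d hdm => ⟨?_, hlt.trans_le (hle' d hdm)⟩⟩
  -- The sentences left to a point under investigation are later than the one being investigated,
  -- while `r` is earlier; so no point occurs twice in the investigation stack.
  rintro rfl
  have h1 := (hs.inv_mem d.1 d.2 hdm).2.2.2 r hr
  exact absurd (h1.trans hlt) (not_lt.2 (hle' d hdm))

theorem Invariant.step (hG : GoodConnections V T I t₁) {s s' : SheriffState α}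
    (hs : Invariant V T I t₁ s) (h : Step V T t₁ ord s s') : Invariant V T I t₁ s' := by
  cases h with
  | choose p q h_inv h_elig h_first h_top =>
    obtain ⟨-, hcert, q', hq', hlt⟩ := h_elig
    exact hs.investigate hG hcert h_top ((h_top.2 q' hq'.1).trans_lt hlt) (by simp [h_inv])
  | execute_cert p q r l h_inv h_cert h_late =>
    refine hs.execute h_inv (fun r' hr' => ?_) (fun h => ?_)
    · rw [h_cert] at hr'; cases hr'; exact h_late
    · rw [h_cert] at h; cases h
  | execute_sentence p q l h_inv h_cert h_late =>
    refine hs.execute h_inv (fun r' hr' => ?_) (fun _ => h_late)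
    rw [h_cert] at hr'; cases hr'
  | discard p q r l h_inv h_cert h_early => exact hs.discard h_inv h_cert h_early
  | descend p q r l h_inv h_cert h_top h_early =>
    have hd := (hs.inv_mem p q (by simp [h_inv])).1
    obtain ⟨h1, h2⟩ := hs.descend_lt hG h_inv h_top.1 h_early
    exact hs.investigate hG h_cert h_top (h1.trans hd.lt) h2

/-- Certificates are never revoked, and no sentences are added. -/
theorem Invariant.step_mono {s s' : SheriffState α}
    (hs : Invariant V T I t₁ s) (h : Step V T t₁ ord s s') :
    (∀ p q, s.cert p = some q → s'.cert p = some q) ∧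
      ∀ p, s'.sentences p ⊆ s.sentences p := by
  have hexec : ∀ p q l, s.inv = (p, q) :: l → ∀ p' q', s.cert p' = some q' →
      Function.update s.cert p (some q) p' = some q' := by
    intro p q l hinv p' q' h
    have hcert := (hs.inv_mem p q (by simp [hinv])).2.2.1
    rw [Function.update_of_ne, h]
    rintro rfl
    rw [hcert] at h; cases h
  cases h with
  | choose p q h_inv h_elig h_first h_top =>
    exact ⟨fun _ _ => id, fun _ _ hr => (mem_investigate.1 hr).1⟩
  | execute_cert p q r l h_inv h_cert h_late =>
    exact ⟨hexec p q l h_inv, fun _ => subset_rfl⟩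
  | execute_sentence p q l h_inv h_cert h_late =>
    exact ⟨hexec p q l h_inv, fun _ => subset_rfl⟩
  | discard p q r l h_inv h_cert h_early => exact ⟨fun _ _ => id, fun _ => subset_rfl⟩
  | descend p q r l h_inv h_cert h_top h_early =>
    exact ⟨fun _ _ => id, fun _ _ hr => (mem_investigate.1 hr).1⟩

/-- The sentences of the points without a certificate. -/
def openSentences (s : SheriffState α) (p : α) : Set α := {r | s.cert p = none ∧ r ∈ s.sentences p}

/-- The rules leave open only the case that the killer has a certificate with exactly the time `T p
q`. Distinctness of times would make it the same connection, in which `p` and `q` would have to kill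
each other. -/
theorem exists_step_of_inv (hG : GoodConnections V T I t₁) {s : SheriffState α}
    (hs : Invariant V T I t₁ s) {p q : α} {l : List (α × α)} (hinv : s.inv = (p, q) :: l) :
    ∃ s', Step V T t₁ ord s s' := by
  obtain ⟨hd, hI, hcert, hsent⟩ := hs.inv_mem p q (by simp [hinv])
  rcases hq : s.cert q with _ | r
  · by_cases hlate : ∀ r ∈ s.sentences q, T p q < T q r
    · exact ⟨_, .execute_sentence s p q l hinv hq hlate⟩
    · push Not at hlate
      obtain ⟨r, hr, hle⟩ := hlate
      obtain ⟨r', htop, hle'⟩ := hG.exists_isTopCard hd.snd_mem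
        (fun x hx => (hs.sent q x hx).2.1) hr (hle.trans_lt hd.lt)
      exact ⟨_, .descend s p q r' l hinv hq htop (hle'.trans hle)⟩
  · rcases lt_trichotomy (T p q) (T q r) with h | h | h
    · exact ⟨_, .execute_cert s p q r l hinv hq h⟩
    · obtain ⟨hdr, hIr, -⟩ := hs.cert_dart q r hq
      rw [hG.symm p q] at h
      have := hG.eq_of_time_eq (hG.dart_symm hd) hdr.snd_mem hdr.ne h
      subst this
      exact absurd hIr (hG.killer_ne hd.ne hI)
    · exact ⟨_, .discard s p q r l hinv hq h⟩

theorem exists_step_of_eligible {s : SheriffState α}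
    (hinv : s.inv = []) {p : α} (hp : s.Eligible V T t₁ p) : ∃ s', Step V T t₁ ord s s' := by
  obtain ⟨p', hp', hmin⟩ := (measure ord).wf.has_min {p | s.Eligible V T t₁ p} ⟨p, hp⟩
  obtain ⟨q, hq, hlt⟩ := hp'.2.2
  exact ⟨_, .choose s p' q hinv hp' (fun r hr => not_lt.1 (hmin r hr)) hq⟩

section Run

variable {σ : ℕ → SheriffState α}

theorem IsSheriffRun.invariant (hG : GoodConnections V T I t₁)
    (hσ : IsSheriffRun V T I t₁ ord σ) (n : ℕ) : Invariant V T I t₁ (σ n) :=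
  IsExecution.invariant hσ invariant_initial (fun _ _ h => h.step hG) n

theorem IsSheriffRun.mono (hG : GoodConnections V T I t₁)
    (hσ : IsSheriffRun V T I t₁ ord σ) {n m : ℕ} (hnm : n ≤ m) :
    (∀ p q, (σ n).cert p = some q → (σ m).cert p = some q) ∧
      ∀ p, (σ m).sentences p ⊆ (σ n).sentences p := by
  induction m, hnm using Nat.le_induction with
  | base => exact ⟨fun _ _ => id, fun _ => subset_rfl⟩
  | succ m _ ih =>
    rcases hσ.2 m with h | ⟨-, h⟩
    · have := (hσ.invariant hG m).step_mono h
      exact ⟨fun p q hpq => this.1 p q (ih.1 p q hpq), fun p => (this.2 p).trans (ih.2 p)⟩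
    · rw [h]; exact ih

/-- A sentence leaves the stack of its point when it is investigated, and never returns; hence it is
no longer open when it leaves the investigation stack. -/
theorem IsSheriffRun.isInvestigation (hG : GoodConnections V T I t₁)
    (hσ : IsSheriffRun V T I t₁ ord σ) :
    IsInvestigation V T t₁ ord (fun n => (σ n).inv) (fun n => (σ n).openSentences) where
  start := by simp [hσ.1, initial]
  card n p _ q hq := ((hσ.invariant hG n).sent p q hq.2).2.imp_right And.left
  anti n p r hr := by
    obtain ⟨h1, h2⟩ := hσ.mono hG (Nat.le_succ n)
    refine ⟨?_, h2 p hr.2⟩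
    rcases h : (σ n).cert p with _ | q
    · rfl
    · have := h1 p q h
      rw [hr.1] at this; cases this
  cons n p q l hinv := by
    have hs := hσ.invariant hG n
    obtain ⟨hd, hI, hcert, hsent⟩ := hs.inv_mem p q (by simp [hinv])
    refine ⟨hd, ?_⟩
    have hq : q ∉ (σ n).sentences p := fun h => lt_irrefl _ (hsent q h)
    have hq' : q ∉ (σ (n + 1)).openSentences p := fun h =>
      hq ((hσ.mono hG (Nat.le_succ n)).2 p h.2)
    rcases hσ.2 n with h | ⟨h, -⟩
    · generalize σ (n + 1) = s' at h hq'
      cases h with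
      | choose p q h_inv h_elig h_first h_top => rw [h_inv] at hinv; cases hinv
      | execute_cert p q r l h_inv h_cert h_late =>
        rw [hinv] at h_inv; cases h_inv; exact Or.inl ⟨rfl, hq'⟩
      | execute_sentence p q l h_inv h_cert h_late =>
        rw [hinv] at h_inv; cases h_inv; exact Or.inl ⟨rfl, hq'⟩
      | discard p q r l h_inv h_cert h_early =>
        rw [hinv] at h_inv; cases h_inv; exact Or.inl ⟨rfl, hq'⟩
      | descend p q r l h_inv h_cert h_top h_early =>
        rw [hinv] at h_inv; cases h_inv
        exact Or.inr ⟨r, ⟨h_cert, h_top.1⟩, (hs.descend_lt hG hinv h_top.1 h_early).1, rfl⟩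
    · exact absurd (exists_step_of_inv hG hs hinv) h
  nil n hinv := by
    have hs := hσ.invariant hG n
    have helig : ∀ p ∈ V, (∃ r ∈ (σ n).openSentences p, T p r < t₁) →
        (σ n).Eligible V T t₁ p := by
      rintro p hp ⟨r, hr, hlt⟩
      obtain ⟨q, hq, hle⟩ := hG.exists_isTopCard hp (fun x hx => (hs.sent p x hx).2.1) hr.2 hlt
      exact ⟨hp, hr.1, q, hq, hle.trans_lt hlt⟩
    rcases hσ.2 n with h | ⟨h, heq⟩
    · right
      generalize σ (n + 1) = s' at h
      cases h with
      | choose p q h_inv h_elig h_first h_top =>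
        obtain ⟨hp, hcert, q', hq', hlt⟩ := h_elig
        refine ⟨p, q, hp, ⟨hcert, h_top.1⟩, (h_top.2 q' hq'.1).trans_lt hlt, ?_, ?_⟩
        · simp [investigate, hinv]
        · exact fun p' hp' h => h_first p' (helig p' hp' h)
      | execute_cert p q r l h_inv h_cert h_late => rw [h_inv] at hinv; cases hinv
      | execute_sentence p q l h_inv h_cert h_late => rw [h_inv] at hinv; cases hinv
      | discard p q r l h_inv h_cert h_early => rw [h_inv] at hinv; cases hinv
      | descend p q r l h_inv h_cert h_top h_early => rw [h_inv] at hinv; cases hinv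
    · left
      refine ⟨by simp [heq, hinv], fun p hp r hr => ?_⟩
      by_contra hlt
      exact h (exists_step_of_eligible hinv (helig p hp ⟨r, hr, not_le.1 hlt⟩))

theorem IsSheriffRun.deathTime_eq (hG : GoodConnections V T I t₁)
    (hσ : IsSheriffRun V T I t₁ ord σ) {n : ℕ} {p q : α} (h : (σ n).cert p = some q) :
    deathTime T σ p = T p q := by
  refine le_antisymm (iInf_le_of_le n (iInf₂_le q h)) ?_
  refine le_iInf fun m => le_iInf₂ fun r hr => ?_
  have h1 := (hσ.mono hG (le_max_left n m)).1 p q h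
  rw [(hσ.mono hG (le_max_right n m)).1 p r hr] at h1
  cases h1
  exact le_rfl

theorem exists_cert_of_deathTime_lt_top {p : α} (h : deathTime T σ p < ⊤) :
    ∃ n q, (σ n).cert p = some q := by
  by_contra hcon
  push Not at hcon
  simp [deathTime, hcon] at h

/-- The Sheriff algorithm determines the death times. -/
theorem IsSheriffRun.isDeathTimes (hG : GoodConnections V T I t₁) (hord : Set.InjOn ord V)
    (hσ : IsSheriffRun V T I t₁ ord σ) : IsDeathTimes V T I t₁ (deathTime T σ) where
  killer p hp h := by
    obtain ⟨n, q, hq⟩ := exists_cert_of_deathTime_lt_top h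
    obtain ⟨hd, hI, -⟩ := (hσ.invariant hG n).cert_dart p q hq
    refine ⟨q, hd, hI, hσ.deathTime_eq hG hq, ?_⟩
    rcases eq_top_or_lt_top (deathTime T σ q) with htop | hlt
    · rw [htop]; exact hd.lt.trans_le le_top
    · obtain ⟨m, r, hr⟩ := exists_cert_of_deathTime_lt_top hlt
      rw [hσ.deathTime_eq hG hr]
      have h1 := (hσ.mono hG (le_max_left n m)).1 p q hq
      have h2 := (hσ.mono hG (le_max_right n m)).1 q r hr
      exact ((hσ.invariant hG (max n m)).cert_killer p q h1).1 r h2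
  killed p q hd hI hlt := by
    obtain ⟨n, hinv, hn⟩ := (hσ.isInvestigation hG).eventually_settled hG hord hd.fst_mem
    have hs := hσ.invariant hG n
    by_cases hq : q ∈ (σ n).sentences p
    · rcases hcert : (σ n).cert p with _ | r
      · exact absurd (hn n le_rfl q ⟨hcert, hq⟩) (not_le.2 hd.lt)
      · rw [hσ.deathTime_eq hG hcert]
        exact ((hs.cert_dart p r hcert).2.2 q hq).le
    · have hinv : (σ n).inv = [] := hinv
      rcases hs.resolved p q hd hI hq (by simp [hinv]) with ⟨r, hr, hlt'⟩ | ⟨r, hr, hle⟩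
      · rw [hσ.deathTime_eq hG hr] at hlt
        exact absurd hlt (not_lt.2 hlt'.le)
      · rw [hσ.deathTime_eq hG hr]
        exact hle

end Run

end SheriffState

/-! ### Sheriff with zombies -/

/-- The death times `g` found so far among the points of `X`, when the cards in the stacks `S` are
still open. -/
structure PartialDeathTimes {α : Type*} (V X : Set α) (T : α → α → ℝ≥0∞) (I : α → α → Bool)
    (t₁ : ℝ≥0∞) (g : α → ℝ≥0∞) (S : α → Set α) : Prop where
  -- The last clause guards a killer that is still alive: none of its open cards is at or before the
  -- killing, so a death found later cannot undo it.
  killer : ∀ p ∈ X, g p < ⊤ → ∃ q ∈ X, IsDart V T t₁ p q ∧ I p q = true ∧ g p = T p q ∧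
    T p q < g q ∧ (g q = ⊤ → ∀ r ∈ S q, T p q < T q r)
  resolved : ∀ p ∈ X, ∀ q ∈ X, IsDart V T t₁ p q → I p q = true → q ∉ S p →
    g q ≤ T p q ∨ g p ≤ T p q
  le : ∀ p ∈ X, g p < ⊤ → ∀ r ∈ S p, g p ≤ T p r

namespace PartialDeathTimes

variable {α : Type*} {V X : Set α} {T : α → α → ℝ≥0∞} {I : α → α → Bool}
  {t₁ : ℝ≥0∞} {g g₁ : α → ℝ≥0∞} {S S₁ : α → Set α}

/-- A card may be thrown away once the point that it names is dead by the time of the card, since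
that point can then no longer kill in this connection. -/
theorem drop (h : PartialDeathTimes V X T I t₁ g S) (hS : ∀ p, S₁ p ⊆ S p)
    (hd : ∀ p ∈ X, ∀ q ∈ X, q ∈ S p → q ∉ S₁ p → g q ≤ T p q) :
    PartialDeathTimes V X T I t₁ g S₁ where
  killer p hp hlt := by
    obtain ⟨q, hq, h1, h2, h3, h4, h5⟩ := h.killer p hp hlt
    exact ⟨q, hq, h1, h2, h3, h4, fun h6 r hr => h5 h6 r (hS q hr)⟩
  resolved p hp q hq hdart hI hqS := by
    by_cases hqS' : q ∈ S p
    · exact Or.inl (hd p hp q hq hqS' hqS)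
    · exact h.resolved p hp q hq hdart hI hqS'
  le p hp hlt r hr := h.le p hp hlt r (hS p hr)

/-- One duel seen from one of the two systems; it serves `e` with `X = W` and `e'` with `X = Z₀ ∪
W`. As the card is on top for both duellists, nothing earlier remains open for either, so being
alive according to `g` means being alive at the time of the duel. -/
theorem settle (hG : GoodConnections V T I t₁) (h : PartialDeathTimes V X T I t₁ g S)
    (hS : ∀ p, S₁ p ⊆ S p) {l w : α} (hd : IsDart V T t₁ l w) (hI : I l w = true)
    (hSV : ∀ r ∈ S w, r ∈ V ∧ r ≠ w)
    (hlw : IsTopCard (T l) (S l) w) (hwl : IsTopCard (T w) (S w) l) (hl : l ∉ S₁ w)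
    (hkeep : ∀ p, ∀ r ∈ S p, r ∈ S₁ p ∨ (p = w ∧ r = l) ∨ (p = l ∧ r = w))
    (hg : ∀ p, p ≠ l → g₁ p = g p)
    (hg₁ : (l ∈ X ∧ w ∈ X ∧ g l = ⊤ ∧ g w = ⊤) → g₁ l = T l w)
    (hg₂ : ¬ (l ∈ X ∧ w ∈ X ∧ g l = ⊤ ∧ g w = ⊤) → g₁ l = g l) :
    PartialDeathTimes V X T I t₁ g₁ S₁ := by
  have hmono : ∀ p, g₁ p ≤ g p := by
    intro p
    by_cases hp : p = l
    · subst hp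
      by_cases hc : p ∈ X ∧ w ∈ X ∧ g p = ⊤ ∧ g w = ⊤
      · rw [hc.2.2.1]; exact le_top
      · rw [hg₂ hc]
    · rw [hg p hp]
  have hw : ∀ r ∈ S₁ w, T l w < T w r := by
    intro r hr
    rw [hG.symm l w]
    refine lt_of_le_of_ne (hwl.2 r (hS w hr)) fun heq => ?_
    have h1 := hSV r (hS w hr)
    have := hG.eq_of_time_eq (hG.dart_symm hd) h1.1 h1.2 heq
    exact hl (this ▸ hr)
  have hchange : ∀ p, g₁ p = g p ∨ (p = l ∧ w ∈ X ∧ g l = ⊤ ∧ g w = ⊤ ∧ g₁ l = T l w) := by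
    intro p
    by_cases hp : p = l
    · subst hp
      by_cases hc : p ∈ X ∧ w ∈ X ∧ g p = ⊤ ∧ g w = ⊤
      · exact Or.inr ⟨rfl, hc.2.1, hc.2.2.1, hc.2.2.2, hg₁ hc⟩
      · exact Or.inl (hg₂ hc)
    · exact Or.inl (hg p hp)
  refine ⟨?_, ?_, ?_⟩
  · intro p hp hlt
    rcases hchange p with heq | ⟨rfl, hwX, -, hgw, heq⟩
    · rw [heq] at hlt ⊢
      obtain ⟨q, hq, h1, h2, h3, h4, h5⟩ := h.killer p hp hlt
      refine ⟨q, hq, h1, h2, h3, ?_⟩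
      rcases hchange q with heq' | ⟨rfl, -, hgl, -, heq'⟩
      · rw [heq']
        exact ⟨h4, fun h6 r hr => h5 h6 r (hS q hr)⟩
      · rw [heq']
        -- The point `l` that dies now may itself be the recorded killer of `p`. Its card naming `w`
        -- was open until now, so that earlier killing came strictly before the present death.
        refine ⟨h5 hgl w hlw.1, fun htop => ?_⟩
        exact absurd htop (hd.lt.trans_le le_top).ne
    · refine ⟨w, hwX, hd, hI, heq, ?_, fun _ => hw⟩
      rw [hg w hd.ne, hgw]
      exact hd.lt.trans_le le_top
  · intro p hp q hq hdart hI' hqS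
    by_cases hqS' : q ∈ S p
    · rcases hkeep p q hqS' with h1 | ⟨rfl, rfl⟩ | ⟨rfl, rfl⟩
      · exact absurd h1 hqS
      · exact absurd hI' (hG.killer_ne hd.ne hI)
      · by_cases hc : p ∈ X ∧ q ∈ X ∧ g p = ⊤ ∧ g q = ⊤
        · exact Or.inr (hg₁ hc).le
        · have hc' : g p ≠ ⊤ ∨ g q ≠ ⊤ := by
            by_contra hcon
            push Not at hcon
            exact hc ⟨hp, hq, hcon⟩
          rcases hc' with h1 | h1
          · exact Or.inr ((hmono p).trans (h.le p hp (lt_top_iff_ne_top.2 h1) q hqS'))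
          · refine Or.inl ((hmono q).trans ?_)
            rw [hG.symm p q]
            exact h.le q hq (lt_top_iff_ne_top.2 h1) p hwl.1
    · exact (h.resolved p hp q hq hdart hI' hqS').imp (hmono q).trans (hmono p).trans
  · intro p hp hlt r hr
    rcases hchange p with heq | ⟨rfl, -, -, -, heq⟩
    · rw [heq] at hlt ⊢
      exact h.le p hp hlt r (hS p hr)
    · rw [heq]
      exact hlw.2 r (hS p hr)

end PartialDeathTimes

namespace ZState

set_option linter.unusedSectionVars false

variable {α : Type*} [DecidableEq α] {Z₀ W : Set α} {T : α → α → ℝ≥0∞} {I : α → α → Bool}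
  {t₁ : ℝ≥0∞} {ord : α → ℕ}

/-- The point `p` has died for good. -/
def Dead (Z₀ W : Set α) (s : ZState α) (p : α) : Prop :=
  (p ∈ Z₀ ∧ s.e' p < ⊤) ∨ (p ∈ W ∧ max (s.e p) (s.e' p) < ⊤)

/-- The invariant of Sheriff with zombies. -/
structure Invariant (Z₀ W : Set α) (T : α → α → ℝ≥0∞) (I : α → α → Bool) (t₁ : ℝ≥0∞)
    (s : ZState α) : Prop where
  stack_mem : ∀ p, ∀ q ∈ s.stack p, p ∈ Z₀ ∪ W ∧ q ∈ Z₀ ∪ W ∧ q ≠ p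
  -- Symmetry is lost only at points that are dead for good. For a living point it ensures that the
  -- opponent on its top card still holds the matching card, so that a duel can be on top for both.
  stack_symm : ∀ p, ¬ s.Dead Z₀ W p → ∀ q ∈ s.stack p, p ∈ s.stack q
  times : PartialDeathTimes (Z₀ ∪ W) W T I t₁ s.e s.stack
  times' : PartialDeathTimes (Z₀ ∪ W) (Z₀ ∪ W) T I t₁ s.e' s.stack
  inv_mem : ∀ p q, (p, q) ∈ s.inv → IsDart (Z₀ ∪ W) T t₁ p q ∧ ¬ s.Dead Z₀ W p ∧
    IsTopCard (T p) (s.stack p) q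
  inv_chain : s.inv.Pairwise fun d d' => T d.1 d.2 < T d'.1 d'.2
  -- The four fields from here on identify the special points: antizombies are those dead only in
  -- the augmented system, zombies those dead only in the non-augmented one, where points of `Z₀`
  -- count as dead from the start.
  A_mem : ∀ p z, p ∈ s.A z → z ∈ Z₀ ∧ p ∈ W ∧ s.e' p < ⊤ ∧ s.e p = ⊤
  Z_mem : ∀ p z, p ∈ s.Z z → z ∈ Z₀ ∧ p ∈ Z₀ ∪ W ∧ s.e' p = ⊤ ∧ (p ∈ W → s.e p < ⊤)
  A_exists : ∀ p ∈ W, s.e' p < ⊤ → s.e p = ⊤ → ∃ z, p ∈ s.A z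
  Z_exists : ∀ p ∈ Z₀ ∪ W, s.e' p = ⊤ → (p ∈ W → s.e p < ⊤) → ∃ z, p ∈ s.Z z
  unique : ∀ p z z', p ∈ s.A z ∪ s.Z z → p ∈ s.A z' ∪ s.Z z' → z = z'

theorem invariant_initial (hZW : Disjoint Z₀ W) : Invariant Z₀ W T I t₁ (initial Z₀ W) where
  stack_mem p q h := h
  stack_symm p _ q h := ⟨h.2.1, h.1, h.2.2.symm⟩
  times := by
    refine ⟨fun p _ h => ?_, fun p hp q hq hd _ h => ?_, fun p _ h => ?_⟩
    · simp [initial] at h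
    · exact absurd ⟨hd.fst_mem, hd.snd_mem, hd.ne⟩ h
    · simp [initial] at h
  times' := by
    refine ⟨fun p _ h => ?_, fun p hp q hq hd _ h => ?_, fun p _ h => ?_⟩
    · simp [initial] at h
    · exact absurd ⟨hd.fst_mem, hd.snd_mem, hd.ne⟩ h
    · simp [initial] at h
  inv_mem p q h := by simp [initial] at h
  inv_chain := by simp [initial]
  A_mem p z h := by simp [initial] at h
  Z_mem p z h := by
    obtain ⟨hz, rfl⟩ := h
    exact ⟨hz, Or.inl hz, rfl, fun hW => absurd hW (hZW.notMem_of_mem_left hz)⟩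
  A_exists p _ h := by simp [initial] at h
  Z_exists p hp _ h := by
    refine ⟨p, hp.elim id fun hW => ?_, rfl⟩
    simpa [initial] using h hW
  unique p z z' h h' := by
    simp only [initial, Set.empty_union] at h h'
    exact h.2.symm.trans h'.2

/-- The state `s₁` is the outcome of a duel in state `s`, in which `w` would kill `l`. -/
structure Settled (Z₀ W : Set α) (T : α → α → ℝ≥0∞) (l w : α) (s s₁ : ZState α) : Prop where
  inv_eq : s₁.inv = s.inv
  e_ne : ∀ p, p ≠ l → s₁.e p = s.e p
  e_alive : (l ∈ W ∧ w ∈ W ∧ s.e l = ⊤ ∧ s.e w = ⊤) → s₁.e l = T l w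
  e_dead : ¬ (l ∈ W ∧ w ∈ W ∧ s.e l = ⊤ ∧ s.e w = ⊤) → s₁.e l = s.e l
  e'_ne : ∀ p, p ≠ l → s₁.e' p = s.e' p
  e'_alive : (l ∈ Z₀ ∪ W ∧ w ∈ Z₀ ∪ W ∧ s.e' l = ⊤ ∧ s.e' w = ⊤) → s₁.e' l = T l w
  e'_dead : ¬ (l ∈ Z₀ ∪ W ∧ w ∈ Z₀ ∪ W ∧ s.e' l = ⊤ ∧ s.e' w = ⊤) → s₁.e' l = s.e' l
  -- The winner always loses its card, the loser only if it is not dead for good: the stack of a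
  -- dead point is not drawn on again.
  mem_stack : ∀ p r, r ∈ s₁.stack p ↔ r ∈ s.stack p ∧ ¬ (p = w ∧ r = l) ∧
    ¬ (p = l ∧ r = w ∧ ¬ s₁.Dead Z₀ W l)
  A_ne : ∀ p, p ≠ l → ∀ z, p ∈ s₁.A z ↔ p ∈ s.A z
  Z_ne : ∀ p, p ≠ l → ∀ z, p ∈ s₁.Z z ↔ p ∈ s.Z z
  -- The four fates of the loser: dead for good, unchanged (a zombie against an antizombie), regular
  -- turned antizombie by a zombie, regular turned zombie by an antizombie.
  loser : (s₁.Dead Z₀ W l ∧ ∀ z, l ∉ s₁.A z ∧ l ∉ s₁.Z z) ∨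
    (s₁.e l = s.e l ∧ s₁.e' l = s.e' l ∧ ∀ z, (l ∈ s₁.A z ↔ l ∈ s.A z) ∧ (l ∈ s₁.Z z ↔ l ∈ s.Z z)) ∨
    (l ∈ W ∧ s.Regular l ∧ s.e' l = ⊤ ∧ s₁.e l = ⊤ ∧ s₁.e' l < ⊤ ∧
      ∃ z, w ∈ s.Z z ∧ ∀ z', (l ∈ s₁.A z' ↔ z' = z) ∧ l ∉ s₁.Z z') ∨
    (l ∈ W ∧ s.Regular l ∧ s.e l = ⊤ ∧ s₁.e l < ⊤ ∧ s₁.e' l = ⊤ ∧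
      ∃ z, w ∈ s.A z ∧ ∀ z', l ∉ s₁.A z' ∧ (l ∈ s₁.Z z' ↔ z' = z))

theorem dead_iff {s : ZState α} {p : α} :
    s.Dead Z₀ W p ↔ (p ∈ Z₀ ∧ s.e' p ≠ ⊤) ∨ (p ∈ W ∧ s.e p ≠ ⊤ ∧ s.e' p ≠ ⊤) := by
  simp only [Dead, max_lt_iff]
  simp only [lt_top_iff_ne_top]

theorem Invariant.regular_spec {s : ZState α} (hs : Invariant Z₀ W T I t₁ s) {p : α}
    (hp : p ∈ Z₀ ∪ W) (hdead : ¬ s.Dead Z₀ W p) (h : s.Regular p) :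
    p ∈ W ∧ s.e p = ⊤ ∧ s.e' p = ⊤ := by
  have hA : ¬ (p ∈ W ∧ s.e' p ≠ ⊤ ∧ s.e p = ⊤) := fun ⟨h1, h2, h3⟩ => by
    obtain ⟨z, hz⟩ := hs.A_exists p h1 (lt_top_iff_ne_top.2 h2) h3
    exact (h z).1 hz
  have hZ : ¬ (s.e' p = ⊤ ∧ (p ∈ W → s.e p ≠ ⊤)) := fun ⟨h1, h2⟩ => by
    obtain ⟨z, hz⟩ := hs.Z_exists p hp h1 fun h => lt_top_iff_ne_top.2 (h2 h)
    exact (h z).2 hz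
  rw [dead_iff] at hdead
  rcases hp with hp | hp <;> tauto

section Simp

variable (s : ZState α) (p a z z' x r : α) (t : ℝ≥0∞) (S : Set α)

theorem popCard_e : (s.popCard p a).e = s.e := rfl
theorem popCard_e' : (s.popCard p a).e' = s.e' := rfl
theorem popCard_A : (s.popCard p a).A = s.A := rfl
theorem popCard_Z : (s.popCard p a).Z = s.Z := rfl
theorem setE_stack : (s.setE p t).stack = s.stack := rfl
theorem setE_e : (s.setE p t).e = Function.update s.e p t := rfl
theorem setE_e' : (s.setE p t).e' = s.e' := rfl
theorem setE_A : (s.setE p t).A = s.A := rfl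
theorem setE_Z : (s.setE p t).Z = s.Z := rfl
theorem setE'_stack : (s.setE' p t).stack = s.stack := rfl
theorem setE'_e : (s.setE' p t).e = s.e := rfl
theorem setE'_e' : (s.setE' p t).e' = Function.update s.e' p t := rfl
theorem setE'_A : (s.setE' p t).A = s.A := rfl
theorem setE'_Z : (s.setE' p t).Z = s.Z := rfl
theorem setA_stack : (s.setA z S).stack = s.stack := rfl
theorem setA_e : (s.setA z S).e = s.e := rfl
theorem setA_e' : (s.setA z S).e' = s.e' := rfl
theorem setA_Z : (s.setA z S).Z = s.Z := rfl
theorem setZ_stack : (s.setZ z S).stack = s.stack := rfl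
theorem setZ_e : (s.setZ z S).e = s.e := rfl
theorem setZ_e' : (s.setZ z S).e' = s.e' := rfl
theorem setZ_A : (s.setZ z S).A = s.A := rfl

theorem mem_popCard_stack :
    r ∈ (s.popCard p a).stack x ↔ r ∈ s.stack x ∧ ¬ (x = p ∧ r = a) := by
  by_cases h : x = p
  · subst h; simp [popCard]
  · simp [popCard, h]

theorem mem_setA_A :
    x ∈ (s.setA z S).A z' ↔ (z' = z ∧ x ∈ S) ∨ (z' ≠ z ∧ x ∈ s.A z') := by
  by_cases h : z' = z
  · subst h; simp [setA]
  · simp [setA, h]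

theorem mem_setZ_Z :
    x ∈ (s.setZ z S).Z z' ↔ (z' = z ∧ x ∈ S) ∨ (z' ≠ z ∧ x ∈ s.Z z') := by
  by_cases h : z' = z
  · subst h; simp [setZ]
  · simp [setZ, h]

end Simp

set_option linter.unusedSimpArgs false in
-- The families record in which system a point lives, so every row reduces to one rule: the loser
-- dies where both duellists are alive. A zombie and an antizombie share no system; their duel
-- changes no death time, and the coin only decides which of them is called the loser.
theorem Invariant.settled_of_duel (hG : GoodConnections (Z₀ ∪ W) T I t₁) (hZW : Disjoint Z₀ W)
    {s s₁ : ZState α} (hs : Invariant Z₀ W T I t₁ s) {p q : α} (hd : IsDart (Z₀ ∪ W) T t₁ p q)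
    (hp : ¬ s.Dead Z₀ W p) (hq : ¬ s.Dead Z₀ W q) (h : Duel T I p q q p s s₁) :
    (I p q = true ∧ Settled Z₀ W T p q s s₁) ∨ (I q p = true ∧ Settled Z₀ W T q p s s₁) := by
  have hT : T p q ≠ ⊤ := (hd.lt.trans_le le_top).ne
  have hTs := hG.symm q p
  have hpV := hd.fst_mem
  have hqV := hd.snd_mem
  have hne := hd.ne
  have hflip := hG.flip p q hd.ne.symm
  have hZW' : ∀ x ∈ W, x ∉ Z₀ := fun x hx hx' => hZW.le_bot ⟨hx', hx⟩
  have hRp := hs.regular_spec hpV hp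
  have hRq := hs.regular_spec hqV hq
  have hA := hs.A_mem
  have hZ := hs.Z_mem
  have hU : ∀ x z z', x ∈ s.Z z → x ∈ s.Z z' → z = z' := fun x z z' h h' =>
    hs.unique x z z' (Or.inr h) (Or.inr h')
  have hU' : ∀ x z z', x ∈ s.A z → x ∈ s.A z' → z = z' := fun x z z' h h' =>
    hs.unique x z z' (Or.inl h) (Or.inl h')
  clear hs hd hG hZW
  cases h with
  | regular_regular_true hp' hq' hI
  | zombie_regular_true z hp' hq' hI
  | antizombie_regular_true z hp' hq' hI
  | zombie_zombie_true z z' hp' hq' hI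
  | antizombie_antizombie_true z z' hp' hq' hI =>
    refine Or.inl ⟨hI, ⟨rfl, ?_, ?_, ?_, ?_, ?_, ?_, ?_, ?_, ?_, ?_⟩⟩
    all_goals simp only [dead_iff, lt_top_iff_ne_top, Regular, popCard_e, popCard_e', popCard_A, popCard_Z,
    setE_e, setE_e', setE_A, setE_Z, setE_stack, setE'_e, setE'_e', setE'_A, setE'_Z, setE'_stack,
    setA_e, setA_e', setA_Z, setA_stack, setZ_e, setZ_e', setZ_A, setZ_stack,
    mem_popCard_stack, mem_setA_A, mem_setZ_Z] at *
    all_goals grind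
  | regular_regular_false hp' hq' hI
  | zombie_regular_false z hp' hq' hI
  | antizombie_regular_false z hp' hq' hI
  | zombie_zombie_false z z' hp' hq' hI
  | antizombie_antizombie_false z z' hp' hq' hI =>
    refine Or.inr ⟨by simp [hflip, hI], ⟨rfl, ?_, ?_, ?_, ?_, ?_, ?_, ?_, ?_, ?_, ?_⟩⟩
    all_goals simp only [dead_iff, lt_top_iff_ne_top, Regular, popCard_e, popCard_e', popCard_A, popCard_Z,
    setE_e, setE_e', setE_A, setE_Z, setE_stack, setE'_e, setE'_e', setE'_A, setE'_Z, setE'_stack,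
    setA_e, setA_e', setA_Z, setA_stack, setZ_e, setZ_e', setZ_A, setZ_stack,
    mem_popCard_stack, mem_setA_A, mem_setZ_Z] at *
    all_goals grind
  | zombie_antizombie z z' hp' hq' =>
    cases hI : I p q with
    | true =>
      refine Or.inl ⟨rfl, ⟨rfl, ?_, ?_, ?_, ?_, ?_, ?_, ?_, ?_, ?_, ?_⟩⟩
      all_goals simp only [dead_iff, lt_top_iff_ne_top, Regular, popCard_e, popCard_e', popCard_A, popCard_Z,
    setE_e, setE_e', setE_A, setE_Z, setE_stack, setE'_e, setE'_e', setE'_A, setE'_Z, setE'_stack,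
    setA_e, setA_e', setA_Z, setA_stack, setZ_e, setZ_e', setZ_A, setZ_stack,
    mem_popCard_stack, mem_setA_A, mem_setZ_Z] at *
      all_goals grind
    | false =>
      refine Or.inr ⟨by simp [hflip, hI], ⟨rfl, ?_, ?_, ?_, ?_, ?_, ?_, ?_, ?_, ?_, ?_⟩⟩
      all_goals simp only [dead_iff, lt_top_iff_ne_top, Regular, popCard_e, popCard_e', popCard_A, popCard_Z,
    setE_e, setE_e', setE_A, setE_Z, setE_stack, setE'_e, setE'_e', setE'_A, setE'_Z, setE'_stack,
    setA_e, setA_e', setA_Z, setA_stack, setZ_e, setZ_e', setZ_A, setZ_stack,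
    mem_popCard_stack, mem_setA_A, mem_setZ_Z] at *
      all_goals grind

end ZState

/-! ### Preservation of the invariant and uniqueness of the next state -/

namespace ZState

set_option linter.unusedSectionVars false

variable {α : Type*} [DecidableEq α] {Z₀ W : Set α} {T : α → α → ℝ≥0∞} {I : α → α → Bool}
  {t₁ : ℝ≥0∞} {ord : α → ℕ}

theorem Settled.dead_iff_of_ne {s s₁ : ZState α} {l w : α} (h : Settled Z₀ W T l w s s₁) {p : α}
    (hp : p ≠ l) : s₁.Dead Z₀ W p ↔ s.Dead Z₀ W p := by
  simp only [Dead, h.e_ne p hp, h.e'_ne p hp]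

theorem Settled.e_change {s s₁ : ZState α} {l w : α} (h : Settled Z₀ W T l w s s₁) (p : α) :
    s₁.e p = s.e p ∨ (s.e p = ⊤ ∧ s₁.e p = T l w) := by
  by_cases hp : p = l
  · subst hp
    by_cases hc : p ∈ W ∧ w ∈ W ∧ s.e p = ⊤ ∧ s.e w = ⊤
    · exact Or.inr ⟨hc.2.2.1, h.e_alive hc⟩
    · exact Or.inl (h.e_dead hc)
  · exact Or.inl (h.e_ne p hp)

theorem Settled.e'_change {s s₁ : ZState α} {l w : α} (h : Settled Z₀ W T l w s s₁) (p : α) :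
    s₁.e' p = s.e' p ∨ (s.e' p = ⊤ ∧ s₁.e' p = T l w) := by
  by_cases hp : p = l
  · subst hp
    by_cases hc : p ∈ Z₀ ∪ W ∧ w ∈ Z₀ ∪ W ∧ s.e' p = ⊤ ∧ s.e' w = ⊤
    · exact Or.inr ⟨hc.2.2.1, h.e'_alive hc⟩
    · exact Or.inl (h.e'_dead hc)
  · exact Or.inl (h.e'_ne p hp)

theorem dead_mono {s s₁ : ZState α} {p : α} (he : s₁.e p ≤ s.e p) (he' : s₁.e' p ≤ s.e' p)
    (h : s.Dead Z₀ W p) : s₁.Dead Z₀ W p :=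
  h.imp (fun h => ⟨h.1, he'.trans_lt h.2⟩)
    fun h => ⟨h.1, (max_le_max he he').trans_lt h.2⟩

theorem Settled.dead {s s₁ : ZState α} {l w : α} (h : Settled Z₀ W T l w s s₁) {p : α}
    (hp : s.Dead Z₀ W p) : s₁.Dead Z₀ W p := by
  refine dead_mono ?_ ?_ hp
  · rcases h.e_change p with h | h
    · exact h.le
    · exact h.1 ▸ le_top
  · rcases h.e'_change p with h | h
    · exact h.le
    · exact h.1 ▸ le_top

/-- Cards that remain under investigation must belong to neither duellist, because the top cards of
the duellists may have changed. Other points keep their times, families and stacks, so apart from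
the two systems of death times only the fate of the loser has to be examined. -/
theorem Invariant.settle (hG : GoodConnections (Z₀ ∪ W) T I t₁) (hZW : Disjoint Z₀ W)
    {s s₁ : ZState α} (hs : Invariant Z₀ W T I t₁ s) {l w : α} (hd : IsDart (Z₀ ∪ W) T t₁ l w)
    (hI : I l w = true) (hl : ¬ s.Dead Z₀ W l)
    (hlw : IsTopCard (T l) (s.stack l) w) (hwl : IsTopCard (T w) (s.stack w) l)
    (h : Settled Z₀ W T l w s s₁) {L : List (α × α)}
    (hL : L.Pairwise fun d d' => T d.1 d.2 < T d'.1 d'.2)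
    (hLs : ∀ p q, (p, q) ∈ L → (p, q) ∈ s.inv ∧ p ≠ l ∧ p ≠ w) :
    Invariant Z₀ W T I t₁ { s₁ with inv := L } := by
  have hsub : ∀ p, s₁.stack p ⊆ s.stack p := fun p r hr => ((h.mem_stack p r).1 hr).1
  have hlS : l ∉ s₁.stack w := fun hr => ((h.mem_stack w l).1 hr).2.1 ⟨rfl, rfl⟩
  have hkeep : ∀ p, ∀ r ∈ s.stack p, r ∈ s₁.stack p ∨ (p = w ∧ r = l) ∨ (p = l ∧ r = w) := by
    intro p r hr
    rw [h.mem_stack]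
    tauto
  have hSV : ∀ r ∈ s.stack w, r ∈ Z₀ ∪ W ∧ r ≠ w := fun r hr => (hs.stack_mem w r hr).2
  have hA := hs.A_mem
  have hZ := hs.Z_mem
  have hU : ∀ x z z', x ∈ s.Z z → x ∈ s.Z z' → z = z' := fun x z z' h h' =>
    hs.unique x z z' (Or.inr h) (Or.inr h')
  have hU' : ∀ x z z', x ∈ s.A z → x ∈ s.A z' → z = z' := fun x z z' h h' =>
    hs.unique x z z' (Or.inl h) (Or.inl h')
  refine ⟨fun p q hq => hs.stack_mem p q (hsub p hq), ?_,
    hs.times.settle hG hsub hd hI hSV hlw hwl hlS hkeep h.e_ne h.e_alive h.e_dead,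
    hs.times'.settle hG hsub hd hI hSV hlw hwl hlS hkeep h.e'_ne h.e'_alive h.e'_dead,
    ?_, hL, ?_, ?_, ?_, ?_, ?_⟩
  · intro p hp q hq
    change ¬ s₁.Dead Z₀ W p at hp
    change q ∈ s₁.stack p at hq
    change p ∈ s₁.stack q
    have hp' : ¬ s.Dead Z₀ W p := fun hdead => hp (h.dead hdead)
    have h1 := hs.stack_symm p hp' q (hsub p hq)
    rw [h.mem_stack] at hq ⊢
    refine ⟨h1, fun h2 => ?_, fun h2 => ?_⟩
    · exact hq.2.2 ⟨h2.2, h2.1, h2.2 ▸ hp⟩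
    · exact hq.2.1 ⟨h2.2.1, h2.1⟩
  · intro p q hpq
    obtain ⟨hpq, hpl, hpw⟩ := hLs p q hpq
    obtain ⟨h1, h2, h3⟩ := hs.inv_mem p q hpq
    refine ⟨h1, fun h4 => h2 ((h.dead_iff_of_ne hpl).1 h4), ?_, fun r hr => h3.2 r (hsub p hr)⟩
    exact (h.mem_stack p q).2 ⟨h3.1, fun h4 => hpw h4.1, fun h4 => hpl h4.1⟩
  · intro p z hp
    change p ∈ s₁.A z at hp
    change z ∈ Z₀ ∧ p ∈ W ∧ s₁.e' p < ⊤ ∧ s₁.e p = ⊤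
    by_cases hpl : p = l
    · subst hpl
      have := h.loser
      grind
    · rw [h.A_ne p hpl] at hp
      rw [h.e_ne p hpl, h.e'_ne p hpl]
      exact hA p z hp
  · intro p z hp
    change p ∈ s₁.Z z at hp
    change z ∈ Z₀ ∧ p ∈ Z₀ ∪ W ∧ s₁.e' p = ⊤ ∧ (p ∈ W → s₁.e p < ⊤)
    by_cases hpl : p = l
    · subst hpl
      have := h.loser
      grind
    · rw [h.Z_ne p hpl] at hp
      rw [h.e_ne p hpl, h.e'_ne p hpl]
      exact hZ p z hp
  · intro p hp h1 h2
    change s₁.e' p < ⊤ at h1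
    change s₁.e p = ⊤ at h2
    change ∃ z, p ∈ s₁.A z
    by_cases hpl : p = l
    · subst hpl
      rcases h.loser with h3 | h3 | h3 | h3
      · rcases h3.1 with h4 | h4
        · exact absurd hp (hZW.notMem_of_mem_left h4.1)
        · rw [h2] at h4; exact absurd h4.2 (by simp)
      · obtain ⟨z, hz⟩ := hs.A_exists p hp (h3.2.1 ▸ h1) (h3.1 ▸ h2)
        exact ⟨z, (h3.2.2 z).1.2 hz⟩
      · obtain ⟨-, -, -, -, -, z, -, hz⟩ := h3
        exact ⟨z, (hz z).1.2 rfl⟩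
      · exact absurd (h3.2.2.2.2.1 ▸ h1) (lt_irrefl _)
    · rw [h.e_ne p hpl] at h2
      rw [h.e'_ne p hpl] at h1
      simp only [h.A_ne p hpl]
      exact hs.A_exists p hp h1 h2
  · intro p hp h1 h2
    change s₁.e' p = ⊤ at h1
    change p ∈ W → s₁.e p < ⊤ at h2
    change ∃ z, p ∈ s₁.Z z
    by_cases hpl : p = l
    · subst hpl
      rcases h.loser with h3 | h3 | h3 | h3
      · rcases h3.1 with h4 | h4
        · rw [h1] at h4; exact absurd h4.2 (lt_irrefl _)
        · rw [h1] at h4; exact absurd h4.2 (by simp)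
      · obtain ⟨z, hz⟩ := hs.Z_exists p hp (h3.2.1 ▸ h1) (h3.1 ▸ h2)
        exact ⟨z, (h3.2.2 z).2.2 hz⟩
      · exact absurd (h1 ▸ h3.2.2.2.2.1) (lt_irrefl _)
      · obtain ⟨-, -, -, -, -, z, -, hz⟩ := h3
        exact ⟨z, (hz z).2.2 rfl⟩
    · rw [h.e_ne p hpl] at h2
      rw [h.e'_ne p hpl] at h1
      simp only [h.Z_ne p hpl]
      exact hs.Z_exists p hp h1 h2
  · intro p z z' h1 h2
    change p ∈ s₁.A z ∪ s₁.Z z at h1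
    change p ∈ s₁.A z' ∪ s₁.Z z' at h2
    have hU := hs.unique p z z'
    simp only [mem_union] at h1 h2 hU
    by_cases hpl : p = l
    · subst hpl
      have := h.loser
      grind
    · rw [h.A_ne p hpl, h.Z_ne p hpl] at h1 h2
      exact hU h1 h2

/-- Duels between points of the same kind can be read from the table in two ways, with `p` and `q`
interchanged. This is harmless: the loser is the same and its fate is fixed by the two times, the
ancestor being fixed by that of the winner. -/
theorem Invariant.settled_unique (hZW : Disjoint Z₀ W)
    {s s₁ s₂ : ZState α} (hs : Invariant Z₀ W T I t₁ s) {l w : α} (hl : ¬ s.Dead Z₀ W l)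
    (h₁ : Settled Z₀ W T l w s s₁) (h₂ : Settled Z₀ W T l w s s₂) : s₁ = s₂ := by
  have he : s₁.e = s₂.e := by
    funext p
    by_cases hp : p = l
    · subst hp
      by_cases hc : p ∈ W ∧ w ∈ W ∧ s.e p = ⊤ ∧ s.e w = ⊤
      · rw [h₁.e_alive hc, h₂.e_alive hc]
      · rw [h₁.e_dead hc, h₂.e_dead hc]
    · rw [h₁.e_ne p hp, h₂.e_ne p hp]
  have he' : s₁.e' = s₂.e' := by
    funext p
    by_cases hp : p = l
    · subst hp
      by_cases hc : p ∈ Z₀ ∪ W ∧ w ∈ Z₀ ∪ W ∧ s.e' p = ⊤ ∧ s.e' w = ⊤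
      · rw [h₁.e'_alive hc, h₂.e'_alive hc]
      · rw [h₁.e'_dead hc, h₂.e'_dead hc]
    · rw [h₁.e'_ne p hp, h₂.e'_ne p hp]
  have hdead : s₁.Dead Z₀ W l ↔ s₂.Dead Z₀ W l := by simp only [Dead, he, he']
  have hstack : s₁.stack = s₂.stack := by
    funext p; ext r
    rw [h₁.mem_stack, h₂.mem_stack, hdead]
  have hU : ∀ x z z', x ∈ s.Z z → x ∈ s.Z z' → z = z' := fun x z z' h h' =>
    hs.unique x z z' (Or.inr h) (Or.inr h')
  have hU' : ∀ x z z', x ∈ s.A z → x ∈ s.A z' → z = z' := fun x z z' h h' =>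
    hs.unique x z z' (Or.inl h) (Or.inl h')
  have hdisj : ∀ x ∈ W, x ∉ Z₀ := fun x hx hx' => hZW.le_bot ⟨hx', hx⟩
  have key : ∀ z, (l ∈ s₁.A z ↔ l ∈ s₂.A z) ∧ (l ∈ s₁.Z z ↔ l ∈ s₂.Z z) := by
    have h1 := h₁.loser
    have h2 := h₂.loser
    simp only [dead_iff, he, he', lt_top_iff_ne_top] at h1 h2 hl
    clear hs h₁ h₂ hdead hstack he he' hZW
    rcases h1 with h1 | h1 | h1 | h1 <;> rcases h2 with h2 | h2 | h2 | h2 <;> grind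
  have hA : s₁.A = s₂.A := by
    funext z; ext p
    by_cases hp : p = l
    · subst hp; exact (key z).1
    · rw [h₁.A_ne p hp, h₂.A_ne p hp]
  have hZ : s₁.Z = s₂.Z := by
    funext z; ext p
    by_cases hp : p = l
    · subst hp; exact (key z).2
    · rw [h₁.Z_ne p hp, h₂.Z_ne p hp]
  have hinv : s₁.inv = s₂.inv := h₁.inv_eq.trans h₂.inv_eq.symm
  cases s₁; cases s₂
  simp only at he he' hstack hA hZ hinv
  subst he he' hstack hA hZ hinv
  rfl

/-- The steps of Sheriff with zombies in the states that it reaches. -/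
inductive ReachedStep (Z₀ W : Set α) (T : α → α → ℝ≥0∞) (I : α → α → Bool) (t₁ : ℝ≥0∞)
    (ord : α → ℕ) (s : ZState α) : ZState α → Prop
  | choose (p q : α) (h_inv : s.inv = []) (h_mem : p ∈ Z₀ ∪ W)
      (h_unf : ¬ s.Finished Z₀ W T t₁ p)
      (h_first : ∀ p' ∈ Z₀ ∪ W, ¬ s.Finished Z₀ W T t₁ p' → ord p ≤ ord p')
      (h_top : IsTopCard (T p) (s.stack p) q) (h_lt : T p q < t₁) :
      ReachedStep Z₀ W T I t₁ ord s { s with inv := [(p, q)] }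
  | drop (p q : α) (l : List (α × α)) (h_inv : s.inv = (p, q) :: l) (h_dead : s.Dead Z₀ W q) :
      ReachedStep Z₀ W T I t₁ ord s { s.popCard p q with inv := l }
  | descend (p q r : α) (l : List (α × α)) (h_inv : s.inv = (p, q) :: l)
      (h_dead : ¬ s.Dead Z₀ W q) (h_top : IsTopCard (T q) (s.stack q) r)
      (h_early : T q r < T p q) :
      ReachedStep Z₀ W T I t₁ ord s { s with inv := (q, r) :: s.inv }
  | duel (s₁ : ZState α) (p q k w : α) (l : List (α × α)) (h_inv : s.inv = (p, q) :: l)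
      (h_dead : ¬ s.Dead Z₀ W q) (h_top : IsTopCard (T q) (s.stack q) p)
      (h_pair : (k = p ∧ w = q) ∨ (k = q ∧ w = p)) (h_I : I k w = true)
      (h_settled : Settled Z₀ W T k w s s₁) :
      ReachedStep Z₀ W T I t₁ ord s { s₁ with inv := l }

theorem Finished.of_dead {s : ZState α} {p : α} (h : s.Dead Z₀ W p) : s.Finished Z₀ W T t₁ p :=
  h.elim Or.inl fun h => Or.inr (Or.inl h)

theorem finished_iff {s : ZState α} {p : α} :
    s.Finished Z₀ W T t₁ p ↔ s.Dead Z₀ W p ∨ ∀ r ∈ s.stack p, t₁ ≤ T p r := by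
  simp only [Finished, Dead, or_assoc]

/-- By symmetry of the stacks, `q` still holds the card naming `p`, and this card is before `t₁`. So
`q` can be finished only through its death. -/
theorem Invariant.finished_head_iff (hG : GoodConnections (Z₀ ∪ W) T I t₁)
    {s : ZState α} (hs : Invariant Z₀ W T I t₁ s)
    {p q : α} {l : List (α × α)} (hinv : s.inv = (p, q) :: l) :
    s.Finished Z₀ W T t₁ q ↔ s.Dead Z₀ W q := by
  obtain ⟨hd, hp, htop⟩ := hs.inv_mem p q (by simp [hinv])
  rw [finished_iff, or_iff_left]
  intro h
  have := h p (hs.stack_symm p hp q htop.1)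
  rw [hG.symm q p] at this
  exact absurd hd.lt (not_lt.2 this)

theorem Invariant.top_unique (hG : GoodConnections (Z₀ ∪ W) T I t₁)
    {s : ZState α} (hs : Invariant Z₀ W T I t₁ s) {p q r : α} (hq : IsTopCard (T p) (s.stack p) q)
    (hr : IsTopCard (T p) (s.stack p) r) (hlt : T p q < t₁) : r = q := by
  obtain ⟨hp, hqV, hne⟩ := hs.stack_mem p q hq.1
  obtain ⟨-, hrV, hne'⟩ := hs.stack_mem p r hr.1
  exact hG.eq_of_time_eq ⟨hp, hqV, hne, hlt⟩ hrV hne' (le_antisymm (hq.2 r hr.1) (hr.2 q hq.1))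

/-- The stack of `q` contains the card naming `p`, so its top is no later than `T p q`. If it is not
earlier either, distinctness of times makes it that very card. -/
theorem Invariant.top_of_not_early (hG : GoodConnections (Z₀ ∪ W) T I t₁)
    {s : ZState α} (hs : Invariant Z₀ W T I t₁ s) {p q b : α} {l : List (α × α)}
    (hinv : s.inv = (p, q) :: l) (hb : IsTopCard (T q) (s.stack q) b)
    (hlate : ¬ T q b < T p q) : b = p := by
  obtain ⟨hd, hp, htop⟩ := hs.inv_mem p q (by simp [hinv])
  have hpq := hs.stack_symm p hp q htop.1
  obtain ⟨-, hbV, hbq⟩ := hs.stack_mem q b hb.1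
  refine hG.eq_of_time_eq (hG.dart_symm hd) hbV hbq (le_antisymm ?_ (hb.2 p hpq))
  rw [hG.symm q p]
  exact not_lt.1 hlate

theorem Invariant.reachedStep (hG : GoodConnections (Z₀ ∪ W) T I t₁) (hZW : Disjoint Z₀ W)
    {s s' : ZState α} (hs : Invariant Z₀ W T I t₁ s) (h : Step Z₀ W T I t₁ ord s s') :
    ReachedStep Z₀ W T I t₁ ord s s' := by
  cases h with
  | choose p q h_inv h_mem h_unf h_first h_top h_lt =>
    exact .choose p q h_inv h_mem h_unf h_first h_top h_lt
  | drop p q a l h_inv h_fin h_top =>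
    obtain ⟨hd, hp, htop⟩ := hs.inv_mem p q (by simp [h_inv])
    have := hs.top_unique hG htop h_top hd.lt
    subst this
    exact .drop p a l h_inv ((hs.finished_head_iff hG h_inv).1 h_fin)
  | descend p q r l h_inv h_unf h_top h_early =>
    exact .descend p q r l h_inv (fun h => h_unf (.of_dead h)) h_top h_early
  | duel s₁ p q a b l h_inv h_unf h_top_p h_top_q h_late h_duel =>
    obtain ⟨hd, hp, htop⟩ := hs.inv_mem p q (by simp [h_inv])
    have ha := hs.top_unique hG htop h_top_p hd.lt
    have hb := hs.top_of_not_early hG h_inv h_top_q h_late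
    subst ha hb
    have hq : ¬ s.Dead Z₀ W a := fun h => h_unf (.of_dead h)
    rcases h_duel with h | h
    · rcases hs.settled_of_duel hG hZW hd hp hq h with ⟨hI, h⟩ | ⟨hI, h⟩
      · exact .duel s₁ b a b a l h_inv hq h_top_q (Or.inl ⟨rfl, rfl⟩) hI h
      · exact .duel s₁ b a a b l h_inv hq h_top_q (Or.inr ⟨rfl, rfl⟩) hI h
    · rcases hs.settled_of_duel hG hZW (hG.dart_symm hd) hq hp h with ⟨hI, h⟩ | ⟨hI, h⟩
      · exact .duel s₁ b a a b l h_inv hq h_top_q (Or.inr ⟨rfl, rfl⟩) hI h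
      · exact .duel s₁ b a b a l h_inv hq h_top_q (Or.inl ⟨rfl, rfl⟩) hI h

theorem ReachedStep.unique (hG : GoodConnections (Z₀ ∪ W) T I t₁) (hZW : Disjoint Z₀ W)
    (hord : Set.InjOn ord (Z₀ ∪ W)) {s s₁ s₂ : ZState α} (hs : Invariant Z₀ W T I t₁ s)
    (h₁ : ReachedStep Z₀ W T I t₁ ord s s₁) (h₂ : ReachedStep Z₀ W T I t₁ ord s s₂) :
    s₁ = s₂ := by
  cases h₁ with
  | choose p q h_inv h_mem h_unf h_first h_top h_lt =>
    cases h₂ with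
    | choose p' q' h_inv' h_mem' h_unf' h_first' h_top' h_lt' =>
      have := hord h_mem h_mem' (le_antisymm (h_first p' h_mem' h_unf') (h_first' p h_mem h_unf))
      subst this
      rw [hs.top_unique hG h_top h_top' h_lt]
    | drop p' q' l' h_inv' | descend p' q' r' l' h_inv' | duel s₁' p' q' k' w' l' h_inv' =>
      rw [h_inv] at h_inv'; cases h_inv'
  | drop p q l h_inv h_dead =>
    cases h₂ with
    | choose p' q' h_inv' => rw [h_inv] at h_inv'; cases h_inv'
    | drop p' q' l' h_inv' => rw [h_inv] at h_inv'; cases h_inv'; rfl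
    | descend p' q' r' l' h_inv' h_dead' | duel s₁' p' q' k' w' l' h_inv' h_dead' =>
      rw [h_inv] at h_inv'; cases h_inv'; exact absurd h_dead h_dead'
  | descend p q r l h_inv h_dead h_top h_early =>
    cases h₂ with
    | choose p' q' h_inv' => rw [h_inv] at h_inv'; cases h_inv'
    | drop p' q' l' h_inv' h_dead' =>
      rw [h_inv] at h_inv'; cases h_inv'; exact absurd h_dead' h_dead
    | descend p' q' r' l' h_inv' h_dead' h_top' h_early' =>
      rw [h_inv] at h_inv'; cases h_inv'
      have hd := (hs.inv_mem p q (by simp [h_inv])).1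
      rw [hs.top_unique hG h_top h_top' (h_early.trans hd.lt)]
    | duel s₁' p' q' k' w' l' h_inv' h_dead' h_top' =>
      rw [h_inv] at h_inv'; cases h_inv'
      have := h_top'.2 r h_top.1
      rw [hG.symm q p] at this
      exact absurd h_early (not_lt.2 this)
  | duel s₁ p q k w l h_inv h_dead h_top h_pair h_I h_settled =>
    cases h₂ with
    | choose p' q' h_inv' => rw [h_inv] at h_inv'; cases h_inv'
    | drop p' q' l' h_inv' h_dead' =>
      rw [h_inv] at h_inv'; cases h_inv'; exact absurd h_dead' h_dead
    | descend p' q' r' l' h_inv' h_dead' h_top' h_early' =>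
      rw [h_inv] at h_inv'; cases h_inv'
      have := h_top.2 r' h_top'.1
      rw [hG.symm q p] at this
      exact absurd h_early' (not_lt.2 this)
    | duel s₂ p' q' k' w' l' h_inv' h_dead' h_top' h_pair' h_I' h_settled' =>
      rw [h_inv] at h_inv'; cases h_inv'
      obtain ⟨hd, hp, htop⟩ := hs.inv_mem p q (by simp [h_inv])
      have hI := hG.killer_ne hd.ne
      have hI' := hG.killer_ne hd.ne.symm
      rcases h_pair with ⟨rfl, rfl⟩ | ⟨rfl, rfl⟩ <;> rcases h_pair' with ⟨rfl, rfl⟩ | ⟨rfl, rfl⟩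
      · rw [hs.settled_unique hZW hp h_settled h_settled']
      · exact absurd h_I' (hI h_I)
      · exact absurd h_I (hI h_I')
      · rw [hs.settled_unique hZW h_dead h_settled h_settled']

theorem Invariant.step (hG : GoodConnections (Z₀ ∪ W) T I t₁) (hZW : Disjoint Z₀ W)
    {s s' : ZState α} (hs : Invariant Z₀ W T I t₁ s) (h : ReachedStep Z₀ W T I t₁ ord s s') :
    Invariant Z₀ W T I t₁ s' := by
  cases h with
  | choose p q h_inv h_mem h_unf h_first h_top h_lt =>
    refine { hs with inv_mem := fun p' q' h => ?_, inv_chain := by simp }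
    simp only [List.mem_singleton, Prod.mk.injEq] at h
    obtain ⟨rfl, rfl⟩ := h
    obtain ⟨h1, h2, h3⟩ := hs.stack_mem p' q' h_top.1
    exact ⟨⟨h1, h2, h3, h_lt⟩, fun h => h_unf (.of_dead h), h_top⟩
  | drop p q l h_inv h_dead =>
    obtain ⟨hd, hp, htop⟩ := hs.inv_mem p q (by simp [h_inv])
    have hsub : ∀ p', (s.popCard p q).stack p' ⊆ s.stack p' := fun p' r hr =>
      ((mem_popCard_stack s p q p' r).1 hr).1
    have hpq := hs.stack_symm p hp q htop.1
    have hpop : ∀ p' q', q' ∈ s.stack p' → q' ∉ (s.popCard p q).stack p' → p' = p ∧ q' = q := by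
      intro p' q' h1 h2
      by_contra h3
      exact h2 ((mem_popCard_stack s p q p' q').2 ⟨h1, h3⟩)
    have hchain := hs.inv_chain
    rw [h_inv, List.pairwise_cons] at hchain
    refine ⟨fun p' q' h => hs.stack_mem p' q' (hsub p' h), ?_, ?_, ?_, ?_, hchain.2,
      hs.A_mem, hs.Z_mem, hs.A_exists, hs.Z_exists, hs.unique⟩
    · intro p' hp' q' hq'
      have h1 := hs.stack_symm p' hp' q' (hsub p' hq')
      refine (mem_popCard_stack s p q q' p').2 ⟨h1, fun h2 => hp' ?_⟩
      rw [h2.2]; exact h_dead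
    -- The dead point `q` still holds its card naming `p`, so by `le` it died no later than this
    -- connection; the discarded card is void in both systems.
    · refine hs.times.drop hsub fun p' hp' q' hq' h1 h2 => ?_
      obtain ⟨rfl, rfl⟩ := hpop p' q' h1 h2
      have h3 : s.e q' < ⊤ := by
        rcases h_dead with h | h
        · exact absurd hq' (hZW.notMem_of_mem_left h.1)
        · exact (max_lt_iff.1 h.2).1
      rw [hG.symm]
      exact hs.times.le q' hq' h3 p' hpq
    · refine hs.times'.drop hsub fun p' hp' q' hq' h1 h2 => ?_
      obtain ⟨rfl, rfl⟩ := hpop p' q' h1 h2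
      have h3 : s.e' q' < ⊤ := by
        rcases h_dead with h | h
        · exact h.2
        · exact (max_lt_iff.1 h.2).2
      rw [hG.symm]
      exact hs.times'.le q' hq' h3 p' hpq
    · intro p' q' h
      obtain ⟨h1, h2, h3⟩ := hs.inv_mem p' q' (by rw [h_inv]; exact List.mem_cons_of_mem _ h)
      refine ⟨h1, h2, (mem_popCard_stack s p q p' q').2 ⟨h3.1, ?_⟩, fun r hr => h3.2 r (hsub p' hr)⟩
      rintro ⟨rfl, rfl⟩
      exact absurd (hchain.1 _ h) (lt_irrefl _)
  | descend p q r l h_inv h_dead h_top h_early =>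
    obtain ⟨hd, hp, htop⟩ := hs.inv_mem p q (by simp [h_inv])
    have hchain := hs.inv_chain
    rw [h_inv, List.pairwise_cons] at hchain
    refine { hs with inv_mem := fun p' q' h => ?_, inv_chain := List.pairwise_cons.2 ⟨?_, hs.inv_chain⟩ }
    · simp only [List.mem_cons, Prod.mk.injEq] at h
      rcases h with ⟨rfl, rfl⟩ | h
      · obtain ⟨h1, h2, h3⟩ := hs.stack_mem p' q' h_top.1
        exact ⟨⟨h1, h2, h3, h_early.trans hd.lt⟩, h_dead, h_top⟩
      · exact hs.inv_mem p' q' h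
    · intro d hd'
      rw [h_inv, List.mem_cons] at hd'
      rcases hd' with rfl | hd'
      · exact h_early
      · exact h_early.trans (hchain.1 d hd')
  | duel s₁ p q k w l h_inv h_dead h_top h_pair h_I h_settled =>
    obtain ⟨hd, hp, htop⟩ := hs.inv_mem p q (by simp [h_inv])
    have hchain := hs.inv_chain
    rw [h_inv, List.pairwise_cons] at hchain
    -- Cards deeper in the investigation stack are later than the duel, yet each is on top for its
    -- owner; the duellists both hold an earlier card, so neither of them is such an owner.
    have hL : ∀ p' q', (p', q') ∈ l → (p', q') ∈ s.inv ∧ p' ≠ p ∧ p' ≠ q := by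
      intro p' q' h
      have h1 : (p', q') ∈ s.inv := by rw [h_inv]; exact List.mem_cons_of_mem _ h
      have h2 : T p q < T p' q' := hchain.1 _ h
      have h3 := (hs.inv_mem p' q' h1).2.2
      refine ⟨h1, ?_, ?_⟩
      · rintro rfl
        exact absurd h2 (not_lt.2 (h3.2 q htop.1))
      · rintro rfl
        have := h3.2 p (hs.stack_symm p hp _ htop.1)
        rw [hG.symm _ p] at this
        exact absurd h2 (not_lt.2 this)
    rcases h_pair with ⟨rfl, rfl⟩ | ⟨rfl, rfl⟩
    · exact hs.settle hG hZW hd h_I hp htop h_top h_settled hchain.2 hL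
    · exact hs.settle hG hZW (hG.dart_symm hd) h_I h_dead h_top htop h_settled hchain.2
        fun p' q' h => ⟨(hL p' q' h).1, (hL p' q' h).2.2, (hL p' q' h).2.1⟩

end ZState

/-! ### Limits of the recorded death times, progress and termination -/

/-- Death times that are found step by step. -/
theorem PartialDeathTimes.isDeathTimes_iInf {α : Type*} {V X : Set α} {T : α → α → ℝ≥0∞}
    {I : α → α → Bool} {t₁ : ℝ≥0∞} (hG : GoodConnections V T I t₁) (hX : X ⊆ V)
    {g : ℕ → α → ℝ≥0∞} {S : ℕ → α → Set α}
    (h : ∀ n, PartialDeathTimes V X T I t₁ (g n) (S n))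
    (hg : ∀ n p, g n p < ⊤ → ∀ m, g m p < ⊤ → g m p = g n p)
    (hmono : ∀ n m, n ≤ m → ∀ p, g m p ≤ g n p)
    (hfin : ∀ p ∈ X, ∃ n, ∀ m ≥ n, ∀ r ∈ S m p, T p r < t₁ → g m p < ⊤) :
    (∀ p, ∀ᶠ n in atTop, g n p = ⨅ n, g n p) ∧ IsDeathTimes X T I t₁ fun p => ⨅ n, g n p := by
  have hev : ∀ p, ∀ᶠ n in atTop, g n p = ⨅ n, g n p := by
    intro p
    by_cases hp : ∃ n, g n p < ⊤
    · obtain ⟨n, hn⟩ := hp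
      filter_upwards [eventually_ge_atTop n] with m hm
      have hm' : g m p < ⊤ := (hmono n m hm p).trans_lt hn
      refine le_antisymm (le_iInf fun k => ?_) (iInf_le _ m)
      rcases eq_top_or_lt_top (g k p) with hk | hk
      · rw [hk]; exact le_top
      · exact (hg k p hk m hm').le
    · push Not at hp
      simp [fun n => top_le_iff.1 (hp n)]
  refine ⟨hev, fun p hp hlt => ?_, fun p q hd hI hlt => ?_⟩
  · obtain ⟨n, hn⟩ := (hev p).exists
    rw [← hn] at hlt
    obtain ⟨q, hq, hd, hI, heq, -, -⟩ := (h n).killer p hp hlt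
    refine ⟨q, ⟨hp, hq, hd.ne, hd.lt⟩, hI, by rw [← hn, heq], ?_⟩
    -- The killer must outlive the connection according to its final time, so the invariant is read
    -- again when both times have stabilised. Distinctness of times shows that the killer named
    -- there is the same.
    obtain ⟨m, hm1, hm2⟩ := ((hev p).and (hev q)).exists
    rw [← hm2]
    obtain ⟨q', -, hd', -, heq', hlt', -⟩ := (h m).killer p hp (by rwa [hm1, ← hn])
    rw [hm1, ← hn, heq] at heq'
    have := hG.eq_of_time_eq hd hd'.snd_mem hd'.ne heq'
    rwa [this] at hlt'
  · obtain ⟨n, hn⟩ := hfin p hd.fst_mem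
    obtain ⟨m, ⟨hm1, hm2⟩, hm⟩ := (((hev p).and (hev q)).and (eventually_ge_atTop n)).exists
    have hdV : IsDart V T t₁ p q := ⟨hX hd.fst_mem, hX hd.snd_mem, hd.ne, hd.lt⟩
    rw [← hm2] at hlt
    change (⨅ n, g n p) ≤ T p q
    rw [← hm1]
    by_cases hq : q ∈ S m p
    · exact (h m).le p hd.fst_mem (hn m hm q hq hd.lt) q hq
    · exact ((h m).resolved p hd.fst_mem q hd.snd_mem hdV hI hq).resolve_left (not_le.2 hlt)

namespace ZState

set_option linter.unusedSectionVars false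

variable {α : Type*} [DecidableEq α] {Z₀ W : Set α} {T : α → α → ℝ≥0∞} {I : α → α → Bool}
  {t₁ : ℝ≥0∞} {ord : α → ℕ}

theorem regular_or (s : ZState α) (p : α) :
    s.Regular p ∨ (∃ z, p ∈ s.A z) ∨ ∃ z, p ∈ s.Z z := by
  by_contra hcon
  push Not at hcon
  exact hcon.1 fun z => ⟨hcon.2.1 z, hcon.2.2 z⟩

theorem exists_duel (s : ZState α) (p q a b : α) :
    ∃ s₁, Duel T I p q a b s s₁ ∨ Duel T I q p b a s s₁ := by
  rcases s.regular_or p with hp | ⟨z, hp⟩ | ⟨z, hp⟩ <;>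
    rcases s.regular_or q with hq | ⟨z', hq⟩ | ⟨z', hq⟩
  · cases hI : I p q
    · exact ⟨_, Or.inl (.regular_regular_false s hp hq hI)⟩
    · exact ⟨_, Or.inl (.regular_regular_true s hp hq hI)⟩
  · cases hI : I q p
    · exact ⟨_, Or.inr (.antizombie_regular_false s z' hq hp hI)⟩
    · exact ⟨_, Or.inr (.antizombie_regular_true s z' hq hp hI)⟩
  · cases hI : I q p
    · exact ⟨_, Or.inr (.zombie_regular_false s z' hq hp hI)⟩
    · exact ⟨_, Or.inr (.zombie_regular_true s z' hq hp hI)⟩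
  · cases hI : I p q
    · exact ⟨_, Or.inl (.antizombie_regular_false s z hp hq hI)⟩
    · exact ⟨_, Or.inl (.antizombie_regular_true s z hp hq hI)⟩
  · cases hI : I p q
    · exact ⟨_, Or.inl (.antizombie_antizombie_false s z z' hp hq hI)⟩
    · exact ⟨_, Or.inl (.antizombie_antizombie_true s z z' hp hq hI)⟩
  · exact ⟨_, Or.inr (.zombie_antizombie s z' z hq hp)⟩
  · cases hI : I p q
    · exact ⟨_, Or.inl (.zombie_regular_false s z hp hq hI)⟩
    · exact ⟨_, Or.inl (.zombie_regular_true s z hp hq hI)⟩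
  · exact ⟨_, Or.inl (.zombie_antizombie s z z' hp hq)⟩
  · cases hI : I p q
    · exact ⟨_, Or.inl (.zombie_zombie_false s z z' hp hq hI)⟩
    · exact ⟨_, Or.inl (.zombie_zombie_true s z z' hp hq hI)⟩

theorem Invariant.exists_top (hG : GoodConnections (Z₀ ∪ W) T I t₁) {s : ZState α}
    (hs : Invariant Z₀ W T I t₁ s) {p : α} (hp : p ∈ Z₀ ∪ W)
    (hunf : ¬ s.Finished Z₀ W T t₁ p) : ∃ q, IsTopCard (T p) (s.stack p) q ∧ T p q < t₁ := by
  rw [finished_iff, not_or] at hunf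
  obtain ⟨-, h⟩ := hunf
  push Not at h
  obtain ⟨r, hr, hlt⟩ := h
  obtain ⟨q, hq, hle⟩ := hG.exists_isTopCard hp (fun x hx => (hs.stack_mem p x hx).2.1) hr hlt
  exact ⟨q, hq, hle.trans_lt hlt⟩

theorem Invariant.exists_step (hG : GoodConnections (Z₀ ∪ W) T I t₁) {s : ZState α}
    (hs : Invariant Z₀ W T I t₁ s)
    (h : ¬ (s.inv = [] ∧ ∀ p ∈ Z₀ ∪ W, s.Finished Z₀ W T t₁ p)) :
    ∃ s', Step Z₀ W T I t₁ ord s s' := by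
  rcases hinv : s.inv with _ | ⟨⟨p, q⟩, l⟩
  · rw [hinv] at h
    simp only [true_and, not_forall] at h
    obtain ⟨p, hp, hunf⟩ := h
    obtain ⟨p', ⟨hp', hunf'⟩, hmin⟩ := (measure ord).wf.has_min
      {p | p ∈ Z₀ ∪ W ∧ ¬ s.Finished Z₀ W T t₁ p} ⟨p, hp, hunf⟩
    obtain ⟨q, hq, hlt⟩ := hs.exists_top hG hp' hunf'
    exact ⟨_, .choose s p' q hinv hp' hunf' (fun r hr hr' => not_lt.1 (hmin r ⟨hr, hr'⟩)) hq hlt⟩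
  · obtain ⟨hd, hp, htop⟩ := hs.inv_mem p q (by simp [hinv])
    by_cases hq : s.Finished Z₀ W T t₁ q
    · exact ⟨_, .drop s p q q l hinv hq htop⟩
    · obtain ⟨b, hb, -⟩ := hs.exists_top hG hd.snd_mem hq
      by_cases hlt : T q b < T p q
      · exact ⟨_, .descend s p q b l hinv hq hb hlt⟩
      · obtain ⟨s₁, hs₁⟩ := s.exists_duel p q q b (T := T) (I := I)
        exact ⟨_, .duel s s₁ p q q b l hinv hq htop hb hlt hs₁⟩

theorem runsUnambiguously (hG : GoodConnections (Z₀ ∪ W) T I t₁) (hZW : Disjoint Z₀ W)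
    (hord : Set.InjOn ord (Z₀ ∪ W)) : RunsUnambiguously Z₀ W T I t₁ ord := by
  intro s hreach
  have hs : Invariant Z₀ W T I t₁ s := by
    induction hreach with
    | refl => exact invariant_initial hZW
    | tail _ h ih => exact ih.step hG hZW (ih.reachedStep hG hZW h)
  refine ⟨hs.unique, or_iff_not_imp_left.2 fun h => ?_⟩
  obtain ⟨s', hs'⟩ := hs.exists_step hG h (ord := ord)
  exact ⟨s', hs', fun s'' hs'' => ReachedStep.unique hG hZW hord hs
    (hs.reachedStep hG hZW hs'') (hs.reachedStep hG hZW hs')⟩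

/-- Only regular points are converted. A special loser therefore either keeps its family or dies in
its one remaining system. -/
theorem Settled.persists {s s₁ : ZState α} {l w : α} (h : Settled Z₀ W T l w s s₁) {p z : α}
    (hp : p ∈ s.A z ∪ s.Z z) : p ∈ s₁.A z ∪ s₁.Z z ∨ s₁.Dead Z₀ W p := by
  by_cases hpl : p = l
  · subst hpl
    rcases h.loser with h1 | h1 | h1 | h1
    · exact Or.inr h1.1
    · left
      rcases hp with hp | hp
      · exact Or.inl ((h1.2.2 z).1.2 hp)
      · exact Or.inr ((h1.2.2 z).2.2 hp)
    · exact absurd hp (by simpa using h1.2.1 z)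
    · exact absurd hp (by simpa using h1.2.1 z)
  · left
    simpa only [mem_union, h.A_ne p hpl, h.Z_ne p hpl] using hp

/-- The changes that a step makes to a point `p`. -/
structure Progress (Z₀ W : Set α) (T : α → α → ℝ≥0∞) (s s' : ZState α) (p : α) : Prop where
  stack : s'.stack p ⊆ s.stack p
  e : s'.e p = s.e p ∨ (s.e p = ⊤ ∧ s'.e p = s.currentTime T ∧ s'.e p < ⊤ ∧
    ∃ r ∈ s.stack p, T p r = s.currentTime T)
  e' : s'.e' p = s.e' p ∨ (s.e' p = ⊤ ∧ s'.e' p = s.currentTime T ∧ s'.e' p < ⊤ ∧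
    ∃ r ∈ s.stack p, T p r = s.currentTime T)
  persists : ∀ z, p ∈ s.A z ∪ s.Z z → p ∈ s'.A z ∪ s'.Z z ∨ s'.Dead Z₀ W p

theorem ReachedStep.progress (hG : GoodConnections (Z₀ ∪ W) T I t₁) {s s' : ZState α}
    (hs : Invariant Z₀ W T I t₁ s) (h : ReachedStep Z₀ W T I t₁ ord s s') (p : α) :
    Progress Z₀ W T s s' p := by
  cases h with
  | choose => exact ⟨subset_rfl, Or.inl rfl, Or.inl rfl, fun z h => Or.inl h⟩
  | drop p' q' l h_inv h_dead =>
    exact ⟨fun r hr => ((mem_popCard_stack s p' q' p r).1 hr).1, Or.inl rfl, Or.inl rfl,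
      fun z h => Or.inl h⟩
  | descend => exact ⟨subset_rfl, Or.inl rfl, Or.inl rfl, fun z h => Or.inl h⟩
  | duel s₁ p' q' k w l h_inv h_dead h_top h_pair h_I h_settled =>
    obtain ⟨hd, hp, htop⟩ := hs.inv_mem p' q' (by simp [h_inv])
    have hct : s.currentTime T = T p' q' := by simp [currentTime, h_inv]
    have hkw : T k w = T p' q' ∧ w ∈ s.stack k := by
      rcases h_pair with ⟨rfl, rfl⟩ | ⟨rfl, rfl⟩
      · exact ⟨rfl, htop.1⟩
      · exact ⟨hG.symm _ _, h_top.1⟩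
    have hlt : T k w < ⊤ := hkw.1 ▸ hd.lt.trans_le le_top
    refine ⟨fun r hr => ((h_settled.mem_stack p r).1 hr).1, ?_, ?_, fun z h => h_settled.persists h⟩
    · by_cases hpk : p = k
      · subst hpk
        rcases h_settled.e_change p with h | ⟨h1, h2⟩
        · exact Or.inl h
        · refine Or.inr ⟨h1, ?_, ?_, w, hkw.2, by rw [hct, hkw.1]⟩
          · rw [hct, ← hkw.1]; exact h2
          · exact h2.trans_lt hlt
      · exact Or.inl (h_settled.e_ne p hpk)
    · by_cases hpk : p = k
      · subst hpk
        rcases h_settled.e'_change p with h | ⟨h1, h2⟩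
        · exact Or.inl h
        · refine Or.inr ⟨h1, ?_, ?_, w, hkw.2, by rw [hct, hkw.1]⟩
          · rw [hct, ← hkw.1]; exact h2
          · exact h2.trans_lt hlt
      · exact Or.inl (h_settled.e'_ne p hpk)

section Run

variable {s : ℕ → ZState α}

theorem IsZRun.invariant (hG : GoodConnections (Z₀ ∪ W) T I t₁) (hZW : Disjoint Z₀ W)
    (hs : IsZRun Z₀ W T I t₁ ord s) (n : ℕ) : Invariant Z₀ W T I t₁ (s n) :=
  IsExecution.invariant hs (invariant_initial hZW)
    (fun _ _ h h' => h.step hG hZW (h.reachedStep hG hZW h')) n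

theorem IsZRun.progress (hG : GoodConnections (Z₀ ∪ W) T I t₁) (hZW : Disjoint Z₀ W)
    (hs : IsZRun Z₀ W T I t₁ ord s) (n : ℕ) (p : α) : Progress Z₀ W T (s n) (s (n + 1)) p := by
  have hi := hs.invariant hG hZW n
  rcases hs.2 n with h | ⟨-, h⟩
  · exact (hi.reachedStep hG hZW h).progress hG hi p
  · rw [h]; exact ⟨subset_rfl, Or.inl rfl, Or.inl rfl, fun z h => Or.inl h⟩

theorem IsZRun.e_anti (hG : GoodConnections (Z₀ ∪ W) T I t₁) (hZW : Disjoint Z₀ W)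
    (hs : IsZRun Z₀ W T I t₁ ord s) {n m : ℕ} (hnm : n ≤ m) (p : α) :
    (s m).e p ≤ (s n).e p ∧ ((s n).e p < ⊤ → (s m).e p = (s n).e p) := by
  induction m, hnm using Nat.le_induction with
  | base => exact ⟨le_rfl, fun _ => rfl⟩
  | succ m _ ih =>
    rcases (hs.progress hG hZW m p).e with h | h
    · rw [h]; exact ih
    · refine ⟨?_, fun h' => ?_⟩
      · have := ih.1
        rw [h.1, top_le_iff] at this
        rw [this]; exact le_top
      · rw [ih.2 h'] at h; rw [h.1] at h'; exact absurd h' (lt_irrefl _)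

theorem IsZRun.e'_anti (hG : GoodConnections (Z₀ ∪ W) T I t₁) (hZW : Disjoint Z₀ W)
    (hs : IsZRun Z₀ W T I t₁ ord s) {n m : ℕ} (hnm : n ≤ m) (p : α) :
    (s m).e' p ≤ (s n).e' p ∧ ((s n).e' p < ⊤ → (s m).e' p = (s n).e' p) := by
  induction m, hnm using Nat.le_induction with
  | base => exact ⟨le_rfl, fun _ => rfl⟩
  | succ m _ ih =>
    rcases (hs.progress hG hZW m p).e' with h | h
    · rw [h]; exact ih
    · refine ⟨?_, fun h' => ?_⟩
      · have := ih.1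
        rw [h.1, top_le_iff] at this
        rw [this]; exact le_top
      · rw [ih.2 h'] at h; rw [h.1] at h'; exact absurd h' (lt_irrefl _)

theorem IsZRun.dead_mono (hG : GoodConnections (Z₀ ∪ W) T I t₁) (hZW : Disjoint Z₀ W)
    (hs : IsZRun Z₀ W T I t₁ ord s) {n m : ℕ} (hnm : n ≤ m) {p : α}
    (h : (s n).Dead Z₀ W p) : (s m).Dead Z₀ W p :=
  ZState.dead_mono (hs.e_anti hG hZW hnm p).1 (hs.e'_anti hG hZW hnm p).1 h

/-- The cards of the points that have not died for good. -/
def openCards (Z₀ W : Set α) (s : ZState α) (p : α) : Set α :=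
  {r | ¬ s.Dead Z₀ W p ∧ r ∈ s.stack p}

theorem finished_iff_openCards {s : ZState α} {p : α} :
    s.Finished Z₀ W T t₁ p ↔ ∀ r ∈ s.openCards Z₀ W p, t₁ ≤ T p r := by
  rw [finished_iff]
  by_cases h : s.Dead Z₀ W p <;> simp [openCards, h]

/-- A loser that dies for good keeps its card, so the raw stacks do not shrink after every duel.
`openCards` ignores the dead and does shrink. -/
theorem IsZRun.isInvestigation (hG : GoodConnections (Z₀ ∪ W) T I t₁) (hZW : Disjoint Z₀ W)
    (hs : IsZRun Z₀ W T I t₁ ord s) :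
    IsInvestigation (Z₀ ∪ W) T t₁ ord (fun n => (s n).inv) (fun n => (s n).openCards Z₀ W) where
  start := by simp [hs.1, initial]
  card n p _ q hq := ((hs.invariant hG hZW n).stack_mem p q hq.2).2
  anti n p r hr := ⟨fun h => hr.1 (hs.dead_mono hG hZW (Nat.le_succ n) h),
    (hs.progress hG hZW n p).stack hr.2⟩
  cons n p q l hinv := by
    have hi := hs.invariant hG hZW n
    obtain ⟨hd, hp, htop⟩ := hi.inv_mem p q (by simp [hinv])
    refine ⟨hd, ?_⟩
    rcases hs.2 n with h | ⟨h, -⟩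
    · have h := hi.reachedStep hG hZW h
      generalize s (n + 1) = s' at h ⊢
      cases h with
      | choose p' q' h_inv => rw [h_inv] at hinv; cases hinv
      | drop p' q' l' h_inv h_dead =>
        rw [hinv] at h_inv; cases h_inv
        exact Or.inl ⟨rfl, fun h => ((mem_popCard_stack _ p q p q).1 h.2).2 ⟨rfl, rfl⟩⟩
      | descend p' q' r l' h_inv h_dead h_top h_early =>
        rw [hinv] at h_inv; cases h_inv
        exact Or.inr ⟨r, ⟨h_dead, h_top.1⟩, h_early, rfl⟩
      | duel s₁ p' q' k w l' h_inv h_dead h_top h_pair h_I h_settled =>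
        rw [hinv] at h_inv; cases h_inv
        refine Or.inl ⟨rfl, fun h => ?_⟩
        have h1 := (h_settled.mem_stack p q).1 h.2
        rcases h_pair with ⟨rfl, rfl⟩ | ⟨rfl, rfl⟩
        · exact h1.2.2 ⟨rfl, rfl, h.1⟩
        · exact h1.2.1 ⟨rfl, rfl⟩
    · refine absurd (hi.exists_step hG fun hcon => ?_) h
      rw [hinv] at hcon; cases hcon.1
  nil n hinv := by
    have hi := hs.invariant hG hZW n
    have hinv : (s n).inv = [] := hinv
    rcases hs.2 n with h | ⟨h, heq⟩
    · right
      have h := hi.reachedStep hG hZW h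
      generalize s (n + 1) = s' at h ⊢
      cases h with
      | choose p q h_inv h_mem h_unf h_first h_top h_lt =>
        refine ⟨p, q, h_mem, ⟨fun h => h_unf (.of_dead h), h_top.1⟩, h_lt, rfl, ?_⟩
        rintro p' hp' ⟨r, hr, hlt⟩
        refine h_first p' hp' fun hfin => ?_
        exact absurd (finished_iff_openCards.1 hfin r hr) (not_le.2 hlt)
      | drop p q l h_inv | descend p q r l h_inv | duel s₁ p q k w l h_inv =>
        rw [h_inv] at hinv; cases hinv
    · left
      refine ⟨by rw [heq]; exact hinv, fun p hp => ?_⟩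
      by_contra hcon
      refine h (hi.exists_step hG fun h' => hcon ?_)
      exact finished_iff_openCards.1 (h'.2 p hp)

theorem IsZRun.eventually_finished (hG : GoodConnections (Z₀ ∪ W) T I t₁) (hZW : Disjoint Z₀ W)
    (hord : Set.InjOn ord (Z₀ ∪ W)) (hs : IsZRun Z₀ W T I t₁ ord s) {p : α} (hp : p ∈ Z₀ ∪ W) :
    ∃ n, ∀ m ≥ n, (s m).Finished Z₀ W T t₁ p := by
  obtain ⟨n, -, hn⟩ := (hs.isInvestigation hG hZW).eventually_settled hG hord hp
  exact ⟨n, fun m hm => finished_iff_openCards.2 (hn m hm)⟩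

theorem IsZRun.e_isDeathTimes (hG : GoodConnections (Z₀ ∪ W) T I t₁) (hZW : Disjoint Z₀ W)
    (hord : Set.InjOn ord (Z₀ ∪ W)) (hs : IsZRun Z₀ W T I t₁ ord s) :
    (∀ p, ∀ᶠ n in atTop, (s n).e p = ⨅ n, (s n).e p) ∧
      IsDeathTimes W T I t₁ fun p => ⨅ n, (s n).e p := by
  refine PartialDeathTimes.isDeathTimes_iInf hG subset_union_right
    (fun n => (hs.invariant hG hZW n).times) (fun n p hn m hm => ?_)
    (fun n m hnm p => (hs.e_anti hG hZW hnm p).1) (fun p hp => ?_)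
  · rcases le_total n m with h | h
    · exact (hs.e_anti hG hZW h p).2 hn
    · exact ((hs.e_anti hG hZW h p).2 hm).symm
  · obtain ⟨n, hn⟩ := hs.eventually_finished hG hZW hord (Or.inr hp)
    refine ⟨n, fun m hm r hr hlt => ?_⟩
    -- A finished point of `W` that still has a card before `t₁` must be dead in both systems, in
    -- particular in this one.
    rcases finished_iff.1 (hn m hm) with (h | h) | h
    · exact absurd hp (hZW.notMem_of_mem_left h.1)
    · exact (max_lt_iff.1 h.2).1
    · exact absurd (h r hr) (not_le.2 hlt)

theorem IsZRun.e'_isDeathTimes (hG : GoodConnections (Z₀ ∪ W) T I t₁) (hZW : Disjoint Z₀ W)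
    (hord : Set.InjOn ord (Z₀ ∪ W)) (hs : IsZRun Z₀ W T I t₁ ord s) :
    (∀ p, ∀ᶠ n in atTop, (s n).e' p = ⨅ n, (s n).e' p) ∧
      IsDeathTimes (Z₀ ∪ W) T I t₁ fun p => ⨅ n, (s n).e' p := by
  refine PartialDeathTimes.isDeathTimes_iInf hG subset_rfl
    (fun n => (hs.invariant hG hZW n).times') (fun n p hn m hm => ?_)
    (fun n m hnm p => (hs.e'_anti hG hZW hnm p).1) (fun p hp => ?_)
  · rcases le_total n m with h | h
    · exact (hs.e'_anti hG hZW h p).2 hn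
    · exact ((hs.e'_anti hG hZW h p).2 hm).symm
  · obtain ⟨n, hn⟩ := hs.eventually_finished hG hZW hord hp
    refine ⟨n, fun m hm r hr hlt => ?_⟩
    rcases finished_iff.1 (hn m hm) with (h | h) | h
    · exact h.2
    · exact (max_lt_iff.1 h.2).2
    · exact absurd (h r hr) (not_le.2 hlt)

end Run

end ZState

/-! ### Zombies, antizombies and offspring in time -/

namespace ZState

set_option linter.unusedSectionVars false

variable {α : Type*} [DecidableEq α] {Z₀ W : Set α} {T : α → α → ℝ≥0∞} {I : α → α → Bool}
  {t₁ : ℝ≥0∞} {ord : α → ℕ} {s : ℕ → ZState α}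

theorem iInf_e_eq (hG : GoodConnections (Z₀ ∪ W) T I t₁) (hZW : Disjoint Z₀ W)
    (hs : IsZRun Z₀ W T I t₁ ord s) {n : ℕ} {p : α} (h : (s n).e p < ⊤) :
    ⨅ n, (s n).e p = (s n).e p := by
  refine le_antisymm (iInf_le _ n) (le_iInf fun m => ?_)
  rcases le_total n m with hnm | hnm
  · exact ((hs.e_anti hG hZW hnm p).2 h).ge
  · exact (hs.e_anti hG hZW hnm p).1

theorem iInf_e'_eq (hG : GoodConnections (Z₀ ∪ W) T I t₁) (hZW : Disjoint Z₀ W)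
    (hs : IsZRun Z₀ W T I t₁ ord s) {n : ℕ} {p : α} (h : (s n).e' p < ⊤) :
    ⨅ n, (s n).e' p = (s n).e' p := by
  refine le_antisymm (iInf_le _ n) (le_iInf fun m => ?_)
  rcases le_total n m with hnm | hnm
  · exact ((hs.e'_anti hG hZW hnm p).2 h).ge
  · exact (hs.e'_anti hG hZW hnm p).1

theorem Invariant.notMem_of_dead (hZW : Disjoint Z₀ W) {u : ZState α}
    (hu : Invariant Z₀ W T I t₁ u) {p : α} (h : u.Dead Z₀ W p) (z : α) :
    p ∉ u.A z ∪ u.Z z := by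
  rintro (hp | hp)
  · obtain ⟨-, hW, -, he⟩ := hu.A_mem p z hp
    rcases h with h | h
    · exact hZW.notMem_of_mem_left h.1 hW
    · rw [he] at h; exact absurd h.2 (by simp)
  · obtain ⟨-, -, he', -⟩ := hu.Z_mem p z hp
    rcases h with h | h
    · rw [he'] at h; exact absurd h.2 (by simp)
    · rw [he'] at h; exact absurd h.2 (by simp)

/-- A special point keeps its ancestor until it dies for good. -/
theorem IsZRun.persists (hG : GoodConnections (Z₀ ∪ W) T I t₁) (hZW : Disjoint Z₀ W)
    (hs : IsZRun Z₀ W T I t₁ ord s) {n m : ℕ} (hnm : n ≤ m) {p z : α}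
    (h : p ∈ (s n).A z ∪ (s n).Z z) : p ∈ (s m).A z ∪ (s m).Z z ∨ (s m).Dead Z₀ W p := by
  induction m, hnm using Nat.le_induction with
  | base => exact Or.inl h
  | succ m _ ih =>
    rcases ih with ih | ih
    · exact (hs.progress hG hZW m p).persists z ih
    · exact Or.inr (hs.dead_mono hG hZW (Nat.le_succ m) ih)

/-- The two moments may differ: the ancestor persists from the earlier to the later one, unless the
point has died for good, and then it belongs to no family. -/
theorem IsZRun.ancestor_unique (hG : GoodConnections (Z₀ ∪ W) T I t₁) (hZW : Disjoint Z₀ W)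
    (hs : IsZRun Z₀ W T I t₁ ord s) {n m : ℕ} {p z z' : α}
    (h : p ∈ (s n).A z ∪ (s n).Z z) (h' : p ∈ (s m).A z' ∪ (s m).Z z') : z = z' := by
  wlog hnm : n ≤ m generalizing n m z z'
  · exact (this h' h (le_of_not_ge hnm)).symm
  have hi := hs.invariant hG hZW m
  rcases hs.persists hG hZW hnm h with h1 | h1
  · exact hi.unique p z z' h1 h'
  · exact absurd h' (hi.notMem_of_dead hZW h1 z')

/-- The step must be the one in which `e' p` becomes finite. Had it been finite before, with `e p`
still infinite, then `p` would already have been an antizombie, and of the same ancestor. The three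
companion statements follow the same pattern. -/
theorem IsZRun.added_A (hG : GoodConnections (Z₀ ∪ W) T I t₁) (hZW : Disjoint Z₀ W)
    (hs : IsZRun Z₀ W T I t₁ ord s) {n : ℕ} {p z : α} (h : p ∉ (s n).A z)
    (h' : p ∈ (s (n + 1)).A z) :
    p ∈ W ∧ ⨅ n, (s n).e' p = (s n).currentTime T := by
  have hi := hs.invariant hG hZW n
  have hi' := hs.invariant hG hZW (n + 1)
  obtain ⟨hz, hW, he', he⟩ := hi'.A_mem p z h'
  refine ⟨hW, ?_⟩
  rw [iInf_e'_eq hG hZW hs he']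
  rcases (hs.progress hG hZW n p).e' with heq | heq
  · have he0 : (s n).e p = ⊤ := top_le_iff.1 (he ▸ (hs.e_anti hG hZW (Nat.le_succ n) p).1)
    obtain ⟨z', hz'⟩ := hi.A_exists p hW (heq ▸ he') he0
    have := hs.ancestor_unique hG hZW (n := n) (m := n + 1) (Or.inl hz') (Or.inl h')
    exact absurd (this ▸ hz') h
  · exact heq.2.1

theorem IsZRun.removed_A (hG : GoodConnections (Z₀ ∪ W) T I t₁) (hZW : Disjoint Z₀ W)
    (hs : IsZRun Z₀ W T I t₁ ord s) {n : ℕ} {p z : α} (h : p ∈ (s n).A z)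
    (h' : p ∉ (s (n + 1)).A z) : ⨅ n, (s n).e p = (s n).currentTime T := by
  have hi := hs.invariant hG hZW n
  have hi' := hs.invariant hG hZW (n + 1)
  obtain ⟨hz, hW, he', he⟩ := hi.A_mem p z h
  have he'' : (s (n + 1)).e' p < ⊤ := (hs.e'_anti hG hZW (Nat.le_succ n) p).1.trans_lt he'
  rcases eq_top_or_lt_top ((s (n + 1)).e p) with htop | hlt
  · obtain ⟨z', hz'⟩ := hi'.A_exists p hW he'' htop
    have := hs.ancestor_unique hG hZW (n := n) (m := n + 1) (Or.inl h) (Or.inl hz')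
    exact absurd (this ▸ hz') h'
  · rw [iInf_e_eq hG hZW hs hlt]
    rcases (hs.progress hG hZW n p).e with heq | heq
    · rw [heq, he] at hlt; exact absurd hlt (lt_irrefl _)
    · exact heq.2.1

theorem IsZRun.added_Z (hG : GoodConnections (Z₀ ∪ W) T I t₁) (hZW : Disjoint Z₀ W)
    (hs : IsZRun Z₀ W T I t₁ ord s) {n : ℕ} {p z : α} (h : p ∉ (s n).Z z)
    (h' : p ∈ (s (n + 1)).Z z) :
    p ∈ W ∧ ⨅ n, (s n).e p = (s n).currentTime T := by
  have hi := hs.invariant hG hZW n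
  have hi' := hs.invariant hG hZW (n + 1)
  obtain ⟨hz, hV, he', he⟩ := hi'.Z_mem p z h'
  have he0 : (s n).e' p = ⊤ := top_le_iff.1 (he' ▸ (hs.e'_anti hG hZW (Nat.le_succ n) p).1)
  have hnot : ¬ (p ∈ W → (s n).e p < ⊤) := fun hcon => by
    obtain ⟨z', hz'⟩ := hi.Z_exists p hV he0 hcon
    have := hs.ancestor_unique hG hZW (n := n) (m := n + 1) (Or.inr hz') (Or.inr h')
    exact absurd (this ▸ hz') h
  push Not at hnot
  refine ⟨hnot.1, ?_⟩
  rw [iInf_e_eq hG hZW hs (he hnot.1)]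
  rcases (hs.progress hG hZW n p).e with heq | heq
  · exact absurd (heq ▸ he hnot.1) (not_lt.2 hnot.2)
  · exact heq.2.1

theorem IsZRun.removed_Z (hG : GoodConnections (Z₀ ∪ W) T I t₁) (hZW : Disjoint Z₀ W)
    (hs : IsZRun Z₀ W T I t₁ ord s) {n : ℕ} {p z : α} (h : p ∈ (s n).Z z)
    (h' : p ∉ (s (n + 1)).Z z) : ⨅ n, (s n).e' p = (s n).currentTime T := by
  have hi := hs.invariant hG hZW n
  have hi' := hs.invariant hG hZW (n + 1)
  obtain ⟨hz, hV, he', he⟩ := hi.Z_mem p z h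
  have he'' : p ∈ W → (s (n + 1)).e p < ⊤ := fun hW =>
    (hs.e_anti hG hZW (Nat.le_succ n) p).1.trans_lt (he hW)
  rcases eq_top_or_lt_top ((s (n + 1)).e' p) with htop | hlt
  · obtain ⟨z', hz'⟩ := hi'.Z_exists p hV htop he''
    have := hs.ancestor_unique hG hZW (n := n) (m := n + 1) (Or.inr h) (Or.inr hz')
    exact absurd (this ▸ hz') h'
  · rw [iInf_e'_eq hG hZW hs hlt]
    rcases (hs.progress hG hZW n p).e' with heq | heq
    · rw [heq, he'] at hlt; exact absurd hlt (lt_irrefl _)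
    · exact heq.2.1

theorem exists_change {Q : ℕ → Prop} {n m : ℕ} (hnm : n ≤ m) (hn : Q n) (hm : ¬ Q m) :
    ∃ k, Q k ∧ ¬ Q (k + 1) := by
  induction m, hnm using Nat.le_induction with
  | base => exact absurd hn hm
  | succ m _ ih =>
    by_cases h : Q m
    · exact ⟨m, h, hm⟩
    · exact ih h

theorem exists_lt_top_of_iInf {g : ℕ → ℝ≥0∞} (h : ⨅ n, g n < ⊤) : ∃ n, g n < ⊤ := by
  by_contra hcon
  push Not at hcon
  simp [fun n => top_le_iff.1 (hcon n)] at h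

/-- Entry happens at time `e'` and exit at time `e`. The middle condition stands for the convention
on `Z₀`: there `e` stays infinite, although these points count as dead from time zero. -/
theorem IsZRun.antizombie_iff (hG : GoodConnections (Z₀ ∪ W) T I t₁) (hZW : Disjoint Z₀ W)
    (hs : IsZRun Z₀ W T I t₁ ord s) {t : ℝ≥0∞} (ht : t < ⊤) {p : α} (hp : p ∈ Z₀ ∪ W) :
    (∃ z ∈ Z₀, p ∈ antizombiesAt T s z t) ↔
      ⨅ n, (s n).e' p ≤ t ∧ p ∉ Z₀ ∧ t < ⨅ n, (s n).e p := by
  constructor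
  · rintro ⟨z, -, hadd | ⟨n, h1, h2, h3⟩, hrem⟩
    · simp [hs.1, initial] at hadd
    obtain ⟨hW, heq⟩ := hs.added_A hG hZW h1 h2
    refine ⟨heq ▸ h3, hZW.notMem_of_mem_right hW, ?_⟩
    by_contra hcon
    push Not at hcon
    obtain ⟨N, hN⟩ := exists_lt_top_of_iInf (hcon.trans_lt ht)
    have hN' : p ∉ (s (max N (n + 1))).A z := fun h => by
      have h4 := ((hs.invariant hG hZW _).A_mem p z h).2.2.2
      have h5 := (hs.e_anti hG hZW (le_max_left N (n + 1)) p).1.trans_lt hN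
      rw [h4] at h5; exact lt_irrefl _ h5
    obtain ⟨k, hk, hk'⟩ := exists_change (Q := fun k => p ∈ (s k).A z) (le_max_right _ _) h2 hN'
    exact hrem ⟨k, hk, hk', (hs.removed_A hG hZW hk hk') ▸ hcon⟩
  · rintro ⟨h1, h2, h3⟩
    have hW : p ∈ W := hp.resolve_left h2
    obtain ⟨N, hN⟩ := exists_lt_top_of_iInf (h1.trans_lt ht)
    obtain ⟨n, hn, hn'⟩ := exists_change (Q := fun k => (s k).e' p = ⊤) (Nat.zero_le N)
      (by simp [hs.1, initial]) hN.ne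
    have hlt : (s (n + 1)).e' p < ⊤ := lt_top_iff_ne_top.2 hn'
    obtain ⟨-, heq, -, r, hr, hr'⟩ := (hs.progress hG hZW n p).e'.resolve_left fun h => by
      rw [h, hn] at hlt; exact lt_irrefl _ hlt
    rw [iInf_e'_eq hG hZW hs hlt, heq] at h1
    -- At the step in which `p` dies in the augmented system it is still alive in the other one.
    -- Otherwise its open card at the current time would force `e p` to be at most that time, hence
    -- at most `t`.
    have he : (s (n + 1)).e p = ⊤ := by
      by_contra hcon
      have hlt' := lt_top_iff_ne_top.2 hcon
      have hle : (s (n + 1)).e p ≤ (s n).currentTime T := by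
        rcases (hs.progress hG hZW n p).e with h | h
        · rw [h] at hlt' ⊢
          rw [← hr']
          exact (hs.invariant hG hZW n).times.le p hW hlt' r hr
        · exact h.2.1.le
      rw [iInf_e_eq hG hZW hs hlt'] at h3
      exact absurd (hle.trans h1) (not_le.2 h3)
    obtain ⟨z, hz⟩ := (hs.invariant hG hZW (n + 1)).A_exists p hW hlt he
    have hz' : p ∉ (s n).A z := fun h => by
      have := ((hs.invariant hG hZW n).A_mem p z h).2.2.1
      rw [hn] at this; exact lt_irrefl _ this
    refine ⟨z, ((hs.invariant hG hZW (n + 1)).A_mem p z hz).1, Or.inr ⟨n, hz', hz, h1⟩, ?_⟩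
    rintro ⟨m, hm, hm', hmt⟩
    rw [hs.removed_A hG hZW hm hm'] at h3
    exact absurd hmt (not_le.2 h3)

theorem IsZRun.zombie_iff (hG : GoodConnections (Z₀ ∪ W) T I t₁) (hZW : Disjoint Z₀ W)
    (hs : IsZRun Z₀ W T I t₁ ord s) {t : ℝ≥0∞} (ht : t < ⊤) {p : α} (hp : p ∈ Z₀ ∪ W) :
    (∃ z ∈ Z₀, p ∈ zombiesAt T s z t) ↔
      (p ∈ Z₀ ∨ ⨅ n, (s n).e p ≤ t) ∧ t < ⨅ n, (s n).e' p := by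
  constructor
  · rintro ⟨z, -, hadd, hrem⟩
    have hex : (p ∈ Z₀ ∨ ⨅ n, (s n).e p ≤ t) ∧ ∃ n, p ∈ (s n).Z z := by
      rcases hadd with hadd | ⟨n, h1, h2, h3⟩
      · refine ⟨?_, 0, hadd⟩
        simp only [hs.1, initial] at hadd
        obtain ⟨hz, rfl⟩ := hadd
        exact Or.inl hz
      · exact ⟨Or.inr ((hs.added_Z hG hZW h1 h2).2 ▸ h3), n + 1, h2⟩
    obtain ⟨h1, n, h2⟩ := hex
    refine ⟨h1, ?_⟩
    by_contra hcon
    push Not at hcon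
    obtain ⟨N, hN⟩ := exists_lt_top_of_iInf (hcon.trans_lt ht)
    have hN' : p ∉ (s (max N n)).Z z := fun h => by
      have h4 := ((hs.invariant hG hZW _).Z_mem p z h).2.2.1
      have h5 := (hs.e'_anti hG hZW (le_max_left N n) p).1.trans_lt hN
      rw [h4] at h5; exact lt_irrefl _ h5
    obtain ⟨k, hk, hk'⟩ := exists_change (Q := fun k => p ∈ (s k).Z z) (le_max_right _ _) h2 hN'
    exact hrem ⟨k, hk, hk', (hs.removed_Z hG hZW hk hk') ▸ hcon⟩
  · rintro ⟨h1, h3⟩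
    suffices H : ∃ z ∈ Z₀, p ∈ (s 0).Z z ∨
        ∃ n, p ∉ (s n).Z z ∧ p ∈ (s (n + 1)).Z z ∧ (s n).currentTime T ≤ t by
      obtain ⟨z, hz, h⟩ := H
      refine ⟨z, hz, h, ?_⟩
      rintro ⟨m, hm, hm', hmt⟩
      rw [hs.removed_Z hG hZW hm hm'] at h3
      exact absurd hmt (not_le.2 h3)
    -- A point of the augmentation is the founding member of its own family; all others enter when
    -- `e` becomes finite.
    by_cases hZ : p ∈ Z₀
    · exact ⟨p, hZ, Or.inl (by simp [hs.1, initial, hZ])⟩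
    have hW : p ∈ W := hp.resolve_left hZ
    have h1 := h1.resolve_left hZ
    obtain ⟨N, hN⟩ := exists_lt_top_of_iInf (h1.trans_lt ht)
    obtain ⟨n, hn, hn'⟩ := exists_change (Q := fun k => (s k).e p = ⊤) (Nat.zero_le N)
      (by simp [hs.1, initial]) hN.ne
    have hlt : (s (n + 1)).e p < ⊤ := lt_top_iff_ne_top.2 hn'
    obtain ⟨-, heq, -, r, hr, hr'⟩ := (hs.progress hG hZW n p).e.resolve_left fun h => by
      rw [h, hn] at hlt; exact lt_irrefl _ hlt
    rw [iInf_e_eq hG hZW hs hlt, heq] at h1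
    have he : (s (n + 1)).e' p = ⊤ := by
      by_contra hcon
      have hlt' := lt_top_iff_ne_top.2 hcon
      have hle : (s (n + 1)).e' p ≤ (s n).currentTime T := by
        rcases (hs.progress hG hZW n p).e' with h | h
        · rw [h] at hlt' ⊢
          rw [← hr']
          exact (hs.invariant hG hZW n).times'.le p hp hlt' r hr
        · exact h.2.1.le
      rw [iInf_e'_eq hG hZW hs hlt'] at h3
      exact absurd (hle.trans h1) (not_le.2 h3)
    obtain ⟨z, hz⟩ := (hs.invariant hG hZW (n + 1)).Z_exists p hp he fun _ => hlt
    have hz' : p ∉ (s n).Z z := fun h => by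
      have := ((hs.invariant hG hZW n).Z_mem p z h).2.2.2 hW
      rw [hn] at this; exact lt_irrefl _ this
    exact ⟨z, ((hs.invariant hG hZW (n + 1)).Z_mem p z hz).1, Or.inr ⟨n, hz', hz, h1⟩⟩

theorem exists_mem_of_mem_membersAt {K : ZState α → Set α} {t : ℝ≥0∞} {p : α}
    (h : p ∈ membersAt T s K t) : ∃ n, p ∈ K (s n) := by
  rcases h.1 with h | ⟨n, -, h, -⟩
  · exact ⟨0, h⟩
  · exact ⟨n + 1, h⟩

theorem exists_mem_of_mem_offspring {z p : α} (h : p ∈ offspring T t₁ s z) :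
    ∃ n, p ∈ (s n).A z ∪ (s n).Z z := by
  simp only [offspring, mem_union, mem_iUnion] at h
  rcases h with ⟨t, -, h⟩ | ⟨t, -, h⟩
  · obtain ⟨n, hn⟩ := exists_mem_of_mem_membersAt h
    exact ⟨n, Or.inl hn⟩
  · obtain ⟨n, hn⟩ := exists_mem_of_mem_membersAt h
    exact ⟨n, Or.inr hn⟩

theorem IsZRun.disjoint_offspring (hG : GoodConnections (Z₀ ∪ W) T I t₁) (hZW : Disjoint Z₀ W)
    (hs : IsZRun Z₀ W T I t₁ ord s) {z z' : α} (hz : z ≠ z') :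
    Disjoint (offspring T t₁ s z) (offspring T t₁ s z') := by
  refine Set.disjoint_left.2 fun p hp hp' => hz ?_
  obtain ⟨n, hn⟩ := exists_mem_of_mem_offspring hp
  obtain ⟨m, hm⟩ := exists_mem_of_mem_offspring hp'
  exact hs.ancestor_unique hG hZW hn hm

end ZState

/-- Sheriff with zombies computes the death times of Sheriff with and without the augmentation. -/
theorem GoodConnections.sheriff_with_zombies {α : Type*} [DecidableEq α] {Z₀ W : Set α}
    {T : α → α → ℝ≥0∞} {I : α → α → Bool} {t₁ : ℝ≥0∞}
    (hG : GoodConnections (Z₀ ∪ W) T I t₁) (hZW : Disjoint Z₀ W) (ord ord₁ ord₂ : α → ℕ)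
    (hord : Set.InjOn ord (Z₀ ∪ W)) (hord₁ : Set.InjOn ord₁ W)
    (hord₂ : Set.InjOn ord₂ (Z₀ ∪ W)) :
    ZState.RunsUnambiguously Z₀ W T I t₁ ord ∧
    ∀ (s : ℕ → ZState α) (σ₁ σ₂ : ℕ → SheriffState α),
      ZState.IsZRun Z₀ W T I t₁ ord s →
      SheriffState.IsSheriffRun W T I t₁ ord₁ σ₁ →
      SheriffState.IsSheriffRun (Z₀ ∪ W) T I t₁ ord₂ σ₂ →
      let dd : α → ℝ≥0∞ := SheriffState.nonAugmentedDeathTime Z₀ T σ₁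
      let dd' : α → ℝ≥0∞ := SheriffState.deathTime T σ₂
      (∀ p ∈ Z₀ ∪ W, ∀ᶠ n in atTop, (s n).Finished Z₀ W T t₁ p) ∧
      (∀ p ∈ W, ∀ᶠ n in atTop, (s n).e p = dd p) ∧
      (∀ p ∈ Z₀ ∪ W, ∀ᶠ n in atTop, (s n).e' p = dd' p) ∧
      (∀ t : ℝ≥0∞, t < t₁ → ∀ p ∈ Z₀ ∪ W,
        ((∃ z ∈ Z₀, p ∈ ZState.antizombiesAt T s z t) ↔ dd' p ≤ t ∧ t < dd p) ∧
        ((∃ z ∈ Z₀, p ∈ ZState.zombiesAt T s z t) ↔ dd p ≤ t ∧ t < dd' p)) ∧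
      (∀ z ∈ Z₀, ∀ z' ∈ Z₀, z ≠ z' →
        Disjoint (ZState.offspring T t₁ s z) (ZState.offspring T t₁ s z')) := by
  refine ⟨ZState.runsUnambiguously hG hZW hord, fun s σ₁ σ₂ hs hσ₁ hσ₂ => ?_⟩
  intro dd dd'
  have hGW : GoodConnections W T I t₁ := hG.mono subset_union_right
  obtain ⟨hev, hdt⟩ := hs.e_isDeathTimes hG hZW hord
  obtain ⟨hev', hdt'⟩ := hs.e'_isDeathTimes hG hZW hord
  have hW : ∀ p ∈ W, ⨅ n, (s n).e p = dd p := fun p hp => by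
    have h1 : dd p = SheriffState.deathTime T σ₁ p :=
      if_neg (hZW.notMem_of_mem_right hp)
    rw [h1]
    exact hGW.deathTimes_unique hdt (hσ₁.isDeathTimes hGW hord₁) hp
  have hV : ∀ p ∈ Z₀ ∪ W, ⨅ n, (s n).e' p = dd' p := fun p hp =>
    hG.deathTimes_unique hdt' (hσ₂.isDeathTimes hG hord₂) hp
  refine ⟨fun p hp => ?_, fun p hp => hW p hp ▸ hev p, fun p hp => hV p hp ▸ hev' p,
    fun t ht p hp => ?_, fun z _ z' _ hz => hs.disjoint_offspring hG hZW hz⟩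
  · obtain ⟨n, hn⟩ := hs.eventually_finished hG hZW hord hp
    exact eventually_atTop.2 ⟨n, hn⟩
  · have htop := ht.trans_le le_top
    rw [hs.antizombie_iff hG hZW htop hp, hs.zombie_iff hG hZW htop hp, hV p hp]
    by_cases hZ : p ∈ Z₀
    · have h1 : dd p = 0 := if_pos hZ
      simp [hZ, h1]
    · rw [hW p (hp.resolve_left hZ)]
      simp [hZ]

/-! ### Moments of Poisson processes -/

theorem ENNReal.prod_tsum_eq_tsum_prod {n : ℕ} (f : Fin n → ℕ → ℝ≥0∞) :
    ∏ i, ∑' k, f i k = ∑' j : Fin n → ℕ, ∏ i, f i (j i) := by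
  induction n with
  | zero => simp
  | succ n ih =>
    rw [Fin.prod_univ_succ, ih, ← (Fin.consEquiv fun _ => ℕ).tsum_eq, ENNReal.tsum_prod',
      ← ENNReal.tsum_mul_right]
    refine tsum_congr fun k => ?_
    rw [← ENNReal.tsum_mul_left]
    refine tsum_congr fun j => ?_
    simp [Fin.prod_univ_succ, Fin.consEquiv]

theorem ENNReal.tsum_eq_sum_range_add_tsum (r : ℕ) (f : ℕ → ℝ≥0∞) :
    ∑' k, f k = ∑ k ∈ Finset.range r, f k + ∑' k, f (k + r) :=
  (Summable.sum_add_tsum_nat_add' (k := r) (f := f) ENNReal.summable).symm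

/-- Terms with `k < r` vanish, and shifting the index by `r` turns the series into `m ^ r` times the
total Poisson mass. The case `r = 0` gives the total mass, `r = 1` the mean and `r = 2` the second
moment. -/
theorem tsum_descFactorial_mul_poisson (m : ℝ) (hm : 0 ≤ m) (r : ℕ) :
    ∑' k : ℕ, (k.descFactorial r : ℝ≥0∞) *
      ENNReal.ofReal (Real.exp (-m) * m ^ k / (k.factorial : ℝ)) = ENNReal.ofReal (m ^ r) := by
  rw [ENNReal.tsum_eq_sum_range_add_tsum r]
  have h0 : ∑ k ∈ Finset.range r, (k.descFactorial r : ℝ≥0∞) *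
      ENNReal.ofReal (Real.exp (-m) * m ^ k / (k.factorial : ℝ)) = 0 := by
    refine Finset.sum_eq_zero fun k hk => ?_
    rw [Nat.descFactorial_of_lt (Finset.mem_range.1 hk)]; simp
  have h1 : ∀ k : ℕ, ((k + r).descFactorial r : ℝ≥0∞) *
      ENNReal.ofReal (Real.exp (-m) * m ^ (k + r) / ((k + r).factorial : ℝ)) =
      ENNReal.ofReal (m ^ r * (Real.exp (-m) * m ^ k / (k.factorial : ℝ))) := by
    intro k
    rw [← ENNReal.ofReal_natCast, ← ENNReal.ofReal_mul (by positivity)]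
    congr 1
    have h2 := Nat.factorial_mul_descFactorial (Nat.le_add_left r k)
    rw [Nat.add_sub_cancel] at h2
    rw [← h2]
    have h3 : (k.factorial : ℝ) ≠ 0 := by positivity
    have h4 : ((k + r).descFactorial r : ℝ) ≠ 0 := by
      rw [Nat.cast_ne_zero, Ne, Nat.descFactorial_eq_zero_iff_lt]; omega
    push_cast
    field_simp
    ring
  rw [h0, zero_add]
  simp_rw [h1]
  have h2 : HasSum (fun k : ℕ => m ^ r * (Real.exp (-m) * m ^ k / (k.factorial : ℝ))) (m ^ r * 1) :=
    (hasSum_one_poissonMeasure ⟨m, hm⟩).mul_left (m ^ r)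
  rw [← ENNReal.ofReal_tsum_of_nonneg (fun k => by positivity) h2.summable, h2.tsum_eq, mul_one]

theorem pointCount_toENNReal {Ω S : Type*} (X : ℕ → Ω → S) (B : Set S) (ω : Ω) :
    ((pointCount X B ω : ℕ∞) : ℝ≥0∞) = ∑' j, B.indicator 1 (X j ω) := by
  have h := Measure.count_apply (s := {j | X j ω ∈ B}) MeasurableSet.of_discrete
  have h2 : ∀ j, B.indicator (1 : S → ℝ≥0∞) (X j ω) =
      ({j | X j ω ∈ B} : Set ℕ).indicator 1 j := fun j => by
    simp [Set.indicator]
  rw [pointCount, ← h]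
  simp_rw [h2]
  rw [← tsum_subtype, Measure.count, Measure.sum_apply _ MeasurableSet.of_discrete, tsum_subtype]
  refine tsum_congr fun j => ?_
  by_cases hj : X j ω ∈ B <;> simp [Set.indicator, hj]

section PoissonPoints

variable {Ω S : Type*} [MeasurableSpace Ω] [MeasurableSpace S] {X : ℕ → Ω → S} {μ : Measure S}
  {P : Measure Ω}

theorem IsPoissonPoints.measurable_pointCount (hX : IsPoissonPoints X μ P) {B : Set S}
    (hB : MeasurableSet B) : Measurable (pointCount X B) := by
  have h1 : Measurable fun ω => ((pointCount X B ω : ℕ∞) : ℝ≥0∞) := by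
    simp_rw [pointCount_toENNReal]
    exact Measurable.tsum fun j => (measurable_one.indicator hB).comp (hX.measurable j)
  refine measurable_to_countable' fun k => ?_
  have : pointCount X B ⁻¹' {k} = (fun ω => ((pointCount X B ω : ℕ∞) : ℝ≥0∞)) ⁻¹' {(k : ℝ≥0∞)} := by
    ext ω; simp
  rw [this]
  exact h1 (measurableSet_singleton _)

theorem IsPoissonPoints.lintegral_pointCount [IsProbabilityMeasure P]
    (hX : IsPoissonPoints X μ P) {B : Set S} (hB : MeasurableSet B) (hμ : μ B ≠ ⊤)
    (φ : ℕ∞ → ℝ≥0∞) : ∫⁻ ω, φ (pointCount X B ω) ∂P =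
      ∑' k : ℕ, φ k * ENNReal.ofReal
        (Real.exp (-(μ B).toReal) * (μ B).toReal ^ k / (k.factorial : ℝ)) := by
  have hmeas := hX.measurable_pointCount hB
  have hlaw := hX.law B hB hμ
  have hk : ∀ k : ℕ, (P.map (pointCount X B)) {(k : ℕ∞)} = ENNReal.ofReal
        (Real.exp (-(μ B).toReal) * (μ B).toReal ^ k / (k.factorial : ℝ)) := fun k => by
    rw [Measure.map_apply hmeas (measurableSet_singleton _), ← hlaw k]; rfl
  have hprob : IsProbabilityMeasure (P.map (pointCount X B)) :=
    Measure.isProbabilityMeasure_map hmeas.aemeasurable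
  have hsplit : ∀ ψ : ℕ∞ → ℝ≥0∞, ∑' k : ℕ∞, ψ k = ψ ⊤ + ∑' k : ℕ, ψ k := fun ψ => by
    classical
    rw [ENNReal.tsum_eq_add_tsum_ite (f := ψ) ⊤]
    congr 1
    rw [← Function.Injective.tsum_eq (g := ((↑) : ℕ → ℕ∞)) Nat.cast_injective]
    · exact tsum_congr fun k => by simp
    · intro k hk
      rw [Function.mem_support] at hk
      have hk' : k ≠ ⊤ := fun h => hk (if_pos h)
      exact ⟨k.toNat, ENat.natCast_toNat hk'⟩
  -- The law prescribes only finite counts, but their probabilities already add up to one.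
  have htop : (P.map (pointCount X B)) {⊤} = 0 := by
    have h1 : ∑' k : ℕ, (P.map (pointCount X B)) {(k : ℕ∞)} = 1 := by
      simp_rw [hk]
      have := tsum_descFactorial_mul_poisson (μ B).toReal ENNReal.toReal_nonneg 0
      simpa using this
    have h2 : ∫⁻ _, 1 ∂(P.map (pointCount X B)) = 1 := by simp
    rw [lintegral_countable', hsplit] at h2
    simp only [one_mul, h1] at h2
    have h3 : (P.map (pointCount X B)) {⊤} + 1 = 0 + 1 := by rw [h2, zero_add]
    exact (ENNReal.add_left_inj ENNReal.one_ne_top).1 h3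
  rw [← lintegral_map (f := φ) (measurable_of_countable φ) hmeas, lintegral_countable', hsplit,
    htop, mul_zero, zero_add]
  simp_rw [hk]

theorem IsPoissonPoints.lintegral_sum_indicator [IsProbabilityMeasure P]
    (hX : IsPoissonPoints X μ P) {B : Set S} (hB : MeasurableSet B) (hμ : μ B ≠ ⊤) :
    ∫⁻ ω, ∑' j, B.indicator 1 (X j ω) ∂P = μ B := by
  simp_rw [← pointCount_toENNReal]
  rw [hX.lintegral_pointCount hB hμ fun k => (k : ℝ≥0∞)]
  have := tsum_descFactorial_mul_poisson (μ B).toReal ENNReal.toReal_nonneg 1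
  simp only [Nat.descFactorial_one, pow_one, ENNReal.ofReal_toReal hμ] at this
  simpa using this

theorem IsPoissonPoints.lintegral_sum_indicator_sq [IsProbabilityMeasure P]
    (hX : IsPoissonPoints X μ P) {B : Set S} (hB : MeasurableSet B) (hμ : μ B ≠ ⊤) :
    ∫⁻ ω, (∑' j, B.indicator 1 (X j ω)) * (∑' j, B.indicator 1 (X j ω)) ∂P =
      μ B * μ B + μ B := by
  simp_rw [← pointCount_toENNReal]
  rw [hX.lintegral_pointCount hB hμ fun k => (k : ℝ≥0∞) * (k : ℝ≥0∞)]
  have h1 := tsum_descFactorial_mul_poisson (μ B).toReal ENNReal.toReal_nonneg 1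
  have h2 := tsum_descFactorial_mul_poisson (μ B).toReal ENNReal.toReal_nonneg 2
  have hsq : ENNReal.ofReal ((μ B).toReal ^ 2) = μ B * μ B := by
    rw [sq, ENNReal.ofReal_mul ENNReal.toReal_nonneg, ENNReal.ofReal_toReal hμ]
  rw [hsq] at h2
  rw [pow_one, ENNReal.ofReal_toReal hμ] at h1
  refine Eq.trans ?_ (congrArg₂ (· + ·) h2 h1)
  rw [← ENNReal.tsum_add]
  refine tsum_congr fun k => ?_
  rw [← add_mul]
  congr 1
  have : k * k = k.descFactorial 2 + k.descFactorial 1 := by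
    cases k with
    | zero => rfl
    | succ k => simp [Nat.descFactorial_succ]; ring
  simp only [ENat.toENNReal_coe]
  exact_mod_cast this

end PoissonPoints

/-! ### Factorial moment measures -/

section FactorialMoments

variable {Ω S : Type*} [MeasurableSpace Ω] [MeasurableSpace S] {X : ℕ → Ω → S} {μ : Measure S}
  {P : Measure Ω}

/-- The factorial moment measure of the random points `X 0, X 1, …`. -/
noncomputable def factorialMoment (X : ℕ → Ω → S) (P : Measure Ω) (n : ℕ) :
    Measure (Fin n → S) :=
  Measure.sum fun j : Fin n ↪ ℕ => P.map fun ω i => X (j i) ω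

theorem lintegral_factorialMoment (hX : ∀ j, Measurable (X j)) (n : ℕ) {g : (Fin n → S) → ℝ≥0∞}
    (hg : Measurable g) : ∫⁻ x, g x ∂(factorialMoment X P n) =
      ∑' j : Fin n ↪ ℕ, ∫⁻ ω, g (fun i => X (j i) ω) ∂P := by
  rw [factorialMoment, lintegral_sum_measure]
  exact tsum_congr fun j => lintegral_map hg (measurable_pi_lambda _ fun i => hX _)

/-- A tuple with a repeated index cannot lie in a box with disjoint sides, so the sum may run over
all tuples and becomes the product of the counts, which are independent with means `μ (A i)`. -/
theorem IsPoissonPoints.factorialMoment_pi [IsProbabilityMeasure P] (hX : IsPoissonPoints X μ P)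
    {n : ℕ} {A : Fin n → Set S} (hA : ∀ i, MeasurableSet (A i)) (hμ : ∀ i, μ (A i) ≠ ⊤)
    (hdisj : Pairwise fun i j => Disjoint (A i) (A j)) :
    factorialMoment X P n (univ.pi A) = ∏ i, μ (A i) := by
  have hmeas : ∀ i j, Measurable fun ω => (A i).indicator (1 : S → ℝ≥0∞) (X j ω) := fun i j =>
    (measurable_one.indicator (hA i)).comp (hX.measurable j)
  have hind : ∀ (j : Fin n → ℕ) ω, (univ.pi A).indicator (1 : (Fin n → S) → ℝ≥0∞)
      (fun i => X (j i) ω) = ∏ i, (A i).indicator 1 (X (j i) ω) := by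
    intro j ω
    by_cases h : ∀ i, X (j i) ω ∈ A i
    · rw [Set.indicator_of_mem (by simpa using h)]
      simp [h]
    · rw [Set.indicator_of_notMem (by simpa using h)]
      push Not at h
      obtain ⟨i, hi⟩ := h
      rw [Finset.prod_eq_zero (Finset.mem_univ i)]
      simp [hi]
  have hinj : ∑' j : Fin n ↪ ℕ, ∫⁻ ω, ∏ i, (A i).indicator (1 : S → ℝ≥0∞) (X (j i) ω) ∂P =
      ∑' j : Fin n → ℕ, ∫⁻ ω, ∏ i, (A i).indicator (1 : S → ℝ≥0∞) (X (j i) ω) ∂P := by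
    refine Function.Injective.tsum_eq (g := fun (j : Fin n ↪ ℕ) => (j : Fin n → ℕ))
      (f := fun j => ∫⁻ ω, ∏ i, (A i).indicator (1 : S → ℝ≥0∞) (X (j i) ω) ∂P)
      DFunLike.coe_injective ?_
    intro j hj
    by_contra hcon
    have hninj : ¬ Function.Injective j := fun h => hcon ⟨⟨j, h⟩, rfl⟩
    simp only [Function.Injective, not_forall] at hninj
    obtain ⟨a, b, hab, hne⟩ := hninj
    refine hj ?_
    have h0 : ∀ ω, ∏ i, (A i).indicator (1 : S → ℝ≥0∞) (X (j i) ω) = 0 := by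
      intro ω
      by_cases ha : X (j a) ω ∈ A a
      · refine Finset.prod_eq_zero (Finset.mem_univ b) ?_
        rw [← hab]
        exact Set.indicator_of_notMem (Set.disjoint_left.1 (hdisj hne) ha) _
      · exact Finset.prod_eq_zero (Finset.mem_univ a) (Set.indicator_of_notMem ha _)
    simp [h0]
  have hcount : iIndepFun (fun i ω => ∑' j, (A i).indicator (1 : S → ℝ≥0∞) (X j ω)) P := by
    have := (hX.indep n A hA hdisj).comp (fun _ k => (k : ℝ≥0∞)) fun _ => measurable_of_countable _
    convert this using 2 with i
    funext ω
    exact (pointCount_toENNReal X (A i) ω).symm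
  rw [← lintegral_indicator_one (MeasurableSet.univ_pi hA),
    lintegral_factorialMoment hX.measurable n
      (measurable_one.indicator (MeasurableSet.univ_pi hA))]
  simp_rw [hind]
  rw [hinj, ← lintegral_tsum fun j => (Finset.measurable_prod _ fun i _ => hmeas i _).aemeasurable]
  have hprod : ∀ ω, ∑' j : Fin n → ℕ, ∏ i, (A i).indicator (1 : S → ℝ≥0∞) (X (j i) ω) =
      ∏ i, ∑' k, (A i).indicator (1 : S → ℝ≥0∞) (X k ω) := fun ω =>
    (ENNReal.prod_tsum_eq_tsum_prod fun i k => (A i).indicator (1 : S → ℝ≥0∞) (X k ω)).symm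
  simp_rw [hprod]
  rw [lintegral_prod_eq_prod_lintegral_of_indepFun _ _ hcount
    fun i => Measurable.tsum fun j => hmeas i j]
  exact Finset.prod_congr rfl fun i _ => hX.lintegral_sum_indicator (hA i) (hμ i)

variable [TopologicalSpace S] [T2Space S] [SecondCountableTopology S] [OpensMeasurableSpace S]

/-- The factorial moment measure of a Poisson process on the set of tuples of distinct points. -/
theorem IsPoissonPoints.factorialMoment_restrict [IsProbabilityMeasure P] [SigmaFinite μ]
    (hX : IsPoissonPoints X μ P) (n : ℕ) :
    (factorialMoment X P n).restrict {x | Function.Injective x} =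
      (Measure.pi fun _ => μ).restrict {x | Function.Injective x} := by
  -- Basic open sets cut down to finite measure. Countably many boxes with disjoint sides from this
  -- collection cover the injective tuples, and within such a box both measures agree on all
  -- subrectangles.
  let C : Set (Set S) := {c | ∃ b ∈ TopologicalSpace.countableBasis S, ∃ k : ℕ,
    c = b ∩ spanningSets μ k}
  have hCc : C.Countable := by
    have : C = ⋃ b ∈ TopologicalSpace.countableBasis S, ⋃ k : ℕ, {b ∩ spanningSets μ k} := by
      ext c; simp [C, eq_comm]
    rw [this]
    exact (TopologicalSpace.countable_countableBasis S).biUnion fun b _ =>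
      countable_iUnion fun k => countable_singleton _
  have hCm : ∀ c ∈ C, MeasurableSet c := by
    rintro _ ⟨b, hb, k, rfl⟩
    exact ((TopologicalSpace.isOpen_of_mem_countableBasis hb).measurableSet).inter
      (measurableSet_spanningSets μ k)
  have hCμ : ∀ c ∈ C, μ c ≠ ⊤ := by
    rintro _ ⟨b, hb, k, rfl⟩
    exact ((measure_mono inter_subset_right).trans_lt (measure_spanningSets_lt_top μ k)).ne
  let I := {A : Fin n → Set S // (∀ i, A i ∈ C) ∧ Pairwise fun i j => Disjoint (A i) (A j)}
  have hI : Countable I := by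
    have : Countable C := hCc.to_subtype
    refine Function.Injective.countable (β := Fin n → C) (f := fun A i => ⟨A.1 i, A.2.1 i⟩) ?_
    intro A B h
    refine Subtype.ext (funext fun i => ?_)
    exact congrArg Subtype.val (congrFun h i)
  have hunion : {x : Fin n → S | Function.Injective x} = ⋃ A : I, univ.pi A.1 := by
    ext x
    simp only [Set.mem_ofPred_eq, mem_iUnion]
    constructor
    · intro hx
      obtain ⟨U, hU, hdisj⟩ := (Set.finite_range x).t2_separation
      have : ∀ i, ∃ c ∈ C, x i ∈ c ∧ c ⊆ U (x i) := by
        intro i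
        obtain ⟨b, hb, hxb, hbU⟩ := (TopologicalSpace.isBasis_countableBasis S).exists_subset_of_mem_open
          (hU (x i)).1 (hU (x i)).2
        obtain ⟨k, hk⟩ := mem_iUnion.1 ((iUnion_spanningSets μ).symm ▸ mem_univ (x i))
        exact ⟨_, ⟨b, hb, k, rfl⟩, ⟨hxb, hk⟩, inter_subset_left.trans hbU⟩
      choose c hc hxc hcU using this
      refine ⟨⟨c, hc, fun i j hij => ?_⟩, fun i _ => hxc i⟩
      exact (hdisj (mem_range_self i) (mem_range_self j) (hx.ne hij)).mono (hcU i) (hcU j)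
    · rintro ⟨⟨A, hA, hdisj⟩, hx⟩ i j hij
      by_contra hne
      refine Set.disjoint_left.1 (hdisj hne) (hx i (mem_univ i)) ?_
      rw [hij]; exact hx j (mem_univ j)
  rw [hunion, Measure.restrict_iUnion_congr]
  rintro ⟨A, hA, hdisj⟩
  have hAm : MeasurableSet (univ.pi A) := MeasurableSet.univ_pi fun i => hCm _ (hA i)
  have hval : ∀ B : Fin n → Set S, (∀ i, MeasurableSet (B i)) →
      factorialMoment X P n (univ.pi B ∩ univ.pi A) =
        Measure.pi (fun _ => μ) (univ.pi B ∩ univ.pi A) := by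
    intro B hB
    rw [← Set.pi_inter_distrib, Measure.pi_pi, hX.factorialMoment_pi]
    · exact fun i => (hB i).inter (hCm _ (hA i))
    · exact fun i => ((measure_mono inter_subset_right).trans_lt
        (lt_top_iff_ne_top.2 (hCμ _ (hA i)))).ne
    · exact fun i j hij => (hdisj hij).mono inter_subset_right inter_subset_right
  have huniv := hval (fun _ => univ) fun _ => MeasurableSet.univ
  have hfin : IsFiniteMeasure ((factorialMoment X P n).restrict (univ.pi A)) := by
    refine ⟨?_⟩
    simp only [Set.pi_univ, univ_inter] at huniv
    rw [Measure.restrict_apply_univ, huniv, Measure.pi_pi]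
    exact ENNReal.prod_lt_top fun i _ => lt_top_iff_ne_top.2 (hCμ _ (hA i))
  refine ext_of_generate_finite _ generateFrom_pi.symm isPiSystem_pi ?_ ?_
  · rintro _ ⟨B, hB, rfl⟩
    have hBm : ∀ i, MeasurableSet (B i) := fun i => hB i (mem_univ i)
    rw [Measure.restrict_apply (MeasurableSet.univ_pi hBm),
      Measure.restrict_apply (MeasurableSet.univ_pi hBm)]
    exact hval B hBm
  · rw [Measure.restrict_apply_univ, Measure.restrict_apply_univ]
    simpa using huniv

end FactorialMoments

instance Fin.countable_embedding_nat (n : ℕ) : Countable (Fin n ↪ ℕ) :=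
  Function.Injective.countable (f := fun j => (j : Fin n → ℕ)) DFunLike.coe_injective

section FactorialMoments

variable {Ω S : Type*} [MeasurableSpace Ω] [MeasurableSpace S] {X : ℕ → Ω → S} {μ : Measure S}
  {P : Measure Ω}

/-- The box formula says nothing about coinciding points with different indices. The second moment
`μ(B)² + μ(B)` sums over all pairs of indices, and the equal ones account for `μ(B)`, which can be
cancelled as it is finite. -/
theorem IsPoissonPoints.factorialMoment_two_le [IsProbabilityMeasure P]
    (hX : IsPoissonPoints X μ P) {B : Set S} (hB : MeasurableSet B) (hμ : μ B ≠ ⊤) :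
    factorialMoment X P 2 (univ.pi fun _ => B) ≤ μ B * μ B := by
  have hmeas : ∀ j, Measurable fun ω => B.indicator (1 : S → ℝ≥0∞) (X j ω) := fun j =>
    (measurable_one.indicator hB).comp (hX.measurable j)
  have hind : ∀ (j : Fin 2 → ℕ) ω, (univ.pi fun _ => B).indicator (1 : (Fin 2 → S) → ℝ≥0∞)
      (fun i => X (j i) ω) = ∏ i, B.indicator 1 (X (j i) ω) := by
    intro j ω
    by_cases h0 : X (j 0) ω ∈ B <;> by_cases h1 : X (j 1) ω ∈ B <;>
      simp [Set.indicator, Fin.forall_fin_two, h0, h1]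
  let a : (Fin 2 → ℕ) → ℝ≥0∞ := fun j => ∫⁻ ω, ∏ i, B.indicator 1 (X (j i) ω) ∂P
  have h1 : factorialMoment X P 2 (univ.pi fun _ => B) = ∑' j : Fin 2 ↪ ℕ, a j := by
    rw [← lintegral_indicator_one (MeasurableSet.univ_pi fun _ => hB),
      lintegral_factorialMoment hX.measurable 2
        (measurable_one.indicator (MeasurableSet.univ_pi fun _ => hB))]
    simp_rw [hind]
    rfl
  have h2 : μ B = ∑' k : ℕ, a fun _ => k := by
    rw [← hX.lintegral_sum_indicator hB hμ, lintegral_tsum fun j => (hmeas j).aemeasurable]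
    refine tsum_congr fun k => lintegral_congr fun ω => ?_
    by_cases h : X k ω ∈ B <;> simp [h]
  have h3 : ∑' j : Fin 2 → ℕ, a j = μ B * μ B + μ B := by
    rw [← hX.lintegral_sum_indicator_sq hB hμ, ← lintegral_tsum fun j =>
      (Finset.measurable_prod _ fun i _ => hmeas _).aemeasurable]
    refine lintegral_congr fun ω => ?_
    rw [← ENNReal.prod_tsum_eq_tsum_prod fun _ k => B.indicator (1 : S → ℝ≥0∞) (X k ω)]
    rw [Fin.prod_univ_two]
  have h4 : factorialMoment X P 2 (univ.pi fun _ => B) + μ B ≤ μ B * μ B + μ B := by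
    rw [← h3, h1]
    conv_lhs => rw [h2]
    let φ : (Fin 2 ↪ ℕ) ⊕ ℕ → (Fin 2 → ℕ) := Sum.elim (fun j => j) fun k _ => k
    have hφ : Function.Injective φ := by
      rintro (j | k) (j' | k') h
      · exact congrArg Sum.inl (DFunLike.coe_injective h)
      · have h0 := congrFun h 0
        have h1 := congrFun h 1
        exact absurd (j.injective (h0.trans h1.symm)) (by simp)
      · have h0 := congrFun h 0
        have h1 := congrFun h 1
        exact absurd (j'.injective (h0.symm.trans h1)) (by simp)
      · exact congrArg Sum.inr (congrFun h 0)
    have h5 : HasSum (fun x => a (φ x)) (∑' j : Fin 2 ↪ ℕ, a j + ∑' k : ℕ, a fun _ => k) :=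
      HasSum.sum (f := fun x => a (φ x)) ENNReal.summable.hasSum ENNReal.summable.hasSum
    rw [← h5.tsum_eq]
    exact ENNReal.tsum_comp_le_tsum_of_injective hφ a
  exact (ENNReal.add_le_add_iff_right hμ).1 h4

variable [TopologicalSpace S] [T2Space S] [SecondCountableTopology S] [OpensMeasurableSpace S]

theorem measurableSet_injective (n : ℕ) :
    MeasurableSet {x : Fin n → S | Function.Injective x} := by
  have : {x : Fin n → S | Function.Injective x} =
      ⋂ i : Fin n, ⋂ j : Fin n, ⋂ _ : i ≠ j, {x | x i ≠ x j} := by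
    ext x
    simp only [Set.mem_ofPred_eq, mem_iInter]
    exact ⟨fun h i j hij => h.ne hij, fun h i j => not_imp_not.1 fun hij => h i j hij⟩
  rw [this]
  refine MeasurableSet.iInter fun i => MeasurableSet.iInter fun j => MeasurableSet.iInter fun _ => ?_
  exact (isOpen_ne_fun (continuous_apply i) (continuous_apply j)).measurableSet

theorem pi_two_not_injective [SigmaFinite μ] [NullSingletonClass μ] :
    Measure.pi (fun _ : Fin 2 => μ) {x | ¬ Function.Injective x} = 0 := by
  have hdiag : MeasurableSet {p : S × S | p.1 = p.2} :=
    (isClosed_eq continuous_fst continuous_snd).measurableSet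
  have h0 : (μ.prod μ) {p : S × S | p.1 = p.2} = 0 := by
    rw [Measure.measure_prod_null hdiag]
    refine ae_of_all _ fun x => ?_
    have : Prod.mk x ⁻¹' {p : S × S | p.1 = p.2} = {x} := by ext y; simp [eq_comm]
    simp [this]
  have h1 := (measurePreserving_piFinTwo fun _ : Fin 2 => μ).measure_preimage
    hdiag.nullMeasurableSet
  refine measure_mono_null (fun x hx => ?_) (h1.trans h0)
  simp only [Function.Injective, not_forall, Set.mem_ofPred_eq, Fin.exists_fin_two] at hx
  simp only [mem_preimage, Set.mem_ofPred_eq, MeasurableEquiv.piFinTwo_apply]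
  aesop

/-- The points of a diffuse Poisson process are distinct. -/
theorem IsPoissonPoints.ae_ne [IsProbabilityMeasure P] [SigmaFinite μ] [NullSingletonClass μ]
    (hX : IsPoissonPoints X μ P) {i j : ℕ} (hij : i ≠ j) : ∀ᵐ ω ∂P, X i ω ≠ X j ω := by
  have hD := measurableSet_injective (S := S) 2
  have hB : ∀ k, factorialMoment X P 2
      ((univ.pi fun _ => spanningSets μ k) \ {x | Function.Injective x}) = 0 := by
    intro k
    have hBm := measurableSet_spanningSets μ k
    have hBμ := (measure_spanningSets_lt_top μ k).ne
    have h1 := hX.factorialMoment_two_le hBm hBμ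
    -- The injective pairs alone already use up the bound `μ(B)²`, because `μ` is diffuse and its
    -- diagonal null; nothing is left for coinciding points.
    rw [← measure_inter_add_sdiff _ hD, ← Measure.restrict_apply (MeasurableSet.univ_pi fun _ => hBm),
      hX.factorialMoment_restrict, Measure.restrict_apply (MeasurableSet.univ_pi fun _ => hBm),
      measure_inter_conull, Measure.pi_pi] at h1
    · simp only [Fin.prod_univ_two] at h1
      have h2 : μ (spanningSets μ k) * μ (spanningSets μ k) ≠ ⊤ := ENNReal.mul_ne_top hBμ hBμ
      have h3 := (ENNReal.add_le_add_iff_left (b := factorialMoment X P 2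
        ((univ.pi fun _ => spanningSets μ k) \ {x | Function.Injective x})) (c := 0) h2).1
          (by rw [add_zero]; exact h1)
      exact nonpos_iff_eq_zero.1 h3
    · refine measure_mono_null ?_ pi_two_not_injective
      exact fun x hx hinj => hx hinj
  have h0 : factorialMoment X P 2 {x | ¬ Function.Injective x} = 0 := by
    refine measure_mono_null (t := ⋃ k, (univ.pi fun _ => spanningSets μ k) \
      {x | Function.Injective x}) (fun x hx => ?_) (measure_iUnion_null hB)
    obtain ⟨k, hk⟩ := mem_iUnion.1 ((iUnion_spanningSets μ).symm ▸ mem_univ (x 0))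
    obtain ⟨l, hl⟩ := mem_iUnion.1 ((iUnion_spanningSets μ).symm ▸ mem_univ (x 1))
    refine mem_iUnion.2 ⟨max k l, fun i _ => ?_, hx⟩
    fin_cases i
    · exact monotone_spanningSets μ (le_max_left k l) hk
    · exact monotone_spanningSets μ (le_max_right k l) hl
  rw [factorialMoment, Measure.sum_apply_eq_zero] at h0
  let e : Fin 2 ↪ ℕ := ⟨![i, j], by
    intro a b h
    fin_cases a <;> fin_cases b <;> simp_all⟩
  have h1 : (Measure.map (fun ω i => X (e i) ω) P) {x | Function.Injective x}ᶜ = 0 := h0 e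
  rw [Measure.map_apply (measurable_pi_lambda _ fun i => hX.measurable _) hD.compl] at h1
  refine measure_mono_null (fun ω hω => ?_) h1
  intro hinj
  have h2 : X i ω = X j ω := not_not.1 hω
  have h3 := @hinj 0 1 h2
  simp at h3

/-- Since the points are almost surely distinct, the factorial moment measure lives on injective
tuples, where it equals the product measure. -/
theorem IsPoissonPoints.factorialMoment_le [IsProbabilityMeasure P] [SigmaFinite μ] [NullSingletonClass μ]
    (hX : IsPoissonPoints X μ P) (n : ℕ) :
    factorialMoment X P n ≤ Measure.pi fun _ => μ := by
  have hD := measurableSet_injective (S := S) n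
  have h0 : factorialMoment X P n {x | Function.Injective x}ᶜ = 0 := by
    rw [factorialMoment, Measure.sum_apply_eq_zero]
    intro j
    rw [Measure.map_apply (measurable_pi_lambda _ fun i => hX.measurable _) hD.compl]
    have : ∀ᵐ ω ∂P, ∀ a b : Fin n, a ≠ b → X (j a) ω ≠ X (j b) ω := by
      rw [ae_all_iff]; intro a
      rw [ae_all_iff]; intro b
      by_cases hab : a = b
      · exact ae_of_all _ fun ω h => absurd hab h
      · filter_upwards [hX.ae_ne (j.injective.ne hab)] with ω h _ using h
    rw [ae_iff] at this
    refine measure_mono_null ?_ this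
    exact fun ω hω hcon => hω fun a b => not_imp_not.1 (hcon a b)
  rw [← Measure.restrict_eq_self_of_ae_mem (μ := factorialMoment X P n)
    (s := {x | Function.Injective x}) h0, hX.factorialMoment_restrict]
  exact Measure.restrict_le_self

theorem IsPoissonPoints.tsum_lintegral_le [IsProbabilityMeasure P] [SigmaFinite μ] [NullSingletonClass μ]
    (hX : IsPoissonPoints X μ P) (n : ℕ) {g : (Fin n → S) → ℝ≥0∞} (hg : Measurable g) :
    ∑' j : Fin n ↪ ℕ, ∫⁻ ω, g (fun i => X (j i) ω) ∂P ≤ ∫⁻ x, g x ∂(Measure.pi fun _ => μ) := by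
  rw [← lintegral_factorialMoment hX.measurable n hg]
  exact lintegral_mono' (hX.factorialMoment_le n) le_rfl

end FactorialMoments

/-- Integrating out the first vertex replaces the weight `g` by `y ↦ ∫ g x * h x y`, whose integral
is at most `c ∫ g` by Tonelli. Hence the induction over all weights. -/
theorem lintegral_chain_le {S : Type*} [MeasurableSpace S] (μ : Measure S) [SigmaFinite μ]
    {h : S → S → ℝ≥0∞} (hh : Measurable (Function.uncurry h)) {c : ℝ≥0∞}
    (hc : ∀ x, ∫⁻ y, h x y ∂μ ≤ c) (n : ℕ) {g : S → ℝ≥0∞} (hg : Measurable g) :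
    ∫⁻ x : Fin (n + 1) → S, g (x 0) * ∏ i : Fin n, h (x i.castSucc) (x i.succ)
      ∂(Measure.pi fun _ => μ) ≤ c ^ n * ∫⁻ x, g x ∂μ := by
  induction n generalizing g with
  | zero =>
    simp only [Finset.univ_eq_empty, Finset.prod_empty, mul_one, pow_zero, one_mul]
    have := (measurePreserving_funUnique μ (Fin 1)).lintegral_comp hg
    rw [← this]
    rfl
  | succ n ih =>
    have hmp := measurePreserving_piFinSuccAbove (fun _ : Fin (n + 2) => μ) 0
    let G : S × (Fin (n + 1) → S) → ℝ≥0∞ := fun p =>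
      g p.1 * h p.1 (p.2 0) * ∏ i : Fin n, h (p.2 i.castSucc) (p.2 i.succ)
    have hh' : ∀ {α : Type _} [MeasurableSpace α] {u v : α → S}, Measurable u → Measurable v →
        Measurable fun a => h (u a) (v a) := fun hu hv => hh.comp (hu.prodMk hv)
    have hG : Measurable G := by
      refine ((hg.comp measurable_fst).mul (hh' measurable_fst
        ((measurable_pi_apply 0).comp measurable_snd))).mul (Finset.measurable_prod _ fun i _ => ?_)
      exact hh' ((measurable_pi_apply _).comp measurable_snd)
        ((measurable_pi_apply _).comp measurable_snd)
    have h1 : ∫⁻ x : Fin (n + 2) → S, g (x 0) * ∏ i : Fin (n + 1), h (x i.castSucc) (x i.succ)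
        ∂(Measure.pi fun _ => μ) =
        ∫⁻ p, G p ∂(μ.prod (Measure.pi fun _ => μ)) := by
      rw [← hmp.lintegral_comp hG]
      refine lintegral_congr fun x => ?_
      simp only [G, MeasurableEquiv.piFinSuccAbove_apply, Fin.insertNthEquiv_symm_apply,
        Fin.prod_univ_succ, Fin.castSucc_zero, mul_assoc]
      rfl
    have hgm : Measurable fun y : S => ∫⁻ x, g x * h x y ∂μ :=
      Measurable.lintegral_prod_left ((hg.comp measurable_fst).mul (hh' measurable_fst measurable_snd))
    rw [h1, lintegral_prod_symm _ hG.aemeasurable]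
    have h2 : ∀ y : Fin (n + 1) → S, ∫⁻ x, G (x, y) ∂μ =
        (∫⁻ x, g x * h x (y 0) ∂μ) * ∏ i : Fin n, h (y i.castSucc) (y i.succ) := by
      intro y
      simp only [G]
      rw [lintegral_mul_const]
      exact hg.mul (hh' measurable_id measurable_const)
    simp_rw [h2]
    refine (ih hgm).trans ?_
    rw [lintegral_lintegral_swap (((hg.comp measurable_snd).mul
      (hh' measurable_snd measurable_fst)).aemeasurable), pow_succ, mul_assoc]
    refine mul_le_mul_right ?_ _
    rw [← lintegral_const_mul _ hg]
    refine lintegral_mono fun x => ?_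
    have hm : Measurable fun y => h x y := hh' measurable_const measurable_id
    rw [lintegral_const_mul _ hm, mul_comm]
    exact mul_le_mul_left (hc x) _

/-! ### Random connection times -/

theorem expMeasure_one_le_volume : expMeasure 1 ≤ volume := by
  refine Measure.le_iff.2 fun s hs => ?_
  change (volume.withDensity (exponentialPDF 1)) s ≤ volume s
  rw [withDensity_apply _ hs, ← setLIntegral_one]
  refine lintegral_mono fun x => ?_
  change exponentialPDF 1 x ≤ 1
  rw [exponentialPDF_eq, ← ENNReal.ofReal_one]
  refine ENNReal.ofReal_le_ofReal ?_
  split_ifs with h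
  · rw [one_mul, one_mul]; exact Real.exp_le_one_iff.2 (neg_nonpos.2 h)
  · exact zero_le_one

theorem expMeasure_one_Iic_zero : expMeasure 1 (Iic 0) = 0 := by
  change (volume.withDensity (exponentialPDF 1)) (Iic 0) = 0
  rw [withDensity_apply _ measurableSet_Iic, setLIntegral_congr Iio_ae_eq_Iic.symm]
  exact lintegral_exponentialPDF_of_nonpos le_rfl

/-- The density is at most one and vanishes on negative marks. Keeping only positive marks matters
because `ENNReal.ofReal` sends all others to the same value. -/
theorem expMeasure_one_le_volume_inter (s : Set ℝ) :
    expMeasure 1 s ≤ volume (s ∩ Ioi 0) := by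
  refine le_trans ?_ (expMeasure_one_le_volume _)
  have h1 : s ⊆ (s ∩ Ioi 0) ∪ Iic 0 := fun x hx => by
    by_cases h : 0 < x
    · exact Or.inl ⟨hx, h⟩
    · exact Or.inr (not_lt.1 h)
  refine (measure_mono h1).trans ((measure_union_le _ _).trans ?_)
  rw [expMeasure_one_Iic_zero, add_zero]

/-- The probability that an exponential variable of rate `r`, started at time `b`, falls into an
interval is at most `r` times the length of the interval. -/
theorem expMeasure_one_window_le (b : ℝ) (r δ : ℝ≥0) (A : ℝ≥0∞) :
    expMeasure 1 {u | ENNReal.ofReal b + ENNReal.ofReal u / r ∈ Ico A (A + δ)} ≤ r * δ := by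
  refine (expMeasure_one_le_volume_inter _).trans ((Real.volume_le_diam _).trans ?_)
  -- Positive marks with times in the window differ by at most `r * δ`, so the diameter bounds the
  -- length. At rate zero the time of a positive mark is infinite and misses the window.
  have key : ∀ x ∈ {u | ENNReal.ofReal b + ENNReal.ofReal u / r ∈ Ico A (A + δ)} ∩ Ioi 0,
      ∀ y ∈ {u | ENNReal.ofReal b + ENNReal.ofReal u / r ∈ Ico A (A + δ)} ∩ Ioi 0,
      x ≤ y → edist x y ≤ r * δ := by
    rintro x ⟨⟨hx, -⟩, hx0⟩ y ⟨⟨-, hy⟩, hy0⟩ hxy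
    rcases eq_or_ne r 0 with rfl | hr
    · exfalso
      rw [ENNReal.coe_zero, ENNReal.div_zero (by simpa using hy0), add_top] at hy
      exact not_top_lt hy
    have hr' : (r : ℝ≥0∞) ≠ 0 := by simpa using hr
    have h1 : ENNReal.ofReal b + ENNReal.ofReal y / r ≤
        ENNReal.ofReal b + (ENNReal.ofReal x / r + δ) := by
      rw [← add_assoc]
      exact hy.le.trans (by gcongr)
    have h2 := (ENNReal.add_le_add_iff_left ENNReal.ofReal_ne_top).1 h1
    have h3 : ENNReal.ofReal y ≤ ENNReal.ofReal x + r * δ := by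
      have := mul_le_mul_right h2 (r : ℝ≥0∞)
      rwa [mul_add, ENNReal.mul_div_cancel hr' ENNReal.coe_ne_top,
        ENNReal.mul_div_cancel hr' ENNReal.coe_ne_top] at this
    rw [edist_comm, edist_dist, Real.dist_eq, abs_of_nonneg (sub_nonneg.2 hxy),
      ENNReal.ofReal_sub _ (le_of_lt hx0)]
    exact tsub_le_iff_left.2 h3
  refine Metric.ediam_le fun x hx y hy => ?_
  rcases le_total x y with h | h
  · exact key x hx y hy h
  · rw [edist_comm]; exact key y hy x hx h

/-- At most one positive mark leads to a given finite time. -/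
theorem expMeasure_one_eq_zero (b : ℝ) (r : ℝ≥0) {v : ℝ≥0∞} (hv : v ≠ ⊤) :
    expMeasure 1 {u | ENNReal.ofReal b + ENNReal.ofReal u / r = v} = 0 := by
  refine nonpos_iff_eq_zero.1 ((expMeasure_one_le_volume_inter _).trans (le_of_eq ?_))
  refine Set.Subsingleton.measure_zero ?_ _
  rintro x ⟨hx, hx0⟩ y ⟨hy, hy0⟩
  rw [Set.mem_ofPred_eq] at hx hy
  rcases eq_or_ne r 0 with rfl | hr
  · exfalso
    rw [ENNReal.coe_zero, ENNReal.div_zero (by simpa using hy0), add_top] at hy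
    exact hv hy.symm
  have hr' : (r : ℝ≥0∞) ≠ 0 := by simpa using hr
  have h1 := (ENNReal.add_right_inj ENNReal.ofReal_ne_top).1 (hx.trans hy.symm)
  have h2 := congrArg ((r : ℝ≥0∞) * ·) h1
  simp only [ENNReal.mul_div_cancel hr' ENNReal.coe_ne_top] at h2
  exact (ENNReal.ofReal_eq_ofReal_iff (le_of_lt hx0) (le_of_lt hy0)).1 h2

/-- The connection time of points at `x` and `y` whose connection has the mark `u`. -/
noncomputable def markedTime {d : ℕ} (f : ℝ≥0 → ℝ≥0) (x y : EuclideanSpace ℝ (Fin d) × ℝ)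
    (u : ℝ) : ℝ≥0∞ :=
  ENNReal.ofReal (max x.2 y.2) + ENNReal.ofReal u / ((2 * f ‖x.1 - y.1‖₊ : ℝ≥0) : ℝ≥0∞)

theorem measurable_markedTime {d : ℕ} {f : ℝ≥0 → ℝ≥0} (hf : Measurable f) {Ω : Type*}
    [MeasurableSpace Ω] {x y : Ω → EuclideanSpace ℝ (Fin d) × ℝ} {u : Ω → ℝ}
    (hx : Measurable x) (hy : Measurable y) (hu : Measurable u) :
    Measurable fun ω => markedTime f (x ω) (y ω) (u ω) := by
  unfold markedTime
  refine (hx.snd.max hy.snd).ennreal_ofReal.add (hu.ennreal_ofReal.div ?_)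
  exact (measurable_const.mul (hf.comp (hx.fst.sub hy.fst).nnnorm)).coe_nnreal_ennreal

/-- Exponential marks `U` attached to the unordered pairs of labels, independent of the positions
`Q` of the points. -/
structure IsMarking {Ω S : Type*} [MeasurableSpace Ω] [MeasurableSpace S] (Q : Ω → Label → S)
    (U : Ω → Sym2 Label → ℝ) (P : Measure Ω) : Prop where
  measurable_pos : Measurable Q
  measurable_mark : Measurable U
  law : ∀ e, P.map (fun ω => U ω e) = expMeasure 1
  indep : iIndepFun (fun e ω => U ω e) P
  indep_pos : IndepFun Q U P

namespace IsMarking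

variable {Ω S : Type*} [MeasurableSpace Ω] [MeasurableSpace S] {Q : Ω → Label → S}
  {U : Ω → Sym2 Label → ℝ} {P : Measure Ω}

/-- Given the positions, distinct pairs have independent exponential marks. -/
theorem measure_eq [IsProbabilityMeasure P] (h : IsMarking Q U P) {n : ℕ} {e : Fin n → Sym2 Label}
    (he : Function.Injective e) {E : Set ((Label → S) × (Fin n → ℝ))} (hE : MeasurableSet E) :
    P {ω | (Q ω, fun i => U ω (e i)) ∈ E} =
      ∫⁻ ω, Measure.pi (fun _ : Fin n => expMeasure 1) {u | (Q ω, u) ∈ E} ∂P := by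
  have hr : Measurable fun (u : Sym2 Label → ℝ) (i : Fin n) => u (e i) :=
    measurable_pi_lambda _ fun i => measurable_pi_apply _
  have hU : Measurable fun ω (i : Fin n) => U ω (e i) := hr.comp h.measurable_mark
  have hlaw : P.map (fun ω (i : Fin n) => U ω (e i)) = Measure.pi fun _ : Fin n => expMeasure 1 := by
    have := (iIndepFun_iff_map_fun_eq_pi_map (μ := P) (f := fun (i : Fin n) ω => U ω (e i))
      fun i => ((measurable_pi_apply i).comp hU).aemeasurable).1 (h.indep.precomp he)
    rw [this]
    exact congrArg _ (funext fun i => h.law (e i))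
  have hind : IndepFun Q (fun ω (i : Fin n) => U ω (e i)) P :=
    h.indep_pos.comp (φ := id) measurable_id hr
  have hprob : IsProbabilityMeasure (expMeasure 1) := isProbabilityMeasure_expMeasure one_pos
  have hmap := (indepFun_iff_map_prod_eq_prod_map_map h.measurable_pos.aemeasurable
    hU.aemeasurable).1 hind
  have h1 : P {ω | (Q ω, fun i => U ω (e i)) ∈ E} =
      (P.map fun ω => (Q ω, fun i => U ω (e i))) E :=
    (Measure.map_apply (h.measurable_pos.prodMk hU) hE).symm
  rw [h1, hmap, hlaw, Measure.prod_apply hE, lintegral_map (measurable_measure_prodMk_left hE)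
    h.measurable_pos]
  rfl

end IsMarking

namespace IsMarking

variable {Ω : Type*} [MeasurableSpace Ω] {d : ℕ} {Q : Ω → Label → EuclideanSpace ℝ (Fin d) × ℝ}
  {U : Ω → Sym2 Label → ℝ} {P : Measure Ω} [IsProbabilityMeasure P] {f : ℝ≥0 → ℝ≥0}

/-- Given the positions, distinct pairs have independent marks, and each connection hits the window
with probability at most its rate times `δ`. -/
theorem measure_window_le (h : IsMarking Q U P) (hf : Measurable f) {n : ℕ} {p q : Fin n → Label}
    (he : Function.Injective fun i => s(p i, q i))
    {G : Set (Label → EuclideanSpace ℝ (Fin d) × ℝ)} (hG : MeasurableSet G) (A : ℝ≥0∞) (δ : ℝ≥0) :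
    P {ω | Q ω ∈ G ∧ ∀ i, markedTime f (Q ω (p i)) (Q ω (q i)) (U ω s(p i, q i)) ∈
        Ico A (A + δ)} ≤
      ∫⁻ ω, G.indicator 1 (Q ω) *
        ∏ i, (2 * δ * f ‖(Q ω (p i)).1 - (Q ω (q i)).1‖₊ : ℝ≥0∞) ∂P := by
  have hprob : IsProbabilityMeasure (expMeasure 1) := isProbabilityMeasure_expMeasure one_pos
  let E : Set ((Label → EuclideanSpace ℝ (Fin d) × ℝ) × (Fin n → ℝ)) :=
    {x | x.1 ∈ G ∧ ∀ i, markedTime f (x.1 (p i)) (x.1 (q i)) (x.2 i) ∈ Ico A (A + δ)}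
  have hE : MeasurableSet E := by
    have : E = Prod.fst ⁻¹' G ∩
        ⋂ i, {x : (Label → EuclideanSpace ℝ (Fin d) × ℝ) × (Fin n → ℝ) |
          markedTime f (x.1 (p i)) (x.1 (q i)) (x.2 i) ∈ Ico A (A + δ)} := by
      ext x; simp [E]
    rw [this]
    refine (measurable_fst hG).inter (MeasurableSet.iInter fun i => ?_)
    exact measurable_markedTime hf ((measurable_pi_apply _).comp measurable_fst)
      ((measurable_pi_apply _).comp measurable_fst)
      ((measurable_pi_apply _).comp measurable_snd) measurableSet_Ico
  refine (h.measure_eq he hE).trans_le (lintegral_mono fun ω => ?_)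
  by_cases hω : Q ω ∈ G
  · rw [Set.indicator_of_mem hω, Pi.one_apply, one_mul]
    have hsub : {u | (Q ω, u) ∈ E} ⊆ univ.pi fun i =>
        {u | markedTime f (Q ω (p i)) (Q ω (q i)) u ∈ Ico A (A + δ)} :=
      fun u hu i _ => hu.2 i
    refine (measure_mono hsub).trans ?_
    rw [Measure.pi_pi]
    refine Finset.prod_le_prod' fun i _ => ?_
    refine (expMeasure_one_window_le _ _ _ _).trans (le_of_eq ?_)
    push_cast
    ring
  · have : {u | (Q ω, u) ∈ E} = ∅ := eq_empty_of_forall_notMem fun u hu => hω hu.1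
    rw [this, measure_empty]
    exact zero_le

/-- The finite connection times of distinct pairs are distinct. -/
theorem ae_injective (h : IsMarking Q U P) (hf : Measurable f) {p q p' q' : Label}
    (hne : s(p, q) ≠ s(p', q')) :
    ∀ᵐ ω ∂P, markedTime f (Q ω p) (Q ω q) (U ω s(p, q)) =
      markedTime f (Q ω p') (Q ω q') (U ω s(p', q')) →
      markedTime f (Q ω p) (Q ω q) (U ω s(p, q)) = ⊤ := by
  have hprob : IsProbabilityMeasure (expMeasure 1) := isProbabilityMeasure_expMeasure one_pos
  let e : Fin 2 → Sym2 Label := ![s(p, q), s(p', q')]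
  have he : Function.Injective e := by
    intro i j hij
    fin_cases i <;> fin_cases j <;> first | rfl | exact absurd hij hne | exact absurd hij.symm hne
  let τ : (Label → EuclideanSpace ℝ (Fin d) × ℝ) × (Fin 2 → ℝ) → ℝ≥0∞ := fun x =>
    markedTime f (x.1 p) (x.1 q) (x.2 0)
  let τ' : (Label → EuclideanSpace ℝ (Fin d) × ℝ) × (Fin 2 → ℝ) → ℝ≥0∞ := fun x =>
    markedTime f (x.1 p') (x.1 q') (x.2 1)
  have hτ : Measurable τ := measurable_markedTime hf ((measurable_pi_apply _).comp measurable_fst)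
      ((measurable_pi_apply _).comp measurable_fst) ((measurable_pi_apply _).comp measurable_snd)
  have hτ' : Measurable τ' := measurable_markedTime hf ((measurable_pi_apply _).comp measurable_fst)
      ((measurable_pi_apply _).comp measurable_fst) ((measurable_pi_apply _).comp measurable_snd)
  let E := {x | τ x = τ' x ∧ τ x ≠ ⊤}
  have hE : MeasurableSet E :=
    (measurableSet_eq_fun hτ hτ').inter (hτ (measurableSet_singleton ⊤).compl)
  have h0 : P {ω | (Q ω, fun i => U ω (e i)) ∈ E} = 0 := by
    rw [h.measure_eq he hE, lintegral_eq_zero_iff' ?_]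
    · refine ae_of_all _ fun ω => ?_
      let D : Set (ℝ × ℝ) := {u | markedTime f (Q ω p) (Q ω q) u.1 =
        markedTime f (Q ω p') (Q ω q') u.2 ∧ markedTime f (Q ω p) (Q ω q) u.1 ≠ ⊤}
      have hD : MeasurableSet D := by
        have h1 : Measurable fun u : ℝ × ℝ => markedTime f (Q ω p) (Q ω q) u.1 :=
          measurable_markedTime hf measurable_const measurable_const measurable_fst
        have h2 : Measurable fun u : ℝ × ℝ => markedTime f (Q ω p') (Q ω q') u.2 :=
          measurable_markedTime hf measurable_const measurable_const measurable_snd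
        exact (measurableSet_eq_fun h1 h2).inter (h1 (measurableSet_singleton ⊤).compl)
      have h1 := (measurePreserving_piFinTwo fun _ : Fin 2 => expMeasure 1).measure_preimage
        hD.nullMeasurableSet
      refine Eq.trans h1 ((Measure.measure_prod_null hD).2 ?_)
      -- With the positions and the first mark fixed, the second connection would have to hit one
      -- prescribed finite time.
      refine ae_of_all _ fun u => ?_
      by_cases hu : markedTime f (Q ω p) (Q ω q) u = ⊤
      · have : Prod.mk u ⁻¹' D = ∅ := eq_empty_of_forall_notMem fun v hv => hv.2 hu
        simp [this]
      · refine measure_mono_null (t := {v | markedTime f (Q ω p') (Q ω q') v =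
          markedTime f (Q ω p) (Q ω q) u}) (fun v hv => hv.1.symm) ?_
        exact expMeasure_one_eq_zero _ _ hu
    · exact ((measurable_measure_prodMk_left hE).comp h.measurable_pos).aemeasurable
  rw [ae_iff]
  refine measure_mono_null ?_ h0
  intro ω hω
  rw [Set.mem_ofPred_eq, Classical.not_imp] at hω
  exact hω

end IsMarking

/-! ### Connections of Poisson points -/

/-- Take the least `k` for which some term is below `(k + 1)δ`. Monotonicity keeps all later terms
below, and minimality keeps them at or above `kδ`. -/
theorem exists_eventually_window {δ : ℝ≥0∞} (hδ : δ ≠ 0) {u : ℕ → ℝ≥0∞} (hu : Antitone u)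
    (hfin : ∀ n, u n ≠ ⊤) : ∃ k N : ℕ, ∀ n, N ≤ n → u n ∈ Ico (k * δ) (k * δ + δ) := by
  classical
  have hex : ∃ k : ℕ, ∃ n, u n < k * δ + δ := by
    obtain ⟨k, hk⟩ := ENNReal.exists_nat_mul_gt hδ (hfin 0)
    exact ⟨k, 0, hk.trans_le le_self_add⟩
  obtain ⟨N, hN⟩ := Nat.find_spec hex
  refine ⟨Nat.find hex, N, fun n hn => ⟨?_, (hu hn).trans_lt hN⟩⟩
  by_contra hlt
  rw [not_le] at hlt
  cases hk : Nat.find hex with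
  | zero => rw [hk] at hlt; simp at hlt
  | succ k =>
    rw [hk] at hlt
    refine Nat.find_min hex (m := k) (by omega) ⟨n, ?_⟩
    rwa [Nat.cast_succ, add_mul, one_mul] at hlt

theorem measurable_rate {d : ℕ} {f : ℝ≥0 → ℝ≥0} (hf : Measurable f) (δ : ℝ≥0) {Ω : Type*}
    [MeasurableSpace Ω] {x y : Ω → EuclideanSpace ℝ (Fin d) × ℝ} (hx : Measurable x)
    (hy : Measurable y) : Measurable fun ω => (2 * δ * f ‖(x ω).1 - (y ω).1‖₊ : ℝ≥0∞) :=
  measurable_const.mul (hf.comp (hx.fst.sub hy.fst).nnnorm).coe_nnreal_ennreal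

namespace IsMarking

variable {Ω : Type*} [MeasurableSpace Ω] {d : ℕ} {Q : Ω → Label → EuclideanSpace ℝ (Fin d) × ℝ}
  {U : Ω → Sym2 Label → ℝ} {P : Measure Ω} [IsProbabilityMeasure P] {f : ℝ≥0 → ℝ≥0}
  {μ : Measure (EuclideanSpace ℝ (Fin d) × ℝ)} [SigmaFinite μ] [NullSingletonClass μ]
  {C : ℝ≥0∞}

/-- The expected number of paths of Poisson points with all connections in a time window. -/
theorem tsum_measure_path_le (h : IsMarking Q U P) (hf : Measurable f)
    (hX : IsPoissonPoints (fun j ω => Q ω (Sum.inr j)) μ P)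
    (hC : ∀ x : EuclideanSpace ℝ (Fin d), ∫⁻ y, (f ‖x - y.1‖₊ : ℝ≥0∞) ∂μ ≤ C) (n : ℕ)
    {B : Set (EuclideanSpace ℝ (Fin d) × ℝ)} (hB : MeasurableSet B) (A : ℝ≥0∞) (δ : ℝ≥0) :
    ∑' j : Fin (n + 1) ↪ ℕ, P {ω | Q ω (Sum.inr (j 0)) ∈ B ∧ ∀ i : Fin n,
      markedTime f (Q ω (Sum.inr (j i.castSucc))) (Q ω (Sum.inr (j i.succ)))
        (U ω s(Sum.inr (j i.castSucc), Sum.inr (j i.succ))) ∈ Ico A (A + δ)} ≤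
      (2 * δ * C) ^ n * μ B := by
  let k : (EuclideanSpace ℝ (Fin d) × ℝ) → (EuclideanSpace ℝ (Fin d) × ℝ) → ℝ≥0∞ := fun x y =>
    2 * δ * f ‖x.1 - y.1‖₊
  have hkm : Measurable (Function.uncurry k) := measurable_rate hf δ measurable_fst measurable_snd
  have hkC : ∀ x, ∫⁻ y, k x y ∂μ ≤ 2 * δ * C := fun x => by
    rw [lintegral_const_mul]
    · exact mul_le_mul_right (hC x.1) _
    · exact (hf.comp (measurable_const.sub measurable_fst).nnnorm).coe_nnreal_ennreal
  have hBm : Measurable (B.indicator (1 : EuclideanSpace ℝ (Fin d) × ℝ → ℝ≥0∞)) :=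
    measurable_one.indicator hB
  have h1 := lintegral_chain_le μ hkm hkC n hBm
  rw [lintegral_indicator_one hB] at h1
  refine le_trans ?_ h1
  refine le_trans (ENNReal.tsum_le_tsum fun j => ?_) (hX.tsum_lintegral_le (n + 1)
    (g := fun x => B.indicator 1 (x 0) * ∏ i : Fin n, k (x i.castSucc) (x i.succ)) ?_)
  -- A path through distinct vertices uses each unordered pair at most once, so its marks are
  -- independent.
  · have he : Function.Injective fun i : Fin n =>
        s((Sum.inr (j i.castSucc) : Label), Sum.inr (j i.succ)) := by
      intro a b hab
      simp only [Sym2.eq_iff, Sum.inr.injEq, j.injective.eq_iff] at hab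
      rcases hab with hab | hab
      · exact Fin.castSucc_injective n hab.1
      · have h2 := congrArg Fin.val hab.1
        have h3 := congrArg Fin.val hab.2
        simp only [Fin.val_castSucc, Fin.val_succ] at h2 h3
        omega
    have hG : MeasurableSet {q : Label → EuclideanSpace ℝ (Fin d) × ℝ | q (Sum.inr (j 0)) ∈ B} :=
      measurable_pi_apply (Sum.inr (j 0)) hB
    have h2 := h.measure_window_le hf (p := fun i : Fin n => Sum.inr (j i.castSucc))
      (q := fun i : Fin n => Sum.inr (j i.succ)) he hG A δ
    refine le_trans h2 (lintegral_mono fun ω => le_of_eq ?_)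
    simp only [k, Set.indicator, Set.mem_ofPred_eq, Pi.one_apply]
  · refine (hBm.comp (measurable_pi_apply 0)).mul (Finset.measurable_prod _ fun i _ => ?_)
    exact measurable_rate hf δ (measurable_pi_apply _) (measurable_pi_apply _)

/-- An infinite chain from a set of finite measure contains paths of every length `n`, and the
expected number of these tends to zero geometrically. Countably many starting sets suffice. -/
theorem ae_not_window_chain (h : IsMarking Q U P) (hf : Measurable f)
    (hX : IsPoissonPoints (fun j ω => Q ω (Sum.inr j)) μ P)
    (hC : ∀ x : EuclideanSpace ℝ (Fin d), ∫⁻ y, (f ‖x - y.1‖₊ : ℝ≥0∞) ∂μ ≤ C)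
    {δ : ℝ≥0} (hδ : 2 * δ * C < 1) (A : ℝ≥0∞) :
    ∀ᵐ ω ∂P, ¬ ∃ c : ℕ → ℕ, Function.Injective c ∧ ∀ n,
      markedTime f (Q ω (Sum.inr (c n))) (Q ω (Sum.inr (c (n + 1))))
        (U ω s(Sum.inr (c n), Sum.inr (c (n + 1)))) ∈ Ico A (A + δ) := by
  have key : ∀ m : ℕ, P {ω | ∃ c : ℕ → ℕ, Function.Injective c ∧
      Q ω (Sum.inr (c 0)) ∈ spanningSets μ m ∧ ∀ n,
        markedTime f (Q ω (Sum.inr (c n))) (Q ω (Sum.inr (c (n + 1))))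
          (U ω s(Sum.inr (c n), Sum.inr (c (n + 1)))) ∈ Ico A (A + δ)} = 0 := by
    intro m
    have hlim : Tendsto (fun n : ℕ => (2 * δ * C) ^ n * μ (spanningSets μ m)) atTop
        (nhds (0 * μ (spanningSets μ m))) :=
      ENNReal.Tendsto.mul_const (ENNReal.tendsto_pow_atTop_nhds_zero_of_lt_one hδ)
        (Or.inr (measure_spanningSets_lt_top μ m).ne)
    rw [zero_mul] at hlim
    refine nonpos_iff_eq_zero.1 (ge_of_tendsto' hlim fun n => ?_)
    refine le_trans (le_trans (measure_mono ?_) (measure_iUnion_le _))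
      (h.tsum_measure_path_le hf hX hC n (measurableSet_spanningSets μ m) A δ)
    rintro ω ⟨c, hc, h0, hw⟩
    exact mem_iUnion.2 ⟨⟨fun i => c i, fun a b hab => Fin.val_injective (hc hab)⟩, h0,
      fun i => hw i⟩
  have hall := ae_all_iff.2 fun m => measure_eq_zero_iff_ae_notMem.1 (key m)
  filter_upwards [hall] with ω hω
  rintro ⟨c, hc, hw⟩
  obtain ⟨m, hm⟩ := mem_iUnion.1
    ((iUnion_spanningSets μ).symm ▸ mem_univ (Q ω (Sum.inr (c 0))))
  exact hω m ⟨c, hc, hm, hw⟩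

/-- Poisson points have no infinite chain of connections with non-increasing times. -/
theorem ae_not_antitone_chain (h : IsMarking Q U P) (hf : Measurable f)
    (hX : IsPoissonPoints (fun j ω => Q ω (Sum.inr j)) μ P) (hC_top : C ≠ ⊤)
    (hC : ∀ x : EuclideanSpace ℝ (Fin d), ∫⁻ y, (f ‖x - y.1‖₊ : ℝ≥0∞) ∂μ ≤ C) :
    ∀ᵐ ω ∂P, ¬ ∃ c : ℕ → ℕ, Function.Injective c ∧
      (∀ n, markedTime f (Q ω (Sum.inr (c n))) (Q ω (Sum.inr (c (n + 1))))
        (U ω s(Sum.inr (c n), Sum.inr (c (n + 1)))) ≠ ⊤) ∧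
      Antitone fun n => markedTime f (Q ω (Sum.inr (c n))) (Q ω (Sum.inr (c (n + 1))))
        (U ω s(Sum.inr (c n), Sum.inr (c (n + 1)))) := by
  obtain ⟨δ, hδ0, hδ⟩ : ∃ δ : ℝ≥0, δ ≠ 0 ∧ 2 * (δ : ℝ≥0∞) * C < 1 := by
    lift C to ℝ≥0 using hC_top
    -- With this window length, `2δC` equals `C / (C + 1)`, which also covers `C = 0`.
    refine ⟨(2 * (C + 1))⁻¹, by positivity, ?_⟩
    rw [← ENNReal.coe_ofNat, ← ENNReal.coe_mul, ← ENNReal.coe_mul, ← ENNReal.coe_one,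
      ENNReal.coe_lt_coe]
    have : 2 * (2 * (C + 1))⁻¹ * C = C / (C + 1) := by field_simp
    rw [this, div_lt_one (by positivity)]
    exact lt_add_one C
  have hall := ae_all_iff.2 fun k : ℕ => h.ae_not_window_chain hf hX hC hδ (k * δ)
  filter_upwards [hall] with ω hω
  rintro ⟨c, hc, hfin, hanti⟩
  obtain ⟨k, N, hk⟩ := exists_eventually_window (ENNReal.coe_ne_zero.2 hδ0) hanti hfin
  exact hω k ⟨fun n => c (n + N), fun a b hab => Nat.add_right_cancel (hc hab), fun n => by
    have := hk (n + N) (Nat.le_add_left N n)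
    rwa [show n + N + 1 = n + 1 + N by omega] at this⟩

/-- A Poisson point has finitely many connections to Poisson points before a given time. -/
theorem ae_finite_poisson (h : IsMarking Q U P) (hf : Measurable f)
    (hX : IsPoissonPoints (fun j ω => Q ω (Sum.inr j)) μ P) (hC_top : C ≠ ⊤)
    (hC : ∀ x : EuclideanSpace ℝ (Fin d), ∫⁻ y, (f ‖x - y.1‖₊ : ℝ≥0∞) ∂μ ≤ C) (t : ℝ≥0) :
    ∀ᵐ ω ∂P, ∀ i : ℕ, {j : ℕ | j ≠ i ∧ markedTime f (Q ω (Sum.inr i)) (Q ω (Sum.inr j))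
      (U ω s(Sum.inr i, Sum.inr j)) < t}.Finite := by
  -- A connection before `t` is a path of length one in the window from `0` to `t`, and a finite
  -- expected number of such paths makes their number finite.
  have key : ∀ m : ℕ, ∀ᵐ ω ∂P, {j : Fin 2 ↪ ℕ | ω ∈ {ω | Q ω (Sum.inr (j 0)) ∈
      spanningSets μ m ∧ ∀ i : Fin 1,
      markedTime f (Q ω (Sum.inr (j i.castSucc))) (Q ω (Sum.inr (j i.succ)))
        (U ω s(Sum.inr (j i.castSucc), Sum.inr (j i.succ))) ∈ Ico 0 (0 + (t : ℝ≥0∞))}}.Finite := by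
    intro m
    refine ae_finite_setOfPred_mem (ne_top_of_le_ne_top ?_
      (h.tsum_measure_path_le hf hX hC 1 (measurableSet_spanningSets μ m) 0 t))
    have h2 : 2 * (t : ℝ≥0∞) * C ≠ ⊤ :=
      ENNReal.mul_ne_top (ENNReal.mul_ne_top ENNReal.ofNat_ne_top ENNReal.coe_ne_top) hC_top
    exact ENNReal.mul_ne_top (ENNReal.pow_ne_top h2) (measure_spanningSets_lt_top μ m).ne
  filter_upwards [ae_all_iff.2 key] with ω hω i
  obtain ⟨m, hm⟩ := mem_iUnion.1 ((iUnion_spanningSets μ).symm ▸ mem_univ (Q ω (Sum.inr i)))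
  refine ((hω m).image fun j => j 1).subset ?_
  rintro j ⟨hji, hj⟩
  refine ⟨⟨![i, j], ?_⟩, ⟨hm, fun a => ?_⟩, rfl⟩
  · intro a b hab
    fin_cases a <;> fin_cases b <;> first | rfl | exact absurd hab hji | exact absurd hab.symm hji
  · obtain rfl : a = 0 := Subsingleton.elim _ _
    exact ⟨zero_le, by rw [zero_add]; exact hj⟩

/-- A point that is independent of the Poisson points has finitely many connections to them before
a given time. -/
theorem ae_finite_of_indep (h : IsMarking Q U P) (hf : Measurable f)
    (hX : IsPoissonPoints (fun j ω => Q ω (Sum.inr j)) μ P) (hC_top : C ≠ ⊤)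
    (hC : ∀ x : EuclideanSpace ℝ (Fin d), ∫⁻ y, (f ‖x - y.1‖₊ : ℝ≥0∞) ∂μ ≤ C) (t : ℝ≥0) (i : ℕ)
    (hind : IndepFun (fun ω => Q ω (Sum.inl i)) (fun ω j => Q ω (Sum.inr j)) P) :
    ∀ᵐ ω ∂P, {j : ℕ | markedTime f (Q ω (Sum.inl i)) (Q ω (Sum.inr j))
      (U ω s(Sum.inl i, Sum.inr j)) < t}.Finite := by
  let k : (EuclideanSpace ℝ (Fin d) × ℝ) → (EuclideanSpace ℝ (Fin d) × ℝ) → ℝ≥0∞ := fun x y =>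
    2 * t * f ‖x.1 - y.1‖₊
  have hkm : Measurable (Function.uncurry k) := measurable_rate hf t measurable_fst measurable_snd
  have hkm' : ∀ x, Measurable (k x) := fun x =>
    measurable_rate hf t measurable_const measurable_id
  have hpos : ∀ l, Measurable fun ω => Q ω l := fun l =>
    (measurable_pi_apply l).comp h.measurable_pos
  have hkC : ∀ x, ∫⁻ y, k x y ∂μ ≤ 2 * t * C := fun x => by
    rw [lintegral_const_mul]
    · exact mul_le_mul_right (hC x.1) _
    · exact (hf.comp (measurable_const.sub measurable_fst).nnnorm).coe_nnreal_ennreal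
  -- The bound is uniform in the position `x`, so it survives integration over any law of the
  -- augmentation point.
  have hsum : ∀ x, ∑' j : ℕ, ∫⁻ ω, k x (Q ω (Sum.inr j)) ∂P ≤ 2 * t * C := by
    intro x
    have hg : Measurable fun y : Fin 1 → EuclideanSpace ℝ (Fin d) × ℝ => k x (y 0) :=
      (hkm' x).comp (measurable_pi_apply 0)
    have h1 := hX.tsum_lintegral_le 1 hg
    have h2 : ∫⁻ y : Fin 1 → EuclideanSpace ℝ (Fin d) × ℝ, k x (y 0) ∂(Measure.pi fun _ => μ) =
        ∫⁻ y, k x y ∂μ :=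
      (measurePreserving_funUnique μ (Fin 1)).lintegral_comp (hkm' x)
    refine le_trans ?_ ((h1.trans_eq h2).trans (hkC x))
    let φ : ℕ → (Fin 1 ↪ ℕ) := fun j => ⟨fun _ => j, fun a b _ => Subsingleton.elim a b⟩
    have hφ : Function.Injective φ := fun a b hab => congrArg (fun j : Fin 1 ↪ ℕ => j 0) hab
    exact ENNReal.tsum_comp_le_tsum_of_injective hφ
      fun j : Fin 1 ↪ ℕ => ∫⁻ ω, k x (Q ω (Sum.inr (j 0))) ∂P
  have hle : ∀ j : ℕ, P {ω | Q ω ∈ univ ∧ ∀ _ : Fin 1, markedTime f (Q ω (Sum.inl i))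
      (Q ω (Sum.inr j)) (U ω s(Sum.inl i, Sum.inr j)) ∈ Ico 0 (0 + (t : ℝ≥0∞))} ≤
      ∫⁻ x, ∫⁻ ω, k x (Q ω (Sum.inr j)) ∂P ∂(P.map fun ω => Q ω (Sum.inl i)) := by
    intro j
    refine (h.measure_window_le hf (p := fun _ : Fin 1 => Sum.inl i) (q := fun _ => Sum.inr j)
      (fun a b _ => Subsingleton.elim a b) MeasurableSet.univ 0 t).trans (le_of_eq ?_)
    have hj : Measurable fun y : ℕ → EuclideanSpace ℝ (Fin d) × ℝ => y j := measurable_pi_apply j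
    have hij : IndepFun (fun ω => Q ω (Sum.inl i)) (fun ω => Q ω (Sum.inr j)) P :=
      hind.comp measurable_id hj
    have hmap := (indepFun_iff_map_prod_eq_prod_map_map (hpos (Sum.inl i)).aemeasurable
      (hpos (Sum.inr j)).aemeasurable).1 hij
    have h1 : ∫⁻ ω, k (Q ω (Sum.inl i)) (Q ω (Sum.inr j)) ∂P =
        ∫⁻ z, Function.uncurry k z ∂(P.map fun ω => (Q ω (Sum.inl i), Q ω (Sum.inr j))) :=
      (lintegral_map hkm ((hpos _).prodMk (hpos _))).symm
    have hprob : IsProbabilityMeasure (P.map fun ω => Q ω (Sum.inr j)) :=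
      Measure.isProbabilityMeasure_map (hpos _).aemeasurable
    rw [hmap, lintegral_prod _ hkm.aemeasurable] at h1
    have h2 : ∀ x, ∫⁻ y, Function.uncurry k (x, y) ∂(P.map fun ω => Q ω (Sum.inr j)) =
        ∫⁻ ω, k x (Q ω (Sum.inr j)) ∂P := fun x => lintegral_map (hkm' x) (hpos _)
    simp_rw [h2] at h1
    rw [← h1]
    refine lintegral_congr fun ω => ?_
    simp [k]
  have hfin : ∑' j : ℕ, P {ω | Q ω ∈ univ ∧ ∀ _ : Fin 1, markedTime f (Q ω (Sum.inl i))
      (Q ω (Sum.inr j)) (U ω s(Sum.inl i, Sum.inr j)) ∈ Ico 0 (0 + (t : ℝ≥0∞))} ≠ ⊤ := by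
    have hprob : IsProbabilityMeasure (P.map fun ω => Q ω (Sum.inl i)) :=
      Measure.isProbabilityMeasure_map (hpos _).aemeasurable
    refine ne_top_of_le_ne_top ?_ ((ENNReal.tsum_le_tsum hle).trans ?_) (b := 2 * t * C)
    · exact ENNReal.mul_ne_top (ENNReal.mul_ne_top ENNReal.ofNat_ne_top ENNReal.coe_ne_top) hC_top
    · rw [← lintegral_tsum]
      · refine (lintegral_mono hsum).trans ?_
        rw [lintegral_const, measure_univ, mul_one]
      · intro j
        have : Measurable (Function.uncurry fun x ω => k x (Q ω (Sum.inr j))) :=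
          measurable_rate hf t measurable_fst ((hpos _).comp measurable_snd)
        exact this.lintegral_prod_right'.aemeasurable
  filter_upwards [ae_finite_setOfPred_mem hfin] with ω hω
  refine hω.subset fun j hj => ⟨mem_univ _, fun _ => ⟨zero_le, ?_⟩⟩
  rw [zero_add]; exact hj

end IsMarking

/-! ### The random connections -/

section RandomConnections

variable {d : ℕ}

theorem connTime_eq_markedTime (f : ℝ≥0 → ℝ≥0) (pos : Label → EuclideanSpace ℝ (Fin d) × ℝ)
    (mark : Sym2 Label → ℝ × Bool) (p q : Label) :
    connTime f pos mark p q = markedTime f (pos p) (pos q) (mark s(p, q)).1 := by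
  rw [connTime, markedTime, ENNReal.coe_mul, ENNReal.coe_ofNat]

theorem connTime_comm (f : ℝ≥0 → ℝ≥0) (pos : Label → EuclideanSpace ℝ (Fin d) × ℝ)
    (mark : Sym2 Label → ℝ × Bool) (p q : Label) :
    connTime f pos mark p q = connTime f pos mark q p := by
  rw [connTime, connTime, max_comm, Sym2.eq_swap, ← nnnorm_neg, neg_sub]

theorem connDir_flip (mark : Sym2 Label → ℝ × Bool) {p q : Label} (hpq : p ≠ q) :
    connDir mark q p = !connDir mark p q := by
  have hne := Equiv.natSumNatEquivNat.injective.ne hpq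
  rw [connDir, connDir, Sym2.eq_swap]
  rcases lt_or_gt_of_ne hne with h | h
  · rw [if_neg h.not_gt, if_pos h]
  · rw [if_pos h, if_neg h.not_gt, Bool.not_not]

theorem disjoint_augLabels_birthLabels (N₀ : ℕ∞) : Disjoint (augLabels N₀) birthLabels := by
  refine Set.disjoint_left.2 ?_
  rintro _ ⟨i, -, rfl⟩ ⟨j, hj⟩
  exact absurd hj Sum.inr_ne_inl

/-- Translation invariance removes `x`, and the birth time contributes the factor `t₁`. This is the
constant `C` of the path bound. -/
theorem lintegral_birth_le {f : ℝ≥0 → ℝ≥0} (hf : Measurable f) (lam t₁ : ℝ≥0)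
    (x : EuclideanSpace ℝ (Fin d)) :
    ∫⁻ y : EuclideanSpace ℝ (Fin d) × ℝ, (f ‖x - y.1‖₊ : ℝ≥0∞)
      ∂(lam • (volume.restrict ((Set.univ : Set (EuclideanSpace ℝ (Fin d))) ×ˢ
        Set.Ioo (0 : ℝ) (t₁ : ℝ)))) ≤
      lam * ((∫⁻ y : EuclideanSpace ℝ (Fin d), (f ‖y‖₊ : ℝ≥0∞)) * t₁) := by
  have hm : Measurable fun y : EuclideanSpace ℝ (Fin d) => (f ‖x - y‖₊ : ℝ≥0∞) :=
    (hf.comp (measurable_const.sub measurable_id).nnnorm).coe_nnreal_ennreal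
  have hm' : Measurable fun y : EuclideanSpace ℝ (Fin d) × ℝ => (f ‖x - y.1‖₊ : ℝ≥0∞) :=
    hm.comp measurable_fst
  have h1 : (volume.restrict ((Set.univ : Set (EuclideanSpace ℝ (Fin d))) ×ˢ
      Set.Ioo (0 : ℝ) (t₁ : ℝ))) = (volume : Measure (EuclideanSpace ℝ (Fin d))).prod
        (volume.restrict (Set.Ioo (0 : ℝ) (t₁ : ℝ))) := by
    rw [Measure.volume_eq_prod, ← Measure.prod_restrict, Measure.restrict_univ]
  rw [h1, lintegral_smul_measure, lintegral_prod _ hm'.aemeasurable]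
  simp only [lintegral_const, Measure.restrict_apply MeasurableSet.univ, univ_inter,
    Real.volume_Ioo, sub_zero, ENNReal.ofReal_coe_nnreal]
  rw [lintegral_mul_const _ hm, lintegral_sub_left_eq_self fun y => (f ‖y‖₊ : ℝ≥0∞)]
  exact le_rfl

theorem exists_forall_inr_of_not_frequently {c : ℕ → Label} {N₀ : ℕ∞}
    (hc : ∀ n, c n ∈ augLabels N₀ ∪ birthLabels) (hfreq : ¬ ∃ᶠ n in atTop, c n ∈ augLabels N₀) :
    ∃ (m : ℕ) (b : ℕ → ℕ), ∀ n, c (n + m) = Sum.inr (b n) := by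
  rw [not_frequently, eventually_atTop] at hfreq
  obtain ⟨m, hm⟩ := hfreq
  have : ∀ n, ∃ j, c (n + m) = Sum.inr j := fun n => by
    rcases hc (n + m) with h | ⟨j, hj⟩
    · exact absurd h (hm _ (Nat.le_add_left m n))
    · exact ⟨j, hj.symm⟩
  choose b hb using this
  exact ⟨m, b, hb⟩

variable {Ω : Type*} [MeasurableSpace Ω] {P : Measure Ω}

theorem isMarking_of_indepFun {ψ : ℕ → Ω → EuclideanSpace ℝ (Fin d) × ℝ}
    (hψ : ∀ j, Measurable (ψ j)) {N₀ : Ω → ℕ∞} {ζ : ℕ → Ω → EuclideanSpace ℝ (Fin d)}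
    (hζ : ∀ i, Measurable (ζ i)) {mark : Sym2 Label → Ω → ℝ × Bool}
    (hmark : ∀ e, Measurable (mark e))
    (h_mark_law : ∀ e, P.map (mark e) = (expMeasure 1).prod (PMF.uniformOfFintype Bool).toMeasure)
    (h_mark_indep : iIndepFun mark P)
    (h_mark_points : IndepFun (fun ω => ((N₀ ω, fun i => ζ i ω), fun j => ψ j ω))
      (fun ω e => mark e ω) P) :
    IsMarking (fun ω => position (fun i => ζ i ω) (fun j => ψ j ω)) (fun ω e => (mark e ω).1) P := by
  have hU : Measurable fun (u : Sym2 Label → ℝ × Bool) e => (u e).1 :=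
    measurable_pi_lambda _ fun e => (measurable_pi_apply e).fst
  have hQ : Measurable fun x : (ℕ∞ × (ℕ → EuclideanSpace ℝ (Fin d))) ×
      (ℕ → EuclideanSpace ℝ (Fin d) × ℝ) => position x.1.2 x.2 := by
    refine measurable_pi_lambda _ fun p => ?_
    cases p with
    | inl i =>
      exact ((measurable_pi_apply i).comp measurable_fst.snd).prodMk measurable_const
    | inr j => exact (measurable_pi_apply j).comp measurable_snd
  refine ⟨measurable_pi_lambda _ fun p => ?_, measurable_pi_lambda _ fun e => (hmark e).fst,
    fun e => ?_, h_mark_indep.comp (fun _ => Prod.fst) fun _ => measurable_fst,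
    h_mark_points.comp hQ hU⟩
  · cases p with
    | inl i => exact (hζ i).prodMk measurable_const
    | inr j => exact hψ j
  · have h1 : P.map (fun ω => (mark e ω).1) = (P.map (mark e)).map Prod.fst :=
      (Measure.map_map measurable_fst (hmark e)).symm
    rw [h1, h_mark_law e]
    exact Measure.map_fst_prod.trans (by rw [measure_univ, one_smul])

/-- The connections of the points of the augmentation and the births are almost surely good. -/
theorem ae_goodConnections [IsProbabilityMeasure P] {f : ℝ≥0 → ℝ≥0} (hf : Measurable f)
    (hf_fin : ∫⁻ x : EuclideanSpace ℝ (Fin d), (f ‖x‖₊ : ℝ≥0∞) < ⊤) {lam t₁ : ℝ≥0}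
    {ψ : ℕ → Ω → EuclideanSpace ℝ (Fin d) × ℝ}
    (hψ : IsPoissonPoints ψ
      (lam • (volume.restrict ((Set.univ : Set (EuclideanSpace ℝ (Fin d))) ×ˢ
        Set.Ioo (0 : ℝ) (t₁ : ℝ)))) P)
    {N₀ : Ω → ℕ∞} {ζ : ℕ → Ω → EuclideanSpace ℝ (Fin d)} (hζ : ∀ i, Measurable (ζ i))
    (h_indep_init : IndepFun (fun ω => (N₀ ω, fun i => ζ i ω)) (fun ω j => ψ j ω) P)
    {mark : Sym2 Label → Ω → ℝ × Bool} (hmark : ∀ e, Measurable (mark e))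
    (h_mark_law : ∀ e, P.map (mark e) = (expMeasure 1).prod (PMF.uniformOfFintype Bool).toMeasure)
    (h_mark_indep : iIndepFun mark P)
    (h_mark_points : IndepFun (fun ω => ((N₀ ω, fun i => ζ i ω), fun j => ψ j ω))
      (fun ω e => mark e ω) P)
    (h_init₁ : ∀ᵐ ω ∂P,
      let T := connTime f (position (fun i => ζ i ω) (fun j => ψ j ω)) (fun e => mark e ω)
      ∀ p ∈ augLabels (N₀ ω) ∪ birthLabels, {z | z ∈ augLabels (N₀ ω) ∧ T p z < t₁}.Finite)
    (h_init₂ : ∀ᵐ ω ∂P,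
      let T := connTime f (position (fun i => ζ i ω) (fun j => ψ j ω)) (fun e => mark e ω)
      ¬ ∃ c : ℕ → Label, Function.Injective c ∧ (∀ n, c n ∈ augLabels (N₀ ω) ∪ birthLabels) ∧
        (∃ᶠ n in atTop, c n ∈ augLabels (N₀ ω)) ∧
        (∀ n, T (c n) (c (n + 1)) < t₁) ∧ Antitone (fun n => T (c n) (c (n + 1)))) :
    ∀ᵐ ω ∂P, GoodConnections (augLabels (N₀ ω) ∪ birthLabels)
      (connTime f (position (fun i => ζ i ω) (fun j => ψ j ω)) (fun e => mark e ω))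
      (connDir (fun e => mark e ω)) t₁ := by
  have hM := isMarking_of_indepFun hψ.measurable hζ hmark h_mark_law h_mark_indep h_mark_points
  set μ : Measure (EuclideanSpace ℝ (Fin d) × ℝ) :=
    lam • (volume.restrict ((Set.univ : Set (EuclideanSpace ℝ (Fin d))) ×ˢ
        Set.Ioo (0 : ℝ) (t₁ : ℝ))) with hμ
  have hσ : SigmaFinite μ := by rw [hμ]; infer_instance
  have hna : NullSingletonClass μ := by
    refine ⟨fun x => ?_⟩
    have hx : (volume : Measure (EuclideanSpace ℝ (Fin d) × ℝ)) {x} = 0 := by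
      rw [← Prod.mk.eta (p := x), ← singleton_prod_singleton, Measure.volume_eq_prod,
        Measure.prod_prod, Real.volume_singleton, mul_zero]
    rw [hμ, Measure.smul_apply, Measure.absolutelyContinuous_of_le Measure.restrict_le_self hx,
      smul_zero]
  have hC : ∀ x : EuclideanSpace ℝ (Fin d), ∫⁻ y, (f ‖x - y.1‖₊ : ℝ≥0∞) ∂μ ≤
      lam * ((∫⁻ y : EuclideanSpace ℝ (Fin d), (f ‖y‖₊ : ℝ≥0∞)) * t₁) :=
    lintegral_birth_le hf lam t₁
  have hC_top : lam * ((∫⁻ y : EuclideanSpace ℝ (Fin d), (f ‖y‖₊ : ℝ≥0∞)) * t₁) ≠ ⊤ :=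
    ENNReal.mul_ne_top ENNReal.coe_ne_top (ENNReal.mul_ne_top hf_fin.ne ENNReal.coe_ne_top)
  have h_inj : ∀ᵐ ω ∂P, ∀ p q p' q' : Label, s(p, q) ≠ s(p', q') →
      connTime f (position (fun i => ζ i ω) (fun j => ψ j ω)) (fun e => mark e ω) p q =
      connTime f (position (fun i => ζ i ω) (fun j => ψ j ω)) (fun e => mark e ω) p' q' →
      connTime f (position (fun i => ζ i ω) (fun j => ψ j ω)) (fun e => mark e ω) p q = ⊤ := by
    simp only [ae_all_iff]
    intro p q p' q' hne
    simp only [connTime_eq_markedTime]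
    exact hM.ae_injective hf hne
  have h_fin_aug : ∀ᵐ ω ∂P, ∀ i : ℕ, {j : ℕ | connTime f (position (fun i => ζ i ω)
      (fun j => ψ j ω)) (fun e => mark e ω) (Sum.inl i) (Sum.inr j) < t₁}.Finite := by
    rw [ae_all_iff]
    intro i
    simp only [connTime_eq_markedTime]
    refine hM.ae_finite_of_indep hf hψ hC_top hC t₁ i ?_
    have hi : Measurable fun x : ℕ∞ × (ℕ → EuclideanSpace ℝ (Fin d)) => (x.2 i, (0 : ℝ)) :=
      ((measurable_pi_apply i).comp measurable_snd).prodMk measurable_const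
    exact h_indep_init.comp hi measurable_id
  have h_fin_birth := hM.ae_finite_poisson hf hψ hC_top hC t₁
  have h_chain := hM.ae_not_antitone_chain hf hψ hC_top hC
  filter_upwards [h_init₁, h_init₂, h_inj, h_fin_aug, h_fin_birth, h_chain] with ω hi₁ hi₂ hinj
    hfa hfb hch
  simp only [← connTime_eq_markedTime f _ fun e => mark e ω] at hfb hch
  refine ⟨connTime_comm _ _ _, fun p q => connDir_flip _, ?_, fun p hp => ?_, ?_⟩
  · intro p _ q _ p' _ q' _ _ _ heq hlt
    by_contra hne
    rw [hinj p q p' q' hne heq] at hlt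
    exact not_top_lt hlt
  · have hb : {j : ℕ | Sum.inr j ≠ p ∧ connTime f (position (fun i => ζ i ω) (fun j => ψ j ω))
        (fun e => mark e ω) p (Sum.inr j) < t₁}.Finite := by
      cases p with
      | inl i => exact (hfa i).subset fun j hj => hj.2
      | inr i => exact (hfb i).subset fun j hj => ⟨fun h => hj.1 (congrArg Sum.inr h), hj.2⟩
    -- The singleton is needed because local finiteness does not exclude `q = p`, and the
    -- meaningless value `T p p` may be below `t₁`.
    refine (((hi₁ p hp).union (hb.image Sum.inr)).union (Set.finite_singleton p)).subset ?_
    rintro q ⟨hq | ⟨j, rfl⟩, hlt⟩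
    · exact Or.inl (Or.inl ⟨hq, hlt⟩)
    · by_cases hqp : (Sum.inr j : Label) = p
      · exact Or.inr hqp
      · exact Or.inl (Or.inr ⟨j, ⟨hqp, hlt⟩, rfl⟩)
  · rintro ⟨c, hc, hcV, hlt, hanti⟩
    -- A chain returning to the augmentation forever is excluded by assumption. Any other chain
    -- consists of births from some index on, and this tail contradicts the result for Poisson
    -- points.
    obtain ⟨m, b, hb⟩ := exists_forall_inr_of_not_frequently hcV
      fun hfreq => hi₂ ⟨c, hc, hcV, hfreq, hlt, hanti⟩
    have hb' : ∀ n, c (n + m + 1) = Sum.inr (b (n + 1)) := fun n => by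
      rw [← hb (n + 1)]; congr 1; omega
    refine hch ⟨b, fun i j hij => ?_, fun n => ?_, fun i j hij => ?_⟩
    · have : c (i + m) = c (j + m) := by rw [hb, hb, hij]
      exact Nat.add_right_cancel (hc this)
    · rw [← hb, ← hb']
      exact ((hlt _).trans_le le_top).ne
    · simp only [← hb, add_right_comm _ 1 m]
      exact hanti (Nat.add_le_add_right hij m)

end RandomConnections

theorem mainTheorem9 {Ω : Type*} [MeasurableSpace Ω] (P : Measure Ω) [IsProbabilityMeasure P]
    (d : ℕ)
    -- the response function
    (f : ℝ≥0 → ℝ≥0) (hf_meas : Measurable f) (hf_zero : f 0 = 0)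
    (hf_pos : 0 < ∫⁻ x : EuclideanSpace ℝ (Fin d), (f ‖x‖₊ : ℝ≥0∞))
    (hf_fin : ∫⁻ x : EuclideanSpace ℝ (Fin d), (f ‖x‖₊ : ℝ≥0∞) < ⊤)
    -- birth rate and time horizon
    (lam t₁ : ℝ≥0) (hlam : 0 < lam) (ht₁ : 0 < t₁)
    -- the births: a Poisson process on space times (0, t₁)
    (ψ : ℕ → Ω → EuclideanSpace ℝ (Fin d) × ℝ)
    (hψ : IsPoissonPoints ψ
      (lam • (volume.restrict ((Set.univ : Set (EuclideanSpace ℝ (Fin d))) ×ˢ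
        Set.Ioo (0 : ℝ) (t₁ : ℝ)))) P)
    -- the augmentation: a point process independent of the births
    (N₀ : Ω → ℕ∞) (hN₀ : Measurable N₀)
    (ζ : ℕ → Ω → EuclideanSpace ℝ (Fin d)) (hζ : ∀ i, Measurable (ζ i))
    (h_indep_init : IndepFun (fun ω => (N₀ ω, fun i => ζ i ω)) (fun ω j => ψ j ω) P)
    -- independent pairwise marks, independent of all the points
    (mark : Sym2 Label → Ω → ℝ × Bool) (hmark : ∀ e, Measurable (mark e))
    (h_mark_law : ∀ e, P.map (mark e) = (expMeasure 1).prod (PMF.uniformOfFintype Bool).toMeasure)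
    (h_mark_indep : iIndepFun mark P)
    (h_mark_points : IndepFun (fun ω => ((N₀ ω, fun i => ζ i ω), fun j => ψ j ω))
      (fun ω e => mark e ω) P)
    -- every point has finitely many connections with the augmentation before t₁
    (h_init₁ : ∀ᵐ ω ∂P,
      let T := connTime f (position (fun i => ζ i ω) (fun j => ψ j ω)) (fun e => mark e ω)
      ∀ p ∈ augLabels (N₀ ω) ∪ birthLabels, {z | z ∈ augLabels (N₀ ω) ∧ T p z < t₁}.Finite)
    -- no infinite non-increasing chain of connections visits the augmentation infinitely often
    (h_init₂ : ∀ᵐ ω ∂P,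
      let T := connTime f (position (fun i => ζ i ω) (fun j => ψ j ω)) (fun e => mark e ω)
      ¬ ∃ c : ℕ → Label, Function.Injective c ∧ (∀ n, c n ∈ augLabels (N₀ ω) ∪ birthLabels) ∧
        (∃ᶠ n in atTop, c n ∈ augLabels (N₀ ω)) ∧
        (∀ n, T (c n) (c (n + 1)) < t₁) ∧ Antitone (fun n => T (c n) (c (n + 1)))) :
    ∀ᵐ ω ∂P,
      let Z₀ : Set Label := augLabels (N₀ ω)
      let W : Set Label := birthLabels
      let T := connTime f (position (fun i => ζ i ω) (fun j => ψ j ω)) (fun e => mark e ω)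
      let I := connDir (fun e => mark e ω)
      -- for all predefined orderings of the points
      ∀ ord ord₁ ord₂ : Label → ℕ,
        Set.InjOn ord (Z₀ ∪ W) → Set.InjOn ord₁ W → Set.InjOn ord₂ (Z₀ ∪ W) →
        ZState.RunsUnambiguously Z₀ W T I t₁ ord ∧
        -- for all executions of Sheriff with zombies and of Sheriff without and with augmentation
        ∀ (s : ℕ → ZState Label) (σ₁ σ₂ : ℕ → SheriffState Label),
          ZState.IsZRun Z₀ W T I t₁ ord s →
          SheriffState.IsSheriffRun W T I t₁ ord₁ σ₁ →
          SheriffState.IsSheriffRun (Z₀ ∪ W) T I t₁ ord₂ σ₂ →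
          -- death times without and with augmentation; the points of `Z₀` count as dead in the non-augmented system
          let dd : Label → ℝ≥0∞ := SheriffState.nonAugmentedDeathTime Z₀ T σ₁
          let dd' : Label → ℝ≥0∞ := SheriffState.deathTime T σ₂
          (∀ p ∈ Z₀ ∪ W, ∀ᶠ n in atTop, (s n).Finished Z₀ W T t₁ p) ∧
          (∀ p ∈ W, ∀ᶠ n in atTop, (s n).e p = dd p) ∧
          (∀ p ∈ Z₀ ∪ W, ∀ᶠ n in atTop, (s n).e' p = dd' p) ∧
          (∀ t : ℝ≥0∞, t < t₁ → ∀ p ∈ Z₀ ∪ W,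
            ((∃ z ∈ Z₀, p ∈ ZState.antizombiesAt T s z t) ↔ dd' p ≤ t ∧ t < dd p) ∧
            ((∃ z ∈ Z₀, p ∈ ZState.zombiesAt T s z t) ↔ dd p ≤ t ∧ t < dd' p)) ∧
          (∀ z ∈ Z₀, ∀ z' ∈ Z₀, z ≠ z' →
            Disjoint (ZState.offspring T t₁ s z) (ZState.offspring T t₁ s z'))
          := by
  filter_upwards [ae_goodConnections hf_meas hf_fin hψ hζ h_indep_init hmark h_mark_law h_mark_indep
    h_mark_points h_init₁ h_init₂] with ω hω
  exact hω.sheriff_with_zombies (disjoint_augLabels_birthLabels (N₀ ω))
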